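/- Let $S=S_1\cup S_2\subset\mathbb R^2$ be the union of two disjoint open balls of radii $r_1,r_2>0$ (the balls may touch). For a measurable set $X\subset\mathbb R^2$ let $|X|$ be its area and $P(X)=|D\chi_X|(\mathbb R^2)$ its perimeter, with $P(X)=+\infty$ if $\chi_X\notin BV(\mathbb R^2)$. For $\lambda>0$ and $s\ge 0$ put $$\mathcal F_{s,\lambda}(X)=P(X)+\frac s\lambda\,|X\setminus S|-\frac{1-s}\lambda\,|X\cap S| .$$ For $0<r<\infty$ let $\mathrm{Close}_r(S)$ be the complement of the union of all open balls of radius $r$ contained in $\mathbb R^2\setminus S$; moreover let $\mathrm{Close}_0(S)=S$ and $\mathrm{Close}_\infty(S)=\mathrm{co}(S)$, the convex hull of $S$, and read $\lambda/0=\infty$ for $\lambda>0$. Let $R_c(S)$ be the infimum of the radii $r\in(0,\infty]$ for which $\mathrm{Close}_r(S)$ is connected. Then $R_c(S)<\infty$; for every $r\in(0,\infty]$ the set $\mathrm{Close}_r(S)$ is connected if and only if $r\ge R_c(S)$; $P(\mathrm{Close}_r(S))<\infty$ for all $r\in[R_c(S),\infty]$; and the following hold. (i) Let $\kappa>0$ and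 $s_\kappa(\lambda)=1-\frac\lambda\kappa$. The map $\lambda\mapsto \mathcal F_{s_\kappa(\lambda),\lambda}\bigl(\mathrm{Close}_{\lambda/s_\kappa(\lambda)}(S)\bigr)$ is continuous and strictly decreasing on the set of all $\lambda\in(0,\kappa]$ with $\frac{\lambda}{s_\kappa(\lambda)}\ge R_c(S)$, i.e. as long as $\mathrm{Close}_{\lambda/s_\kappa(\lambda)}(S)$ is connected. (ii) Let $\lambda>0$. The map $s\mapsto\mathcal F_{s,\lambda}\bigl(\mathrm{Close}_{\lambda/s}(S)\bigr)$ is continuous and strictly increasing on the set of all $s\ge 0$ with $\frac\lambda s\ge R_c(S)$, i.e. as long as $\mathrm{Close}_{\lambda/s}(S)$ is connected. (iii) The functions $$r\mapsto P(\mathrm{Close}_r(S))+\frac1r|\mathrm{Close}_r(S)|\qquad\text{and}\qquad r\mapsto P(\mathrm{Close}_r(S))+\frac1r|\mathrm{Close}_r(S)\setminus S|$$ are continuous and strictly decreasing on $[R_c(S),\infty]$, with values in $[0,\infty]$. Here the terms with the factor $\frac1r$ are $0$ at $r=\infty$; and if $R_c(S)=0$ (touching balls), the first function is understood to be $+\infty$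 at $r=0$ and the second to be $P(S)$ at $r=0$. -/

import Mathlib

open scoped ENNReal ContDiff

noncomputable section

namespace TwoBalls

/-- The Euclidean plane, with its Lebesgue measure `MeasureTheory.volume`. -/
abbrev Plane : Type := EuclideanSpace ℝ (Fin 2)

/-- The divergence of a vector field on the plane. -/
def divergence (z : Plane → Plane) (x : Plane) : ℝ :=
  ∑ i : Fin 2, (fderiv ℝ z x (EuclideanSpace.single i 1)) i

/-- The total variation of the distributional gradient of the indicator function of `E`:
the supremum of `∫_E div z` over smooth compactly supported fields `z` with `|z| ≤ 1`. -/
def indicatorVariation (E : Set Plane) : ℝ≥0∞ :=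
  ⨆ (z : Plane → Plane) (_ : ContDiff ℝ ∞ z) (_ : HasCompactSupport z) (_ : ∀ x, ‖z x‖ ≤ 1),
    ENNReal.ofReal (∫ x in E, divergence z x)

open Classical in
/-- The perimeter of `E`, equal to `∞` when the indicator function of `E` is not in `BV`
(in particular when it is not integrable). -/
def perimeter (E : Set Plane) : ℝ≥0∞ :=
  if MeasureTheory.NullMeasurableSet E ∧ MeasureTheory.volume E < ⊤ then
    indicatorVariation E
  else ⊤

/-- The opening of `X` with radius `r`: the union of the (open) balls of radius `r`
contained in `X`. -/
def opening (r : ℝ) (X : Set Plane) : Set Plane :=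
  ⋃ x ∈ {x : Plane | Metric.ball x r ⊆ X}, Metric.ball x r

open Classical in
/-- The closing of `X` with radius `r`: for `0 < r < ∞` the complement of the opening of the
complement, with the limit conventions that the closing with radius `0` is `X` itself and
the closing with radius `∞` is the convex hull of `X`. -/
def closing (r : ℝ≥0∞) (X : Set Plane) : Set Plane :=
  if r = 0 then X
  else if r = ⊤ then convexHull ℝ X
  else (opening r.toReal Xᶜ)ᶜ

/-- The least radius (as an infimum) for which the closing of `S` is connected. -/
def connectingRadius (S : Set Plane) : ℝ≥0∞ :=
  sInf {r : ℝ≥0∞ | 0 < r ∧ IsConnected (closing r S)}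

/-- The functional `P(X) + (s/l) |X \ S| - ((1-s)/l) |X ∩ S|`, with values in `[-∞, ∞]`. -/
def energy (S : Set Plane) (s l : ℝ) (X : Set Plane) : EReal :=
  (perimeter X : EReal)
    + ((s / l : ℝ) : EReal) * (MeasureTheory.volume (X \ S) : EReal)
    - (((1 - s) / l : ℝ) : EReal) * (MeasureTheory.volume (X ∩ S) : EReal)

/-- The quotient `l / s` as an extended radius; it is `∞` for `0 < l` and `s = 0`. -/
def radius (l s : ℝ) : ℝ≥0∞ := ENNReal.ofReal l / ENNReal.ofReal s

end TwoBalls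

end

/-! The heart of the matter is a variational property. Among the closings with radius in `[R_c, ∞]`,
the one with radius `r > 0` minimizes `P(X) + |X|/r`, and hence also `P(X) + |X \ S|/r`, since all
of them contain `S` and the two functionals differ by the constant `|S|/r`.

Given this, each function in (iii) is, for positive radii, a minimum over fixed competitors of
quantities affine in `1/r` with nonnegative slopes bounded by the area term of the convex hull.
Testing one radius with another gives both strict monotonicity (the added area is positive for `0 <
r < ∞`) and a Lipschitz bound in `1/r`. In (i) the weight `(1-s)/λ` is the constant `1/κ`, so the
energy is the second function minus a constant; in (ii) it is the first function minus `|S|/λ`.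

Minimality is a calibration argument in one variable. In coordinates with the centers on the first
axis, every such closing is, up to a null set, a region `|y| ≤ g x` over one common interval,
bounded by arcs of the two circles joined by a bridge. The bridge is an arc of the circle of radius
`r` touching both balls, a segment for the hull, or a point for touching balls at `r = 0`. For a
positive radius, let `Q` be the sine of the slope angle of `g`. Then `Q` is continuous, and its
derivative is the signed curvature: `1/r` on the bridge and negative on the balls, where every
competitor profile `f` satisfies `f ≥ g`. So `Q' (f - g) ≤ (f - g)/r`. The flux of the unit field
`(-Q, ±√(1-Q²))` bounds `P` from below for competitors and equals the length of the boundary for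
`g`; integration by parts concludes (`IsProfile.le_perimeter`, `perimeter_add_mul_volume_le`).

Connectedness reduces to the gap on the axis: the touching ball must not cover a point of it.
Eliminating the touching center leaves an inequality linear in `r` (`Bridged`), so the admissible
radii form a closed upper ray. If `R_c = 0`, continuity at `0` follows from the blow-up of `|S|/r`
for the first function, and for the second from lower semicontinuity of the perimeter, as
`|Close_r(S) \ S| ≤ r P(S)`. -/

open Set MeasureTheory Filter Topology

noncomputable section

namespace TwoBalls

/-! ### Orthonormal coordinates and the variation of a set in them -/

section

/-- The Cartesian coordinates of the plane with origin `o` and orthonormal basis `b`. -/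
def chart (o : Plane) (b : OrthonormalBasis (Fin 2) ℝ Plane) (p : ℝ × ℝ) : Plane :=
  o + (p.1 • b 0 + p.2 • b 1)

variable (o : Plane) (b : OrthonormalBasis (Fin 2) ℝ Plane)

/-- The coordinates of a point of the plane. -/
def coords (z : Plane) : ℝ × ℝ := (inner ℝ (b 0) (z - o), inner ℝ (b 1) (z - o))

theorem chart_coords (z : Plane) : chart o b (coords o b z) = z := by
  have := b.sum_repr' (z - o)
  rw [Fin.sum_univ_two] at this
  simp only [chart, coords, this]
  abel

theorem coords_chart (p : ℝ × ℝ) : coords o b (chart o b p) = p := by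
  simp [chart, coords, inner_add_right, inner_smul_right]

theorem chart_surjective : Function.Surjective (chart o b) := fun z => ⟨_, chart_coords o b z⟩

theorem norm_sq_basis (x y : ℝ) : ‖x • b 0 + y • b 1‖ ^ 2 = x ^ 2 + y ^ 2 := by
  have h := b.sum_sq_inner_right (x • b 0 + y • b 1)
  rw [← h, Fin.sum_univ_two]
  simp [inner_add_right, inner_smul_right]

theorem dist_chart_sq (p q : ℝ × ℝ) :
    dist (chart o b p) (chart o b q) ^ 2 = (p.1 - q.1) ^ 2 + (p.2 - q.2) ^ 2 := by
  have h : chart o b p - chart o b q = (p.1 - q.1) • b 0 + (p.2 - q.2) • b 1 := by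
    simp only [chart, sub_smul]; abel
  rw [dist_eq_norm, h, norm_sq_basis]

theorem contDiff_chart : ContDiff ℝ ∞ (chart o b) := by
  unfold chart; fun_prop

theorem contDiff_coords : ContDiff ℝ ∞ (coords o b) := by
  have h (i : Fin 2) : ContDiff ℝ ∞ (fun z : Plane => inner ℝ (b i) (z - o)) :=
    contDiff_const.inner ℝ (contDiff_id.sub contDiff_const)
  exact (h 0).prodMk (h 1)

theorem measurePreserving_chart : MeasurePreserving (chart o b) := by
  have h1 := (volume_preserving_finTwoArrow ℝ).symm
  have h2 := PiLp.volume_preserving_toLp (Fin 2)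
  have h3 := b.repr.symm.measurePreserving
  have h4 := measurePreserving_add_left (volume : Measure Plane) o
  have heq : chart o b = (fun x => o + x) ∘ b.repr.symm ∘ WithLp.toLp 2 ∘
      MeasurableEquiv.finTwoArrow.symm := by
    refine funext fun p => ?_
    simp only [chart, Function.comp]
    congr 1
    rw [← b.sum_repr_symm, Fin.sum_univ_two]
    simp
  rw [heq]
  exact h4.comp (h3.comp (h2.comp h1))

/-- The chart as a homeomorphism. -/
def chartHomeo : (ℝ × ℝ) ≃ₜ Plane where
  toFun := chart o b
  invFun := coords o b
  left_inv := coords_chart o b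
  right_inv := chart_coords o b
  continuous_toFun := (contDiff_chart o b).continuous
  continuous_invFun := (contDiff_coords o b).continuous

theorem measurableEmbedding_chart : MeasurableEmbedding (chart o b) :=
  (chartHomeo o b).measurableEmbedding

/-- The divergence of a pair of functions of two variables. -/
def pairDivergence (f g : ℝ × ℝ → ℝ) (p : ℝ × ℝ) : ℝ :=
  fderiv ℝ f p (1, 0) + fderiv ℝ g p (0, 1)

/-- The divergence is the trace of the derivative, which does not depend on the orthonormal basis.
-/
theorem divergence_eq_sum_inner (z : Plane → Plane) (x : Plane) :
    divergence z x = ∑ i, inner ℝ (b i) (fderiv ℝ z x (b i)) := by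
  have h1 := LinearMap.trace_eq_sum_inner (𝕜 := ℝ) (fderiv ℝ z x).toLinearMap b
  have h2 := LinearMap.trace_eq_sum_inner (𝕜 := ℝ) (fderiv ℝ z x).toLinearMap
    (EuclideanSpace.basisFun (Fin 2) ℝ)
  simp only [ContinuousLinearMap.coe_coe] at h1 h2
  rw [← h1, h2, divergence]
  refine Finset.sum_congr rfl fun i _ => ?_
  simp [EuclideanSpace.inner_single_left]

theorem hasFDerivAt_chart (p : ℝ × ℝ) :
    HasFDerivAt (chart o b)
      ((ContinuousLinearMap.fst ℝ ℝ ℝ).smulRight (b 0) +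
        (ContinuousLinearMap.snd ℝ ℝ ℝ).smulRight (b 1)) p := by
  unfold chart
  exact (((ContinuousLinearMap.fst ℝ ℝ ℝ).smulRight (b 0) +
        (ContinuousLinearMap.snd ℝ ℝ ℝ).smulRight (b 1)).hasFDerivAt).const_add o

theorem divergence_chart (z : Plane → Plane) (hz : Differentiable ℝ z) (p : ℝ × ℝ) :
    divergence z (chart o b p) =
      pairDivergence (fun p => inner ℝ (b 0) (z (chart o b p)))
        (fun p => inner ℝ (b 1) (z (chart o b p))) p := by
  rw [divergence_eq_sum_inner b, Fin.sum_univ_two, pairDivergence]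
  have h : ∀ i, HasFDerivAt (fun p => inner ℝ (b i) (z (chart o b p)))
      ((innerSL ℝ (b i)).comp ((fderiv ℝ z (chart o b p)).comp
      ((ContinuousLinearMap.fst ℝ ℝ ℝ).smulRight (b 0) +
        (ContinuousLinearMap.snd ℝ ℝ ℝ).smulRight (b 1)))) p := fun i =>
    (innerSL ℝ (b i)).hasFDerivAt.comp p
      ((hz (chart o b p)).hasFDerivAt.comp p (hasFDerivAt_chart o b p))
  rw [(h 0).fderiv, (h 1).fderiv]
  simp

theorem setIntegral_divergence_chart (z : Plane → Plane) (hz : Differentiable ℝ z)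
    (E : Set Plane) :
    ∫ x in E, divergence z x = ∫ p in chart o b ⁻¹' E,
      pairDivergence (fun p => inner ℝ (b 0) (z (chart o b p)))
        (fun p => inner ℝ (b 1) (z (chart o b p))) p := by
  rw [← (measurePreserving_chart o b).setIntegral_preimage_emb (measurableEmbedding_chart o b)]
  simp_rw [divergence_chart o b z hz]

/-- Test fields on the plane restrict the variation of a set in coordinates. -/
theorem indicatorVariation_le_of_coords {E : Set Plane} {c : ℝ≥0∞}
    (h : ∀ f g : ℝ × ℝ → ℝ, ContDiff ℝ ∞ f → ContDiff ℝ ∞ g → HasCompactSupport f →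
      HasCompactSupport g → (∀ p, f p ^ 2 + g p ^ 2 ≤ 1) →
      ENNReal.ofReal (∫ p in chart o b ⁻¹' E, pairDivergence f g p) ≤ c) :
    indicatorVariation E ≤ c := by
  refine iSup_le fun z => iSup_le fun hz => iSup_le fun hc => iSup_le fun hn => ?_
  rw [setIntegral_divergence_chart o b z (hz.differentiable (by simp))]
  have hcs : HasCompactSupport (fun p => z (chart o b p)) :=
    hc.comp_homeomorph (chartHomeo o b)
  have hs : ContDiff ℝ ∞ (fun p => z (chart o b p)) := hz.comp (contDiff_chart o b)
  refine h _ _ (contDiff_const.inner ℝ hs) (contDiff_const.inner ℝ hs)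
    (hcs.comp_left (g := fun w => inner ℝ (b 0) w) (inner_zero_right _))
    (hcs.comp_left (g := fun w => inner ℝ (b 1) w) (inner_zero_right _)) fun p => ?_
  have h1 := b.sum_sq_norm_inner_right (z (chart o b p))
  rw [Fin.sum_univ_two] at h1
  simp only [Real.norm_eq_abs, sq_abs] at h1
  rw [h1]
  have := hn (chart o b p)
  nlinarith [norm_nonneg (z (chart o b p))]

/-- The converse transfer: a coordinate pair is turned into a test field on the plane, so lower
bounds may be produced by fields written in coordinates. -/
theorem le_indicatorVariation_of_coords {E : Set Plane} {f g : ℝ × ℝ → ℝ}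
    (hf : ContDiff ℝ ∞ f) (hg : ContDiff ℝ ∞ g) (hcf : HasCompactSupport f)
    (hcg : HasCompactSupport g) (hn : ∀ p, f p ^ 2 + g p ^ 2 ≤ 1) :
    ENNReal.ofReal (∫ p in chart o b ⁻¹' E, pairDivergence f g p) ≤ indicatorVariation E := by
  set z : Plane → Plane := fun x => f (coords o b x) • b 0 + g (coords o b x) • b 1 with hz
  have hzs : ContDiff ℝ ∞ z :=
    ((hf.comp (contDiff_coords o b)).smul contDiff_const).add
      ((hg.comp (contDiff_coords o b)).smul contDiff_const)
  have hzc : HasCompactSupport z :=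
    ((hcf.comp_homeomorph (chartHomeo o b).symm).smul_right (f' := fun _ => b 0)).add
      ((hcg.comp_homeomorph (chartHomeo o b).symm).smul_right (f' := fun _ => b 1))
  have hzn : ∀ x, ‖z x‖ ≤ 1 := by
    intro x
    have : ‖z x‖ ^ 2 ≤ 1 := by
      exact (norm_sq_basis b _ _).trans_le (hn (coords o b x))
    nlinarith [norm_nonneg (z x)]
  have h0 : (fun p => inner ℝ (b 0) (z (chart o b p))) = f := by
    ext p; simp [hz, inner_add_right, inner_smul_right, coords_chart]
  have h1 : (fun p => inner ℝ (b 1) (z (chart o b p))) = g := by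
    ext p; simp [hz, inner_add_right, inner_smul_right, coords_chart]
  have := setIntegral_divergence_chart o b z (hzs.differentiable (by simp)) E
  rw [h0, h1] at this
  rw [← this]
  exact le_iSup_of_le z (le_iSup_of_le hzs (le_iSup_of_le hzc (le_iSup_of_le hzn le_rfl)))

theorem indicatorVariation_congr_ae {E F : Set Plane} (h : E =ᵐ[volume] F) :
    indicatorVariation E = indicatorVariation F := by
  simp only [indicatorVariation, setIntegral_congr_set h]

theorem perimeter_congr_ae {E F : Set Plane} (h : E =ᵐ[volume] F) :
    perimeter E = perimeter F := by
  have h1 : NullMeasurableSet E ∧ volume E < ⊤ ↔ NullMeasurableSet F ∧ volume F < ⊤ := by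
    rw [measure_congr h]
    exact and_congr_left' ⟨fun hE => hE.congr h, fun hF => hF.congr h.symm⟩
  unfold perimeter
  by_cases hF : NullMeasurableSet F ∧ volume F < ⊤
  · rw [if_pos (h1.2 hF), if_pos hF, indicatorVariation_congr_ae h]
  · rw [if_neg (mt h1.1 hF), if_neg hF]

theorem exists_basis_of_ne {c₁ c₂ : Plane} (h : c₁ ≠ c₂) :
    ∃ b : OrthonormalBasis (Fin 2) ℝ Plane, chart c₁ b (dist c₁ c₂, 0) = c₂ := by
  have hd : dist c₁ c₂ ≠ 0 := dist_ne_zero.2 h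
  set u : Plane := (dist c₁ c₂)⁻¹ • (c₂ - c₁) with hu
  have hu1 : ‖u‖ = 1 := by
    rw [hu, norm_smul, ← dist_eq_norm, dist_comm c₂, norm_inv, Real.norm_of_nonneg dist_nonneg,
      inv_mul_cancel₀ hd]
  obtain ⟨b, hb⟩ := Orthonormal.exists_orthonormalBasis_extension_of_card_eq (𝕜 := ℝ)
    (ι := Fin 2) (E := Plane) (by simp) (v := fun _ => u) (s := {0}) (by
      rw [orthonormal_iff_ite]
      rintro ⟨i, rfl⟩ ⟨j, rfl⟩
      simp [Set.domRestrict, hu1])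
  refine ⟨b, ?_⟩
  have hb0 : b 0 = u := hb 0 rfl
  simp [chart, hb0, hu, smul_smul, mul_inv_cancel₀ hd]

end

/-! ### Regions bounded by a profile, and the Gauss–Green formula for them -/

section

/-- The set `E` is, up to a null set, the region `|y| ≤ g x` over the interval `(α, β)`, where
the continuous function `g` has the integrable derivative `g'` off the countable set `s`. -/
structure IsProfile (α β : ℝ) (E : Set (ℝ × ℝ)) (g g' : ℝ → ℝ) (s : Set ℝ) : Prop where
  lt : α < β
  countable : s.Countable
  measurableSet : MeasurableSet E
  continuous : Continuous g
  left : g α = 0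
  right : g β = 0
  pos : ∀ x ∈ Ioo α β \ s, 0 < g x
  hasDerivAt : ∀ x ∈ Ioo α β \ s, HasDerivAt g (g' x) x
  intervalIntegrable : IntervalIntegrable g' volume α β
  mem : ∀ x ∈ Ioo α β \ s, ∀ y, |y| < g x → (x, y) ∈ E
  notMem : ∀ x ∈ Ioo α β \ s, ∀ y, g x < |y| → (x, y) ∉ E
  notMem_of_notMem_Icc : ∀ x ∉ Icc α β, ∀ y, (x, y) ∉ E

theorem ae_mem_Ioo_diff_or_notMem_Icc {α β : ℝ} {s : Set ℝ} (hs : s.Countable) :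
    ∀ᵐ x : ℝ, x ∈ Ioo α β \ s ∨ x ∉ Icc α β := by
  have h1 : ∀ᵐ x : ℝ, x ∉ s ∪ {α, β} := by
    have : (s ∪ {α, β}).Countable := hs.union (by simp)
    exact measure_eq_zero_iff_ae_notMem.1 (this.measure_zero _)
  filter_upwards [h1] with x hx
  simp only [mem_union, mem_insert_iff, mem_singleton_iff, not_or] at hx
  by_cases h : x ∈ Icc α β
  · exact Or.inl ⟨⟨lt_of_le_of_ne h.1 (Ne.symm hx.2.1), lt_of_le_of_ne h.2 hx.2.2⟩, hx.1⟩
  · exact Or.inr h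

namespace IsProfile

variable {α β : ℝ} {E : Set (ℝ × ℝ)} {g g' : ℝ → ℝ} {s : Set ℝ}

theorem section_ae_eq (h : IsProfile α β E g g' s) {x : ℝ} (hx : x ∈ Ioo α β \ s) :
    Prod.mk x ⁻¹' E =ᵐ[volume] Ioc (-g x) (g x) := by
  have h1 : ∀ᵐ y : ℝ, y ∉ ({-g x, g x} : Set ℝ) :=
    measure_eq_zero_iff_ae_notMem.1 (Set.Countable.measure_zero (by simp) _)
  filter_upwards [h1] with y hy
  simp only [mem_insert_iff, mem_singleton_iff, not_or] at hy
  apply propext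
  change (x, y) ∈ E ↔ y ∈ Ioc (-g x) (g x)
  constructor
  · intro hE
    have : |y| ≤ g x := not_lt.1 fun hlt => h.notMem x hx y hlt hE
    exact ⟨lt_of_le_of_ne (abs_le.1 this).1 (Ne.symm hy.1), (abs_le.1 this).2⟩
  · intro hy'
    exact h.mem x hx y (abs_lt.2 ⟨hy'.1, lt_of_le_of_ne hy'.2 hy.2⟩)

theorem setIntegral_eq (h : IsProfile α β E g g' s) {F : ℝ × ℝ → ℝ} (hF : Continuous F)
    (hc : HasCompactSupport F) :
    ∫ p in E, F p = ∫ x in α..β, ∫ y in -g x..g x, F (x, y) := by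
  have hi : Integrable F := hF.integrable_of_hasCompactSupport hc
  rw [← integral_indicator h.measurableSet, Measure.volume_eq_prod, integral_prod]
  swap
  · rw [← Measure.volume_eq_prod]; exact hi.indicator h.measurableSet
  rw [intervalIntegral.integral_of_le h.lt.le, ← integral_indicator measurableSet_Ioc]
  refine integral_congr_ae ?_
  filter_upwards [ae_mem_Ioo_diff_or_notMem_Icc (α := α) (β := β) h.countable] with x hx
  have hind : (fun y => E.indicator F (x, y)) =
      (Prod.mk x ⁻¹' E).indicator (fun y => F (x, y)) := by
    ext y; by_cases hy : (x, y) ∈ E <;> simp [hy]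
  rcases hx with hx | hx
  · rw [indicator_of_mem (Ioo_subset_Ioc_self hx.1), hind,
      integral_indicator (measurable_prodMk_left h.measurableSet),
      setIntegral_congr_set (h.section_ae_eq hx),
      intervalIntegral.integral_of_le (by linarith [h.pos x hx])]
  · rw [indicator_of_notMem (fun hx' => hx (Ioc_subset_Icc_self hx'))]
    have : ∀ y, E.indicator F (x, y) = 0 := fun y =>
      indicator_of_notMem (h.notMem_of_notMem_Icc x hx y) _
    simp [this]

theorem integral_nonneg (h : IsProfile α β E g g' s) : 0 ≤ ∫ x in α..β, g x := by
  refine intervalIntegral.integral_nonneg_of_ae_restrict h.lt.le ?_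
  rw [EventuallyLE, ae_restrict_iff' measurableSet_Icc]
  filter_upwards [ae_mem_Ioo_diff_or_notMem_Icc (α := α) (β := β) h.countable] with x hx hx'
  exact (h.pos x (hx.resolve_right (not_not.2 hx'))).le

theorem volume_eq (h : IsProfile α β E g g' s) :
    volume E = ENNReal.ofReal (2 * ∫ x in α..β, g x) := by
  rw [Measure.volume_eq_prod, Measure.prod_apply h.measurableSet,
    ← intervalIntegral.integral_const_mul, intervalIntegral.integral_of_le h.lt.le,
    ofReal_integral_eq_lintegral_ofReal]
  · rw [← lintegral_indicator measurableSet_Ioc]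
    refine lintegral_congr_ae ?_
    filter_upwards [ae_mem_Ioo_diff_or_notMem_Icc (α := α) (β := β) h.countable] with x hx
    rcases hx with hx | hx
    · rw [indicator_of_mem (Ioo_subset_Ioc_self hx.1), measure_congr (h.section_ae_eq hx),
        Real.volume_Ioc]
      congr 1; ring
    · rw [indicator_of_notMem (fun hx' => hx (Ioc_subset_Icc_self hx'))]
      have : Prod.mk x ⁻¹' E = ∅ := eq_empty_of_forall_notMem (h.notMem_of_notMem_Icc x hx)
      rw [this, measure_empty]
  · exact ((h.continuous.const_mul 2 |>.intervalIntegrable α β).1)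
  · rw [EventuallyLE, ae_restrict_iff' measurableSet_Ioc]
    filter_upwards [ae_mem_Ioo_diff_or_notMem_Icc (α := α) (β := β) h.countable] with x hx hx'
    have := h.pos x (hx.resolve_right (not_not.2 (Ioc_subset_Icc_self hx')))
    simp only [Pi.zero_apply]; positivity

end IsProfile

section Primitive

variable {f : ℝ × ℝ → ℝ}

theorem continuous_fderiv_apply (hf : ContDiff ℝ ∞ f) (v : ℝ × ℝ) :
    Continuous fun p => fderiv ℝ f p v :=
  (hf.continuous_fderiv (by simp)).clm_apply continuous_const

theorem hasDerivAt_fst (hf : ContDiff ℝ ∞ f) (x y : ℝ) :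
    HasDerivAt (fun x => f (x, y)) (fderiv ℝ f (x, y) (1, 0)) x :=
  ((hf.differentiable (by simp)) (x, y)).hasFDerivAt.comp_hasDerivAt x
    ((hasDerivAt_id x).prodMk (hasDerivAt_const x y))

theorem hasDerivAt_snd (hf : ContDiff ℝ ∞ f) (x y : ℝ) :
    HasDerivAt (fun y => f (x, y)) (fderiv ℝ f (x, y) (0, 1)) y :=
  ((hf.differentiable (by simp)) (x, y)).hasFDerivAt.comp_hasDerivAt y
    ((hasDerivAt_const y x).prodMk (hasDerivAt_id y))

theorem hasCompactSupport_fderiv_apply (hc : HasCompactSupport f) (v : ℝ × ℝ) :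
    HasCompactSupport fun p => fderiv ℝ f p v :=
  (hc.fderiv ℝ).comp_left (g := fun L : ℝ × ℝ →L[ℝ] ℝ => L v) rfl

theorem hasDerivAt_primitive_fst (hf : ContDiff ℝ ∞ f) (hc : HasCompactSupport f) (x w : ℝ) :
    HasDerivAt (fun x => ∫ y in (0 : ℝ)..w, f (x, y))
      (∫ y in (0 : ℝ)..w, fderiv ℝ f (x, y) (1, 0)) x := by
  obtain ⟨M, hM⟩ := (continuous_fderiv_apply hf (1, 0)).bounded_above_of_compact_support
    (hasCompactSupport_fderiv_apply hc (1, 0))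
  have hcont : ∀ x, Continuous fun y => f (x, y) := fun x =>
    hf.continuous.comp (Continuous.prodMk_right x)
  exact (intervalIntegral.hasDerivAt_integral_of_dominated_loc_of_deriv_le (s := univ)
    (bound := fun _ => M) univ_mem (Eventually.of_forall fun x =>
      (hcont x).aestronglyMeasurable) ((hcont x).intervalIntegrable _ _)
    (((continuous_fderiv_apply hf (1, 0)).comp (Continuous.prodMk_right x)).aestronglyMeasurable)
    (Eventually.of_forall fun t _ x _ => hM (x, t)) (by simp)
    (Eventually.of_forall fun t _ x _ => hasDerivAt_fst hf x t)).2

/-- Leibniz rule with a moving endpoint. Both partial derivatives of the primitive in `(x, w)` are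
continuous, so it is strictly differentiable and the chain rule along `x ↦ (x, g x)` applies. -/
theorem hasDerivAt_primitive_comp (hf : ContDiff ℝ ∞ f) (hc : HasCompactSupport f)
    {g : ℝ → ℝ} {m x : ℝ} (hg : HasDerivAt g m x) :
    HasDerivAt (fun x => ∫ y in (0 : ℝ)..g x, f (x, y))
      ((∫ y in (0 : ℝ)..g x, fderiv ℝ f (x, y) (1, 0)) + m * f (x, g x)) x := by
  have hcont : ∀ x, Continuous fun y => f (x, y) := fun x =>
    hf.continuous.comp (Continuous.prodMk_right x)
  have key := hasStrictFDerivAt_uncurry_coprod (𝕜 := ℝ) (u := (x, g x))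
    (f := fun x w => ∫ y in (0 : ℝ)..w, f (x, y))
    (f₁ := fun x w => ContinuousLinearMap.toSpanSingleton ℝ
      (∫ y in (0 : ℝ)..w, fderiv ℝ f (x, y) (1, 0)))
    (f₂ := fun x w => ContinuousLinearMap.toSpanSingleton ℝ (f (x, w)))
    (Eventually.of_forall fun v => (hasDerivAt_primitive_fst hf hc v.1 v.2).hasFDerivAt)
    (Eventually.of_forall fun v => (intervalIntegral.integral_hasDerivAt_right
      ((hcont v.1).intervalIntegrable _ _) ((hcont v.1).stronglyMeasurableAtFilter _ _)
      (hcont v.1).continuousAt).hasFDerivAt) ?_ ?_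
  · have h2 : HasDerivAt (fun x => (x, g x)) ((1 : ℝ), m) x := (hasDerivAt_id x).prodMk hg
    have h3 := key.hasFDerivAt.comp_hasDerivAt (f := fun x => (x, g x)) x h2
    refine h3.congr_deriv ?_
    simp [Function.HasUncurry.uncurry]
  · have h1 : Continuous fun p : ℝ × ℝ => ∫ y in (0 : ℝ)..p.2, fderiv ℝ f (p.1, y) (1, 0) :=
      intervalIntegral.continuous_parametric_primitive_of_continuous
        (f := fun x y => fderiv ℝ f (x, y) (1, 0)) (by
          exact continuous_fderiv_apply hf (1, 0))
    exact ((ContinuousLinearMap.toSpanSingletonCLE (𝕜 := ℝ) (E := ℝ)).continuous.comp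
      h1).continuousAt
  · exact ((ContinuousLinearMap.toSpanSingletonCLE (𝕜 := ℝ) (E := ℝ)).continuous.comp
      hf.continuous).continuousAt

end Primitive

/-- The Gauss–Green formula for the region under a profile. -/
theorem IsProfile.integral_pairDivergence {α β : ℝ} {E : Set (ℝ × ℝ)} {g g' : ℝ → ℝ}
    {s : Set ℝ} (h : IsProfile α β E g g' s) {a b : ℝ × ℝ → ℝ} (ha : ContDiff ℝ ∞ a)
    (hb : ContDiff ℝ ∞ b) (hca : HasCompactSupport a) (hcb : HasCompactSupport b) :
    ∫ p in E, pairDivergence a b p = ∫ x in α..β,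
      (b (x, g x) - b (x, -g x) - g' x * (a (x, g x) + a (x, -g x))) := by
  have hac := continuous_fderiv_apply ha (1, 0)
  have hbc := continuous_fderiv_apply hb (0, 1)
  have hslice : ∀ {F : ℝ × ℝ → ℝ}, Continuous F → ∀ x u v,
      IntervalIntegrable (fun y => F (x, y)) volume u v := fun hF x u v =>
    (hF.comp (Continuous.prodMk_right x)).intervalIntegrable u v
  have hpar : ∀ {F : ℝ × ℝ → ℝ}, Continuous F → ∀ {k : ℝ → ℝ}, Continuous k →
      Continuous fun x => ∫ y in (0 : ℝ)..k x, F (x, y) := fun {F} hF {k} hk =>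
    (intervalIntegral.continuous_parametric_primitive_of_continuous (μ := volume)
      (f := fun x y => F (x, y)) (a₀ := 0) (by exact hF)).comp (continuous_id.prodMk hk)
  have hgm : Continuous fun x => -g x := h.continuous.neg
  rw [h.setIntegral_eq (F := pairDivergence a b) (hac.add hbc)
    ((hasCompactSupport_fderiv_apply hca (1, 0)).add (hasCompactSupport_fderiv_apply hcb (0, 1)))]
  set J : ℝ → ℝ := fun x => (∫ y in (0 : ℝ)..g x, fderiv ℝ a (x, y) (1, 0)) -
    ∫ y in (0 : ℝ)..-g x, fderiv ℝ a (x, y) (1, 0) with hJ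
  set A : ℝ → ℝ := fun x => (∫ y in (0 : ℝ)..g x, a (x, y)) -
    ∫ y in (0 : ℝ)..-g x, a (x, y) with hA
  have hJc : Continuous J := (hpar hac h.continuous).sub (hpar hac hgm)
  have hAc : Continuous A := (hpar ha.continuous h.continuous).sub (hpar ha.continuous hgm)
  have hsum : Continuous fun x => a (x, g x) + a (x, -g x) :=
    (ha.continuous.comp (continuous_id.prodMk h.continuous)).add
      (ha.continuous.comp (continuous_id.prodMk hgm))
  have hint : IntervalIntegrable (fun x => g' x * (a (x, g x) + a (x, -g x))) volume α β :=
    h.intervalIntegrable.mul_continuousOn hsum.continuousOn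
  have hbd : Continuous fun x => b (x, g x) - b (x, -g x) :=
    (hb.continuous.comp (continuous_id.prodMk h.continuous)).sub
      (hb.continuous.comp (continuous_id.prodMk hgm))
  -- The derivative of `A x`, the integral of `a` over the vertical section, is `J` plus the terms
  -- from the moving ends. Since `g` vanishes at `α` and `β`, so does `A`; this trades the interior
  -- term `J` for boundary terms.
  have hFTC : ∫ x in α..β, (J x + g' x * (a (x, g x) + a (x, -g x))) = A β - A α := by
    refine MeasureTheory.integral_eq_of_hasDerivAt_off_countable A _ h.countable
      hAc.continuousOn (fun x hx => ?_) ((hJc.intervalIntegrable _ _).add hint)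
    rw [min_eq_left h.lt.le, max_eq_right h.lt.le] at hx
    have h1 := hasDerivAt_primitive_comp ha hca (h.hasDerivAt x hx)
    have h2 := hasDerivAt_primitive_comp ha hca (h.hasDerivAt x hx).neg
    refine (h1.sub h2).congr_deriv ?_
    simp only [hJ, Pi.neg_apply]
    ring
  have hA0 : A β - A α = 0 := by simp [hA, h.left, h.right]
  have hinner : ∀ x, (∫ y in -g x..g x, pairDivergence a b (x, y)) =
      J x + (b (x, g x) - b (x, -g x)) := by
    intro x
    have h1 : ∫ y in -g x..g x, fderiv ℝ b (x, y) (0, 1) = b (x, g x) - b (x, -g x) :=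
      intervalIntegral.integral_eq_sub_of_hasDerivAt (fun y _ => hasDerivAt_snd hb x y)
        (hslice hbc x _ _)
    simp only [pairDivergence]
    rw [intervalIntegral.integral_add (hslice hac x _ _) (hslice hbc x _ _), h1,
      ← intervalIntegral.integral_interval_sub_left (hslice hac x 0 _) (hslice hac x 0 _)]
  simp_rw [hinner]
  rw [intervalIntegral.integral_add (hJc.intervalIntegrable _ _) (hbd.intervalIntegrable _ _)]
  rw [intervalIntegral.integral_add (hJc.intervalIntegrable _ _) hint, hA0] at hFTC
  rw [intervalIntegral.integral_sub (hbd.intervalIntegrable _ _) hint]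
  linarith

end

/-! ### Upper and lower bounds for the perimeter of a profile region -/

section

/-- Cauchy–Schwarz against the normals `(-m, 1)` and `(-m, -1)` of the upper and the lower graph,
each of length `√(1 + m²)`. -/
theorem sub_sub_mul_le_two_mul_sqrt {a₁ a₂ b₁ b₂ m : ℝ} (h₁ : a₁ ^ 2 + b₁ ^ 2 ≤ 1)
    (h₂ : a₂ ^ 2 + b₂ ^ 2 ≤ 1) :
    b₁ - b₂ - m * (a₁ + a₂) ≤ 2 * √(1 + m ^ 2) := by
  have key : ∀ a b : ℝ, a ^ 2 + b ^ 2 ≤ 1 → b - m * a ≤ √(1 + m ^ 2) := fun a b h => by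
    apply Real.le_sqrt_of_sq_le
    nlinarith [sq_nonneg (a + m * b), sq_nonneg m]
  linarith [key a₁ b₁ h₁, key a₂ (-b₂) (by simpa using h₂)]

/-- A smooth odd approximation of the sign function. -/
def smoothSign (n : ℕ) (y : ℝ) : ℝ :=
  Real.smoothTransition (n * y) - Real.smoothTransition (-(n * y))

theorem contDiff_smoothSign (n : ℕ) : ContDiff ℝ ∞ (smoothSign n) :=
  (Real.smoothTransition.contDiff.comp (contDiff_const.mul contDiff_id)).sub
    (Real.smoothTransition.contDiff.comp (contDiff_const.mul contDiff_id).neg)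

theorem smoothSign_neg (n : ℕ) (y : ℝ) : smoothSign n (-y) = -smoothSign n y := by
  simp [smoothSign]

theorem abs_smoothSign_le (n : ℕ) (y : ℝ) : |smoothSign n y| ≤ 1 := by
  have h1 := Real.smoothTransition.nonneg (n * y)
  have h2 := Real.smoothTransition.le_one (n * y)
  have h3 := Real.smoothTransition.nonneg (-(n * y))
  have h4 := Real.smoothTransition.le_one (-(n * y))
  rw [smoothSign, abs_le]
  constructor <;> linarith

theorem tendsto_smoothSign {y : ℝ} (hy : 0 < y) :
    Tendsto (fun n => smoothSign n y) atTop (𝓝 1) := by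
  obtain ⟨N, hN⟩ := exists_nat_gt (1 / y)
  refine tendsto_const_nhds.congr' ?_
  filter_upwards [eventually_ge_atTop N] with n hn
  have h1 : 1 ≤ (n : ℝ) * y := by
    have : (N : ℝ) ≤ n := by exact_mod_cast hn
    rw [div_lt_iff₀ hy] at hN
    nlinarith
  rw [smoothSign, Real.smoothTransition.one_of_one_le h1,
    Real.smoothTransition.zero_of_nonpos (by linarith), sub_zero]

namespace IsProfile

variable {α β : ℝ} {E : Set Plane} {g g' : ℝ → ℝ} {s : Set ℝ} {o : Plane}
  {b : OrthonormalBasis (Fin 2) ℝ Plane}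

theorem intervalIntegrable_sqrt (h : IntervalIntegrable g' volume α β) :
    IntervalIntegrable (fun x => √(1 + g' x ^ 2)) volume α β := by
  have hb : IntervalIntegrable (fun x => 1 + ‖g' x‖) volume α β :=
    intervalIntegrable_const.add h.norm
  refine hb.mono_fun' ?_ (Eventually.of_forall fun x => ?_)
  · exact (Real.continuous_sqrt.comp_aestronglyMeasurable
      (aestronglyMeasurable_const.add (h.def'.aestronglyMeasurable.pow 2)))
  · beta_reduce
    rw [Real.norm_of_nonneg (Real.sqrt_nonneg _), Real.sqrt_le_left (by positivity),
      Real.norm_eq_abs]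
    nlinarith [abs_nonneg (g' x), sq_abs (g' x)]

theorem volume_plane_eq (h : IsProfile α β (chart o b ⁻¹' E) g g' s) :
    volume E = ENNReal.ofReal (2 * ∫ x in α..β, g x) := by
  rw [← h.volume_eq, (measurePreserving_chart o b).measure_preimage_emb
    (measurableEmbedding_chart o b)]

theorem measurableSet_plane (h : IsProfile α β (chart o b ⁻¹' E) g g' s) :
    MeasurableSet E := by
  have := (measurableEmbedding_chart o b).measurableSet_image.2 h.measurableSet
  rwa [image_preimage_eq _ (chart_surjective o b)] at this

theorem perimeter_eq (h : IsProfile α β (chart o b ⁻¹' E) g g' s) :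
    perimeter E = indicatorVariation E := by
  unfold perimeter
  exact if_pos ⟨h.measurableSet_plane.nullMeasurableSet,
    h.volume_plane_eq.trans_lt ENNReal.ofReal_lt_top⟩

/-- The perimeter is at most the length of the two graphs that bound the set. -/
theorem perimeter_le (h : IsProfile α β (chart o b ⁻¹' E) g g' s) :
    perimeter E ≤ ENNReal.ofReal (2 * ∫ x in α..β, √(1 + g' x ^ 2)) := by
  rw [h.perimeter_eq]
  refine indicatorVariation_le_of_coords o b fun f k hf hk hcf hck hn => ?_
  rw [h.integral_pairDivergence hf hk hcf hck, ← intervalIntegral.integral_const_mul]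
  apply ENNReal.ofReal_le_ofReal
  have h1 : Continuous fun x => f (x, g x) + f (x, -g x) :=
    (hf.continuous.comp (continuous_id.prodMk h.continuous)).add
      (hf.continuous.comp (continuous_id.prodMk h.continuous.neg))
  have h2 : Continuous fun x => k (x, g x) - k (x, -g x) :=
    (hk.continuous.comp (continuous_id.prodMk h.continuous)).sub
      (hk.continuous.comp (continuous_id.prodMk h.continuous.neg))
  exact intervalIntegral.integral_mono_on h.lt.le
    ((h2.intervalIntegrable _ _).sub (h.intervalIntegrable.mul_continuousOn h1.continuousOn))
    ((intervalIntegrable_sqrt h.intervalIntegrable).const_mul 2)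
    fun x _ => sub_sub_mul_le_two_mul_sqrt (hn _) (hn _)

/-- The ideal field is `(-Q x, R x)` above the axis and its mirror image below, with a jump on the
axis. A smooth odd function of `y` in place of the sign keeps it smooth, and by symmetry both graphs
give the same flux, whence the factor 2. -/
theorem le_indicatorVariation_smoothSign (h : IsProfile α β (chart o b ⁻¹' E) g g' s)
    {Q R : ℝ → ℝ} (hQ : ContDiff ℝ ∞ Q) (hR : ContDiff ℝ ∞ R)
    (hn : ∀ x, Q x ^ 2 + R x ^ 2 ≤ 1) (n : ℕ) :
    ENNReal.ofReal (2 * ∫ x in α..β, (R x * smoothSign n (g x) + Q x * g' x)) ≤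
      indicatorVariation E := by
  have hK : IsCompact ((fun x => (x, g x)) '' Icc α β ∪ (fun x => (x, -g x)) '' Icc α β) :=
    (isCompact_Icc.image (continuous_id.prodMk h.continuous)).union
      (isCompact_Icc.image (continuous_id.prodMk h.continuous.neg))
  obtain ⟨ρ, hρ0, hρ⟩ := hK.isBounded.exists_pos_norm_le
  -- The cutoff is 1 on a ball that contains both graphs, so it gives compact support without
  -- changing the boundary integral.
  let χ : ContDiffBump (0 : ℝ × ℝ) := ⟨ρ, ρ + 1, hρ0, by linarith⟩
  have hχ1 : ∀ x ∈ Icc α β, χ (x, g x) = 1 ∧ χ (x, -g x) = 1 := fun x hx =>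
    ⟨χ.one_of_mem_closedBall (by simpa using hρ _ (Or.inl ⟨x, hx, rfl⟩)),
      χ.one_of_mem_closedBall (by simpa using hρ _ (Or.inr ⟨x, hx, rfl⟩))⟩
  set f : ℝ × ℝ → ℝ := fun p => -Q p.1 * χ p with hf
  set k : ℝ × ℝ → ℝ := fun p => R p.1 * smoothSign n p.2 * χ p with hk
  have hfs : ContDiff ℝ ∞ f := (hQ.comp contDiff_fst).neg.mul χ.contDiff
  have hks : ContDiff ℝ ∞ k :=
    ((hR.comp contDiff_fst).mul ((contDiff_smoothSign n).comp contDiff_snd)).mul χ.contDiff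
  have hfk : ∀ p, f p ^ 2 + k p ^ 2 ≤ 1 := by
    intro p
    have h1 : χ p ^ 2 ≤ 1 := by nlinarith [χ.nonneg (x := p), χ.le_one (x := p)]
    have h2 : smoothSign n p.2 ^ 2 ≤ 1 := by
      rw [← sq_abs]; nlinarith [abs_nonneg (smoothSign n p.2), abs_smoothSign_le n p.2]
    have h3 := hn p.1
    calc f p ^ 2 + k p ^ 2
        = (Q p.1 ^ 2 + R p.1 ^ 2 * smoothSign n p.2 ^ 2) * χ p ^ 2 := by
          simp only [hf, hk]; ring
      _ ≤ (Q p.1 ^ 2 + R p.1 ^ 2 * smoothSign n p.2 ^ 2) * 1 := by gcongr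
      _ ≤ 1 := by nlinarith [sq_nonneg (R p.1)]
  refine le_trans (le_of_eq ?_) (le_indicatorVariation_of_coords o b hfs hks
    χ.hasCompactSupport.mul_left χ.hasCompactSupport.mul_left hfk)
  rw [h.integral_pairDivergence hfs hks χ.hasCompactSupport.mul_left
    χ.hasCompactSupport.mul_left, ← intervalIntegral.integral_const_mul]
  congr 1
  refine intervalIntegral.integral_congr fun x hx => ?_
  rw [uIcc_of_le h.lt.le] at hx
  simp only [hf, hk, (hχ1 x hx).1, (hχ1 x hx).2, smoothSign_neg]
  ring

/-- Dominated convergence in `n`: the smoothed sign tends to 1 at `g x` because `g` is positive off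
a null set. -/
theorem le_indicatorVariation_contDiff (h : IsProfile α β (chart o b ⁻¹' E) g g' s)
    {Q R : ℝ → ℝ} (hQ : ContDiff ℝ ∞ Q) (hR : ContDiff ℝ ∞ R)
    (hn : ∀ x, Q x ^ 2 + R x ^ 2 ≤ 1) :
    ENNReal.ofReal (2 * ∫ x in α..β, (R x + Q x * g' x)) ≤ indicatorVariation E := by
  have hg' := h.intervalIntegrable.mul_continuousOn hQ.continuous.continuousOn
  have hlim : Tendsto (fun n : ℕ => ∫ x in α..β, (R x * smoothSign n (g x) + Q x * g' x)) atTop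
      (𝓝 (∫ x in α..β, (R x + Q x * g' x))) := by
    refine intervalIntegral.tendsto_integral_filter_of_dominated_convergence
      (fun x => 1 + ‖g' x‖) (Eventually.of_forall fun n => ?_)
      (Eventually.of_forall fun n => Eventually.of_forall fun x _ => ?_)
      (intervalIntegrable_const.add h.intervalIntegrable.norm) ?_
    · exact (hR.continuous.mul ((contDiff_smoothSign n).continuous.comp
        h.continuous)).aestronglyMeasurable.add
        (hQ.continuous.aestronglyMeasurable.mul h.intervalIntegrable.def'.aestronglyMeasurable)
    · have hQ1 : |Q x| ≤ 1 := by
        rw [← sq_le_one_iff_abs_le_one]; nlinarith [hn x, sq_nonneg (R x)]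
      have hR1 : |R x| ≤ 1 := by
        rw [← sq_le_one_iff_abs_le_one]; nlinarith [hn x, sq_nonneg (Q x)]
      refine (norm_add_le _ _).trans ?_
      rw [norm_mul, norm_mul]
      simp only [Real.norm_eq_abs]
      have := abs_smoothSign_le n (g x)
      have h1 : |R x| * |smoothSign n (g x)| ≤ 1 := by
        nlinarith [abs_nonneg (R x), abs_nonneg (smoothSign n (g x))]
      have h2 : |Q x| * |g' x| ≤ |g' x| := by nlinarith [abs_nonneg (g' x)]
      linarith
    · filter_upwards [ae_mem_Ioo_diff_or_notMem_Icc (α := α) (β := β) h.countable] with x hx hx'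
      rw [uIoc_of_le h.lt.le] at hx'
      have hpos := h.pos x (hx.resolve_right (not_not.2 (Ioc_subset_Icc_self hx')))
      simpa using ((tendsto_smoothSign hpos).const_mul (R x)).add_const (Q x * g' x)
  refine le_of_tendsto ((ENNReal.continuous_ofReal.tendsto _).comp (hlim.const_mul 2))
    (Eventually.of_forall fun n => h.le_indicatorVariation_smoothSign hQ hR hn n)

/-- The perimeter is at least the flux through the boundary of any unit field that depends on
the first coordinate only. -/
theorem le_perimeter (h : IsProfile α β (chart o b ⁻¹' E) g g' s) {Q : ℝ → ℝ}
    (hQ : Continuous Q) (hQ1 : ∀ x ∈ Icc α β, |Q x| ≤ 1) :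
    ENNReal.ofReal (2 * ∫ x in α..β, (√(1 - Q x ^ 2) + Q x * g' x)) ≤ perimeter E := by
  rw [h.perimeter_eq]
  -- The bound `|Q| ≤ 1` is known only on `[α, β]`, but a test field needs it everywhere, so `Q` is
  -- clamped.
  set P : ℝ → ℝ := fun x => max (-1) (min 1 (Q x)) with hP
  have hPc : Continuous P := continuous_const.max (continuous_const.min hQ)
  have hP1 : ∀ x, P x ^ 2 ≤ 1 := fun x => by
    rw [sq_le_one_iff_abs_le_one, abs_le]
    exact ⟨le_max_left _ _, max_le (by norm_num) (min_le_left _ _)⟩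
  have hPQ : ∀ x ∈ Icc α β, P x = Q x := fun x hx => by
    have := abs_le.1 (hQ1 x hx)
    rw [hP]; simp only; rw [min_eq_right this.2, max_eq_right this.1]
  set R : ℝ → ℝ := fun x => √(1 - P x ^ 2) with hR
  have hRc : Continuous R := (continuous_const.sub (hPc.pow 2)).sqrt
  have hR1 : ∀ x, P x ^ 2 + R x ^ 2 = 1 := fun x => by
    rw [hR]; simp only; rw [Real.sq_sqrt (by linarith [hP1 x])]; ring
  set ε : ℕ → ℝ := fun n => 1 / ((n : ℝ) + 1) with hε
  have hε0 : ∀ n, 0 < ε n := fun n => Nat.one_div_pos_of_nat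
  have hεl : Tendsto ε atTop (𝓝 0) := tendsto_one_div_add_atTop_nhds_zero_nat
  choose q hqs hqd _ using fun n => hPc.exists_contDiff_approx ⊤
    (ε := fun _ => ε n) continuous_const (fun _ => hε0 n)
  choose k hks hkd _ using fun n => hRc.exists_contDiff_approx ⊤
    (ε := fun _ => ε n) continuous_const (fun _ => hε0 n)
  have hql : ∀ x, Tendsto (fun n => q n x / (1 + 2 * ε n)) atTop (𝓝 (P x)) := fun x => by
    have h1 : Tendsto (fun n => q n x) atTop (𝓝 (P x)) := by
      rw [tendsto_iff_dist_tendsto_zero]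
      exact squeeze_zero (fun _ => dist_nonneg) (fun n => (hqd n x).le) hεl
    have h2 := h1.div ((hεl.const_mul 2).const_add 1) (by norm_num)
    simp only [mul_zero, add_zero, div_one] at h2
    exact h2
  have hkl : ∀ x, Tendsto (fun n => k n x / (1 + 2 * ε n)) atTop (𝓝 (R x)) := fun x => by
    have h1 : Tendsto (fun n => k n x) atTop (𝓝 (R x)) := by
      rw [tendsto_iff_dist_tendsto_zero]
      exact squeeze_zero (fun _ => dist_nonneg) (fun n => (hkd n x).le) hεl
    have h2 := h1.div ((hεl.const_mul 2).const_add 1) (by norm_num)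
    simp only [mul_zero, add_zero, div_one] at h2
    exact h2
  -- Each of `q n`, `k n` is within `ε n` of the corresponding component of the unit vector `(P,
  -- R)`, so the approximating vector has length at most `1 + 2 ε n`; dividing by that makes it
  -- admissible.
  have hnorm : ∀ n x, (q n x / (1 + 2 * ε n)) ^ 2 + (k n x / (1 + 2 * ε n)) ^ 2 ≤ 1 := by
    intro n x
    have e0 := hε0 n
    rw [div_pow, div_pow, ← add_div, div_le_one (by positivity)]
    have h1 := abs_lt.1 (by simpa [Real.dist_eq] using hqd n x)
    have h2 := abs_lt.1 (by simpa [Real.dist_eq] using hkd n x)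
    have h3 := hR1 x
    set u := q n x - P x with hu
    set v := k n x - R x with hv
    have e1 : q n x = P x + u := by rw [hu]; ring
    have e2 : k n x = R x + v := by rw [hv]; ring
    rw [e1, e2]
    have hu2 : u ^ 2 ≤ ε n ^ 2 := by nlinarith
    have hv2 : v ^ 2 ≤ ε n ^ 2 := by nlinarith
    have hd : P x * u + R x * v ≤ 2 * ε n := by
      apply le_of_sq_le_sq _ (by positivity)
      nlinarith [sq_nonneg (P x * v - R x * u)]
    nlinarith
  have hlim : Tendsto (fun n : ℕ => ∫ x in α..β,
      (k n x / (1 + 2 * ε n) + q n x / (1 + 2 * ε n) * g' x)) atTop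
      (𝓝 (∫ x in α..β, (R x + P x * g' x))) := by
    refine intervalIntegral.tendsto_integral_filter_of_dominated_convergence
      (fun x => 1 + ‖g' x‖) (Eventually.of_forall fun n => ?_)
      (Eventually.of_forall fun n => Eventually.of_forall fun x _ => ?_)
      (intervalIntegrable_const.add h.intervalIntegrable.norm) (Eventually.of_forall fun x _ => ?_)
    · exact ((hks n).continuous.div_const _).aestronglyMeasurable.add
        (((hqs n).continuous.div_const _).aestronglyMeasurable.mul
          h.intervalIntegrable.def'.aestronglyMeasurable)
    · have hn := hnorm n x
      have hQ1 : |q n x / (1 + 2 * ε n)| ≤ 1 := by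
        rw [← sq_le_one_iff_abs_le_one]; nlinarith [sq_nonneg (k n x / (1 + 2 * ε n))]
      have hR1 : |k n x / (1 + 2 * ε n)| ≤ 1 := by
        rw [← sq_le_one_iff_abs_le_one]; nlinarith [sq_nonneg (q n x / (1 + 2 * ε n))]
      refine (norm_add_le _ _).trans ?_
      rw [norm_mul]
      simp only [Real.norm_eq_abs]
      nlinarith [abs_nonneg (g' x)]
    · exact (hkl x).add ((hql x).mul_const (g' x))
  have heq : ∫ x in α..β, (√(1 - Q x ^ 2) + Q x * g' x) = ∫ x in α..β, (R x + P x * g' x) := by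
    refine intervalIntegral.integral_congr fun x hx => ?_
    rw [uIcc_of_le h.lt.le] at hx
    simp only [hR, hPQ x hx]
  rw [heq]
  exact le_of_tendsto ((ENNReal.continuous_ofReal.tendsto _).comp (hlim.const_mul 2))
    (Eventually.of_forall fun n => h.le_indicatorVariation_contDiff
      ((hqs n).div_const _) ((hks n).div_const _) (hnorm n))

end IsProfile

end

/-! ### Calibration, circular arcs, and gluing of functions -/

section

/-- The equality case of the flux bound: for slope `q / √(1 - q²)`, the field `(-q, √(1 - q²))` is
the unit normal of the graph. -/
theorem sqrt_one_add_div_sq {q : ℝ} (hq : |q| < 1) :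
    √(1 + (q / √(1 - q ^ 2)) ^ 2) = √(1 - q ^ 2) + q * (q / √(1 - q ^ 2)) := by
  have h1 : 0 < 1 - q ^ 2 := by
    rw [← sq_lt_one_iff_abs_lt_one] at hq; linarith
  have h2 := Real.sqrt_pos.2 h1
  have h3 := Real.sq_sqrt h1.le
  set w := √(1 - q ^ 2) with hw
  have h4 : 1 + (q / w) ^ 2 = (1 / w) ^ 2 := by
    field_simp; linarith
  rw [h4, Real.sqrt_sq (by positivity)]
  field_simp; linarith

/-- The function `Q` is the sine of the slope angle of the profile `g`, with derivative `Q'`. -/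
structure IsSlope (α β : ℝ) (g' : ℝ → ℝ) (s : Set ℝ) (Q Q' : ℝ → ℝ) : Prop where
  continuous : Continuous Q
  abs_le : ∀ x ∈ Icc α β, |Q x| ≤ 1
  abs_lt : ∀ x ∈ Ioo α β \ s, |Q x| < 1
  eq : ∀ x ∈ Ioo α β \ s, g' x = Q x / √(1 - Q x ^ 2)
  hasDerivAt : ∀ x ∈ Ioo α β \ s, HasDerivAt Q (Q' x) x
  intervalIntegrable : IntervalIntegrable Q' volume α β

section Comparison

variable {α β : ℝ} {E F : Set Plane} {g g' f f' Q Q' : ℝ → ℝ} {s t : Set ℝ} {o : Plane}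
  {b : OrthonormalBasis (Fin 2) ℝ Plane}

theorem intervalIntegrable_flux (hE : IntervalIntegrable g' volume α β) (hQ : Continuous Q) :
    IntervalIntegrable (fun x => √(1 - Q x ^ 2) + Q x * g' x) volume α β :=
  ((continuous_const.sub (hQ.pow 2)).sqrt.intervalIntegrable _ _).add
    (hE.continuousOn_mul hQ.continuousOn)

theorem integral_sqrt_eq_flux (hE : IsProfile α β (chart o b ⁻¹' E) g g' s)
    (hQ : IsSlope α β g' s Q Q') :
    ∫ x in α..β, √(1 + g' x ^ 2) = ∫ x in α..β, (√(1 - Q x ^ 2) + Q x * g' x) := by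
  refine intervalIntegral.integral_congr_ae ?_
  filter_upwards [ae_mem_Ioo_diff_or_notMem_Icc (α := α) (β := β) hE.countable] with x hx hx'
  rw [uIoc_of_le hE.lt.le] at hx'
  have hx := hx.resolve_right (not_not.2 (Ioc_subset_Icc_self hx'))
  rw [hQ.eq x hx]
  exact sqrt_one_add_div_sq (hQ.abs_lt x hx)

/-- A calibrated profile minimizes `perimeter + k * area` among the profiles that satisfy the
obstacle condition. -/
theorem perimeter_add_mul_volume_le (hE : IsProfile α β (chart o b ⁻¹' E) g g' s)
    (hF : IsProfile α β (chart o b ⁻¹' F) f f' t) (hQ : IsSlope α β g' s Q Q') {k : ℝ}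
    (hk : 0 ≤ k) (hobs : ∀ x ∈ Ioo α β \ (s ∪ t), Q' x * (f x - g x) ≤ k * (f x - g x)) :
    perimeter E + ENNReal.ofReal k * volume E ≤ perimeter F + ENNReal.ofReal k * volume F := by
  have hP := integral_sqrt_eq_flux hE hQ
  have hst : (s ∪ t).Countable := hE.countable.union hF.countable
  have hfg : Continuous fun x => f x - g x := hF.continuous.sub hE.continuous
  have hQ1 : IntervalIntegrable (fun x => Q' x * (f x - g x)) volume α β :=
    hQ.intervalIntegrable.mul_continuousOn hfg.continuousOn
  have hQ2 : IntervalIntegrable (fun x => Q x * (f' x - g' x)) volume α β :=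
    (hF.intervalIntegrable.sub hE.intervalIntegrable).continuousOn_mul hQ.continuous.continuousOn
  -- The integrand is the derivative of `Q (f - g)`, which vanishes at both ends because both
  -- profiles do. This turns the difference of fluxes into `-∫ Q' (f - g)`, which the obstacle
  -- condition bounds by the difference of areas.
  have hparts : ∫ x in α..β, (Q' x * (f x - g x) + Q x * (f' x - g' x)) = 0 := by
    rw [MeasureTheory.integral_eq_of_hasDerivAt_off_countable (fun x => Q x * (f x - g x)) _ hst
      (hQ.continuous.mul hfg).continuousOn (fun x hx => ?_) (hQ1.add hQ2)]
    · simp [hE.left, hE.right, hF.left, hF.right]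
    · rw [min_eq_left hE.lt.le, max_eq_right hE.lt.le] at hx
      have hxs : x ∈ Ioo α β \ s := ⟨hx.1, fun h => hx.2 (Or.inl h)⟩
      have hxt : x ∈ Ioo α β \ t := ⟨hx.1, fun h => hx.2 (Or.inr h)⟩
      exact (hQ.hasDerivAt x hxs).mul ((hF.hasDerivAt x hxt).sub (hE.hasDerivAt x hxs))
  rw [intervalIntegral.integral_add hQ1 hQ2] at hparts
  have hmono : ∫ x in α..β, Q' x * (f x - g x) ≤ ∫ x in α..β, k * (f x - g x) := by
    refine intervalIntegral.integral_mono_ae_restrict hE.lt.le hQ1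
      ((hfg.const_mul k).intervalIntegrable _ _) ?_
    rw [EventuallyLE, ae_restrict_iff' measurableSet_Icc]
    filter_upwards [ae_mem_Ioo_diff_or_notMem_Icc (α := α) (β := β) hst] with x hx hx'
    exact hobs x (hx.resolve_right (not_not.2 hx'))
  rw [intervalIntegral.integral_const_mul, intervalIntegral.integral_sub
    (hF.continuous.intervalIntegrable _ _) (hE.continuous.intervalIntegrable _ _)] at hmono
  have hflux : (∫ x in α..β, (√(1 - Q x ^ 2) + Q x * f' x)) -
      ∫ x in α..β, (√(1 - Q x ^ 2) + Q x * g' x) = ∫ x in α..β, Q x * (f' x - g' x) := by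
    rw [← intervalIntegral.integral_sub
      (intervalIntegrable_flux hF.intervalIntegrable hQ.continuous)
      (intervalIntegrable_flux hE.intervalIntegrable hQ.continuous)]
    exact intervalIntegral.integral_congr fun x _ => by ring
  have hpos : 0 ≤ ∫ x in α..β, √(1 + g' x ^ 2) :=
    intervalIntegral.integral_nonneg hE.lt.le fun x _ => Real.sqrt_nonneg _
  have hgn := hE.integral_nonneg
  have hfn := hF.integral_nonneg
  calc perimeter E + ENNReal.ofReal k * volume E
      ≤ ENNReal.ofReal (2 * ∫ x in α..β, √(1 + g' x ^ 2)) +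
          ENNReal.ofReal k * volume E := by gcongr; exact hE.perimeter_le
    _ = ENNReal.ofReal (2 * (∫ x in α..β, √(1 + g' x ^ 2)) + k * (2 * ∫ x in α..β, g x)) := by
        rw [hE.volume_plane_eq, ← ENNReal.ofReal_mul hk,
          ← ENNReal.ofReal_add (by positivity) (by positivity)]
    _ ≤ ENNReal.ofReal (2 * (∫ x in α..β, (√(1 - Q x ^ 2) + Q x * f' x)) +
          k * (2 * ∫ x in α..β, f x)) := by
        apply ENNReal.ofReal_le_ofReal
        linarith
    _ ≤ ENNReal.ofReal (2 * ∫ x in α..β, (√(1 - Q x ^ 2) + Q x * f' x)) +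
          ENNReal.ofReal (k * (2 * ∫ x in α..β, f x)) := ENNReal.ofReal_add_le
    _ ≤ perimeter F + ENNReal.ofReal k * volume F := by
        rw [hF.volume_plane_eq, ENNReal.ofReal_mul hk]
        gcongr
        exact hF.le_perimeter hQ.continuous hQ.abs_le

end Comparison

section Arc

/-- The upper half circle with radius `ρ` and center `(c, 0)`. -/
def arc (ρ c x : ℝ) : ℝ := √(ρ ^ 2 - (x - c) ^ 2)

/-- The slope of the upper half circle. -/
def arcSlope (ρ c x : ℝ) : ℝ := -(x - c) / √(ρ ^ 2 - (x - c) ^ 2)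

variable {ρ c x : ℝ}

theorem continuous_arc : Continuous (arc ρ c) := by unfold arc; fun_prop

theorem sub_sq_pos (hx : |x - c| < ρ) : 0 < ρ ^ 2 - (x - c) ^ 2 := by
  have := sq_lt_sq' (neg_lt_of_abs_lt hx) (lt_of_abs_lt hx)
  linarith

theorem arc_pos (hx : |x - c| < ρ) : 0 < arc ρ c x := Real.sqrt_pos.2 (sub_sq_pos hx)

theorem arc_sq (hx : |x - c| ≤ ρ) : arc ρ c x ^ 2 = ρ ^ 2 - (x - c) ^ 2 := by
  refine Real.sq_sqrt ?_
  nlinarith [abs_nonneg (x - c), sq_abs (x - c)]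

theorem hasDerivAt_arc (hx : |x - c| < ρ) : HasDerivAt (arc ρ c) (arcSlope ρ c x) x := by
  have h1 : HasDerivAt (fun x => ρ ^ 2 - (x - c) ^ 2) (-(2 * (x - c))) x := by
    simpa using (((hasDerivAt_id x).sub_const c).pow 2).const_sub (ρ ^ 2)
  refine (h1.sqrt (sub_sq_pos hx).ne').congr_deriv ?_
  rw [arcSlope]
  have := (arc_pos hx).ne'
  rw [arc] at this
  field_simp

/-- The slope is unbounded at the ends of the diameter, but it has constant sign on each half, and a
derivative of constant sign of a continuous function is integrable. -/
theorem intervalIntegrable_arcSlope (hρ : 0 ≤ ρ) {u v : ℝ} (hu : u ∈ Icc (c - ρ) (c + ρ))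
    (hv : v ∈ Icc (c - ρ) (c + ρ)) : IntervalIntegrable (arcSlope ρ c) volume u v := by
  have h1 : IntervalIntegrable (arcSlope ρ c) volume (c - ρ) c := by
    refine intervalIntegral.intervalIntegrable_deriv_of_nonneg (g := arc ρ c)
      continuous_arc.continuousOn (fun x hx => hasDerivAt_arc ?_) (fun x hx => ?_)
    all_goals
      rw [min_eq_left (by linarith), max_eq_right (by linarith)] at hx
    · rw [abs_lt]; constructor <;> linarith [hx.1, hx.2]
    · exact div_nonneg (by linarith [hx.2]) (Real.sqrt_nonneg _)
  have h2 : IntervalIntegrable (fun x => -arcSlope ρ c x) volume c (c + ρ) := by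
    refine intervalIntegral.intervalIntegrable_deriv_of_nonneg (g := fun x => -arc ρ c x)
      continuous_arc.neg.continuousOn (fun x hx => (hasDerivAt_arc ?_).neg) (fun x hx => ?_)
    all_goals
      rw [min_eq_left (by linarith), max_eq_right (by linarith)] at hx
    · rw [abs_lt]; constructor <;> linarith [hx.1, hx.2]
    · rw [arcSlope, neg_div, neg_neg]
      exact div_nonneg (by linarith [hx.1]) (Real.sqrt_nonneg _)
  have h3 : IntervalIntegrable (arcSlope ρ c) volume c (c + ρ) :=
    h2.neg.congr fun x _ => neg_neg _
  refine (h1.trans h3).mono_set ?_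
  rw [uIcc_of_le (by linarith : c - ρ ≤ c + ρ)]
  exact uIcc_subset_Icc hu hv

theorem arcSlope_eq (hρ : 0 < ρ) :
    arcSlope ρ c x = (-(x - c) / ρ) / √(1 - (-(x - c) / ρ) ^ 2) := by
  have h : ρ ^ 2 - (x - c) ^ 2 = ρ ^ 2 * (1 - (-(x - c) / ρ) ^ 2) := by
    field_simp
  rw [arcSlope, h, Real.sqrt_mul (by positivity), Real.sqrt_sq hρ.le, div_div]

end Arc

section Glue

/-- The function that is `u` up to `x₁`, `v` between `x₁` and `x₂`, and `w` from `x₂` on. -/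
def glue (x₁ x₂ : ℝ) (u v w : ℝ → ℝ) (x : ℝ) : ℝ :=
  if x ≤ x₁ then u x else if x ≤ x₂ then v x else w x

variable {x₁ x₂ x : ℝ} {u v w : ℝ → ℝ}

theorem glue_left (h : x ≤ x₁) : glue x₁ x₂ u v w x = u x := if_pos h

theorem glue_mid (h₁ : x₁ < x) (h₂ : x ≤ x₂) : glue x₁ x₂ u v w x = v x := by
  rw [glue, if_neg h₁.not_ge, if_pos h₂]

theorem glue_right (h₁ : x₁ < x) (h₂ : x₂ < x) : glue x₁ x₂ u v w x = w x := by
  rw [glue, if_neg h₁.not_ge, if_neg h₂.not_ge]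

/-- Only the values of `v` on `[x₁, x₂]` matter; extending it by constants makes all three pieces
globally continuous. -/
theorem continuous_glue (h : x₁ ≤ x₂) (hu : Continuous u) (hv : ContinuousOn v (Icc x₁ x₂))
    (hw : Continuous w) (h₁ : u x₁ = v x₁) (h₂ : v x₂ = w x₂) :
    Continuous (glue x₁ x₂ u v w) := by
  set V : ℝ → ℝ := IccExtend h ((Icc x₁ x₂).domRestrict v) with hV
  have hVc : Continuous V := (continuousOn_iff_continuous_domRestrict.1 hv).Icc_extend'
  have hVv : ∀ x ∈ Icc x₁ x₂, V x = v x := fun x hx => by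
    rw [hV, IccExtend_of_mem h _ hx]; rfl
  have heq : glue x₁ x₂ u v w = fun x => if x ≤ x₁ then u x else if x ≤ x₂ then V x else w x := by
    ext x
    by_cases hx : x ≤ x₁
    · simp [glue, hx]
    · by_cases hx' : x ≤ x₂
      · simp [glue, hx, hx', hVv x ⟨(not_le.1 hx).le, hx'⟩]
      · simp [glue, hx, hx']
  rw [heq]
  refine hu.if_le (hVc.if_le hw continuous_id continuous_const ?_) continuous_id
    continuous_const ?_
  · rintro x rfl; rw [hVv _ ⟨h, le_rfl⟩, h₂]
  · rintro x rfl; rw [if_pos h, hVv _ ⟨le_rfl, h⟩, h₁]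

theorem hasDerivAt_glue {m : ℝ} (h : x₁ ≤ x₂) (hx : x ∉ ({x₁, x₂} : Set ℝ))
    (hl : x < x₁ → HasDerivAt u m x) (hm : x₁ < x → x < x₂ → HasDerivAt v m x)
    (hr : x₂ < x → HasDerivAt w m x) : HasDerivAt (glue x₁ x₂ u v w) m x := by
  simp only [mem_insert_iff, mem_singleton_iff, not_or] at hx
  rcases lt_or_gt_of_ne hx.1 with h1 | h1
  · refine (hl h1).congr_of_eventuallyEq ?_
    filter_upwards [Iio_mem_nhds h1] with y hy using glue_left (le_of_lt hy)
  · rcases lt_or_gt_of_ne hx.2 with h2 | h2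
    · refine (hm h1 h2).congr_of_eventuallyEq ?_
      filter_upwards [Ioo_mem_nhds h1 h2] with y hy using glue_mid hy.1 hy.2.le
    · refine (hr h2).congr_of_eventuallyEq ?_
      filter_upwards [Ioi_mem_nhds h2] with y hy using glue_right (h.trans_lt hy) hy

theorem intervalIntegrable_glue {α β : ℝ} (hα : α ≤ x₁) (h : x₁ ≤ x₂) (hβ : x₂ ≤ β)
    (hu : IntervalIntegrable u volume α x₁) (hv : IntervalIntegrable v volume x₁ x₂)
    (hw : IntervalIntegrable w volume x₂ β) :
    IntervalIntegrable (glue x₁ x₂ u v w) volume α β := by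
  refine ((hu.congr ?_).trans (hv.congr ?_)).trans (hw.congr ?_)
  · intro x hx
    rw [uIoc_of_le hα] at hx
    exact (glue_left hx.2).symm
  · intro x hx
    rw [uIoc_of_le h] at hx
    exact (glue_mid hx.1 hx.2).symm
  · intro x hx
    rw [uIoc_of_le hβ] at hx
    exact (glue_right (h.trans_lt hx.1) hx.1).symm

end Glue

end

/-! ### Profiles made of two circular arcs and a bridge -/

section

section TwoBallProfile

variable {r₁ r₂ d x₁ x₂ : ℝ}

/-- The upper boundary that follows the circles around `(0, 0)` and `(d, 0)` outside of the
interval `[x₁, x₂]` and the function `v` in it. -/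
def bridge (r₁ r₂ d x₁ x₂ : ℝ) (v : ℝ → ℝ) : ℝ → ℝ := glue x₁ x₂ (arc r₁ 0) v (arc r₂ d)

/-- The slope of a bridge over an interval where its slope is `v'`. -/
def bridgeSlope (r₁ r₂ d x₁ x₂ : ℝ) (v' : ℝ → ℝ) : ℝ → ℝ :=
  glue x₁ x₂ (arcSlope r₁ 0) v' (arcSlope r₂ d)

theorem isProfile_bridge {E : Set (ℝ × ℝ)} {v v' : ℝ → ℝ} {s : Set ℝ} (h₁ : -r₁ < x₁)
    (h₁' : x₁ ≤ r₁) (h : x₁ ≤ x₂) (h₂' : d - r₂ ≤ x₂) (h₂ : x₂ < d + r₂)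
    (hv : ContinuousOn v (Icc x₁ x₂)) (hv₁ : arc r₁ 0 x₁ = v x₁) (hv₂ : v x₂ = arc r₂ d x₂)
    (hv' : ∀ x ∈ Ioo x₁ x₂, HasDerivAt v (v' x) x) (hi : IntervalIntegrable v' volume x₁ x₂)
    (hs : s.Countable) (hs₁ : x₁ ∈ s) (hs₂ : x₂ ∈ s) (hpos : ∀ x ∈ Ioo x₁ x₂ \ s, 0 < v x)
    (hE : MeasurableSet E)
    (hmem : ∀ x ∈ Ioo (-r₁) (d + r₂), ∀ y, |y| < bridge r₁ r₂ d x₁ x₂ v x → (x, y) ∈ E)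
    (hnot : ∀ x ∈ Ioo (-r₁) (d + r₂), ∀ y, bridge r₁ r₂ d x₁ x₂ v x < |y| → (x, y) ∉ E)
    (hout : ∀ x ∉ Icc (-r₁) (d + r₂), ∀ y, (x, y) ∉ E) :
    IsProfile (-r₁) (d + r₂) E (bridge r₁ r₂ d x₁ x₂ v) (bridgeSlope r₁ r₂ d x₁ x₂ v') s := by
  have hr₁ : 0 < r₁ := by linarith
  have hr₂ : 0 < r₂ := by linarith
  have hl : ∀ x, -r₁ < x → x < x₁ → |x - 0| < r₁ := fun x a b => by
    rw [sub_zero, abs_lt]; constructor <;> linarith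
  have hr : ∀ x, x₂ < x → x < d + r₂ → |x - d| < r₂ := fun x a b => by
    rw [abs_lt]; constructor <;> linarith
  have hns : ∀ x ∉ s, x ∉ ({x₁, x₂} : Set ℝ) := by
    rintro x hx (rfl | rfl)
    exacts [hx hs₁, hx hs₂]
  refine ⟨by linarith, hs, hE, continuous_glue h continuous_arc hv continuous_arc hv₁ hv₂, ?_, ?_,
    fun x hx => ?_, fun x hx => ?_, ?_, fun x hx => hmem x hx.1, fun x hx => hnot x hx.1, hout⟩
  · rw [bridge, glue_left h₁.le]; simp [arc]
  · rw [bridge, glue_right (by linarith) h₂]; simp [arc]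
  · rcases lt_or_ge x x₁ with hx1 | hx1
    · rw [bridge, glue_left hx1.le]; exact arc_pos (hl x hx.1.1 hx1)
    · have hx1' : x₁ < x := lt_of_le_of_ne hx1 fun e => hx.2 (e ▸ hs₁)
      rcases lt_or_ge x₂ x with hx2 | hx2
      · rw [bridge, glue_right hx1' hx2]; exact arc_pos (hr x hx2 hx.1.2)
      · rw [bridge, glue_mid hx1' hx2]
        exact hpos x ⟨⟨hx1', lt_of_le_of_ne hx2 fun e => hx.2 (e ▸ hs₂)⟩, hx.2⟩
  · refine hasDerivAt_glue h (hns x hx.2) (fun a => ?_) (fun a b => ?_) (fun a => ?_)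
    · rw [bridgeSlope, glue_left a.le]; exact hasDerivAt_arc (hl x hx.1.1 a)
    · rw [bridgeSlope, glue_mid a b.le]; exact hv' x ⟨a, b⟩
    · rw [bridgeSlope, glue_right (h.trans_lt a) a]; exact hasDerivAt_arc (hr x a hx.1.2)
  · refine intervalIntegrable_glue h₁.le h h₂.le (intervalIntegrable_arcSlope hr₁.le ?_ ?_) hi
      (intervalIntegrable_arcSlope hr₂.le ?_ ?_)
    all_goals constructor <;> linarith

/-- Along a circle or a line the sine of the slope angle is affine in `x`, with the signed curvature
as its derivative. The matching conditions on `q` say that the bridge is tangent to the circles. -/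
theorem isSlope_bridge {q : ℝ → ℝ} {k : ℝ} {s : Set ℝ} (h₁ : -r₁ < x₁) (h₁' : x₁ < r₁)
    (h : x₁ ≤ x₂) (h₂' : d - r₂ < x₂) (h₂ : x₂ < d + r₂) (hs₁ : x₁ ∈ s) (hs₂ : x₂ ∈ s)
    (hq : ∀ x, HasDerivAt q k x) (hq₁ : -x₁ / r₁ = q x₁) (hq₂ : q x₂ = -(x₂ - d) / r₂)
    (hq1 : ∀ x ∈ Icc x₁ x₂, |q x| < 1) :
    IsSlope (-r₁) (d + r₂) (bridgeSlope r₁ r₂ d x₁ x₂ fun x => q x / √(1 - q x ^ 2)) s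
      (glue x₁ x₂ (fun x => -x / r₁) q fun x => -(x - d) / r₂)
      (glue x₁ x₂ (fun _ => -1 / r₁) (fun _ => k) fun _ => -1 / r₂) := by
  have hr₁ : 0 < r₁ := by linarith
  have hr₂ : 0 < r₂ := by linarith
  have hns : ∀ x ∉ s, x ∉ ({x₁, x₂} : Set ℝ) := by
    rintro x hx (rfl | rfl)
    exacts [hx hs₁, hx hs₂]
  have hlt : ∀ x ∈ Ioo (-r₁) (d + r₂),
      |glue x₁ x₂ (fun x => -x / r₁) q (fun x => -(x - d) / r₂) x| < 1 := by
    intro x hx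
    rcases le_or_gt x x₁ with hx1 | hx1
    · rw [glue_left hx1, abs_div, abs_of_pos hr₁, div_lt_one hr₁, abs_lt]
      constructor <;> linarith [hx.1]
    · rcases le_or_gt x x₂ with hx2 | hx2
      · rw [glue_mid hx1 hx2]; exact hq1 x ⟨hx1.le, hx2⟩
      · rw [glue_right hx1 hx2, abs_div, abs_of_pos hr₂, div_lt_one hr₂, abs_lt]
        constructor <;> linarith [hx.2]
  refine ⟨?_, fun x hx => ?_, fun x hx => hlt x hx.1, fun x hx => ?_, fun x hx => ?_, ?_⟩
  · exact continuous_glue h (by fun_prop)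
      (fun x _ => (hq x).continuousAt.continuousWithinAt) (by fun_prop) hq₁ hq₂
  · rcases eq_or_lt_of_le hx.1 with rfl | hx1
    · rw [glue_left h₁.le, neg_neg, div_self hr₁.ne', abs_one]
    · rcases eq_or_lt_of_le hx.2 with rfl | hx2
      · rw [glue_right (h.trans_lt h₂) h₂, add_sub_cancel_left, neg_div, div_self hr₂.ne',
          abs_neg, abs_one]
      · exact (hlt x ⟨hx1, hx2⟩).le
  · rcases le_or_gt x x₁ with hx1 | hx1
    · rw [bridgeSlope, glue_left hx1, glue_left hx1, arcSlope_eq hr₁, sub_zero]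
    · rcases le_or_gt x x₂ with hx2 | hx2
      · rw [bridgeSlope, glue_mid hx1 hx2, glue_mid hx1 hx2]
      · rw [bridgeSlope, glue_right hx1 hx2, glue_right hx1 hx2, arcSlope_eq hr₂]
  · refine hasDerivAt_glue h (hns x hx.2) (fun a => ?_) (fun a b => ?_) (fun a => ?_)
    · rw [glue_left a.le]; exact (hasDerivAt_id x).neg.div_const r₁
    · rw [glue_mid a b.le]; exact hq x
    · rw [glue_right (h.trans_lt a) a]; exact ((hasDerivAt_id x).sub_const d).neg.div_const r₂
  · exact intervalIntegrable_glue h₁.le h h₂.le intervalIntegrable_const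
      intervalIntegrable_const intervalIntegrable_const

theorem intervalIntegrable_div_sqrt {q : ℝ → ℝ} (h : x₁ ≤ x₂) (hq : ContinuousOn q (Icc x₁ x₂))
    (hq1 : ∀ x ∈ Icc x₁ x₂, |q x| < 1) :
    IntervalIntegrable (fun x => q x / √(1 - q x ^ 2)) volume x₁ x₂ := by
  apply ContinuousOn.intervalIntegrable
  rw [uIcc_of_le h]
  refine hq.div (continuousOn_const.sub (hq.pow 2)).sqrt fun x hx => ?_
  have := (sq_lt_one_iff_abs_lt_one _).2 (hq1 x hx)
  exact (Real.sqrt_pos.2 (by linarith)).ne'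

/-- Comparison of a bridge of curvature `k` with a set that contains both balls. -/
theorem bridge_perimeter_le {E F : Set Plane} {v q f f' : ℝ → ℝ} {k : ℝ} {s t : Set ℝ}
    {o : Plane} {b : OrthonormalBasis (Fin 2) ℝ Plane} (h₁ : -r₁ < x₁) (h₁' : x₁ < r₁)
    (h : x₁ ≤ x₂) (h₂' : d - r₂ < x₂) (h₂ : x₂ < d + r₂) (hs₁ : x₁ ∈ s) (hs₂ : x₂ ∈ s)
    (hk : 0 ≤ k) (hq : ∀ x, HasDerivAt q k x) (hq₁ : -x₁ / r₁ = q x₁)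
    (hq₂ : q x₂ = -(x₂ - d) / r₂) (hq1 : ∀ x ∈ Icc x₁ x₂, |q x| < 1)
    (hE : IsProfile (-r₁) (d + r₂) (chart o b ⁻¹' E) (bridge r₁ r₂ d x₁ x₂ v)
      (bridgeSlope r₁ r₂ d x₁ x₂ fun x => q x / √(1 - q x ^ 2)) s)
    (hF : IsProfile (-r₁) (d + r₂) (chart o b ⁻¹' F) f f' t)
    (hF₁ : ∀ x y, x ^ 2 + y ^ 2 < r₁ ^ 2 → (x, y) ∈ chart o b ⁻¹' F)
    (hF₂ : ∀ x y, (x - d) ^ 2 + y ^ 2 < r₂ ^ 2 → (x, y) ∈ chart o b ⁻¹' F) :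
    perimeter E + ENNReal.ofReal k * volume E ≤ perimeter F + ENNReal.ofReal k * volume F := by
  have hr₁ : 0 < r₁ := by linarith
  have hr₂ : 0 < r₂ := by linarith
  refine perimeter_add_mul_volume_le hE hF
    (isSlope_bridge h₁ h₁' h h₂' h₂ hs₁ hs₂ hq hq₁ hq₂ hq1) hk fun x hx => ?_
  -- A profile region containing a ball lies above its arc. So `f - g ≥ 0` off the bridge, where the
  -- curvature is negative; on the bridge the curvature equals `k` and the sign of `f - g` is
  -- irrelevant.
  have hf : ∀ ρ c : ℝ, (∀ x y, (x - c) ^ 2 + y ^ 2 < ρ ^ 2 → (x, y) ∈ chart o b ⁻¹' F) →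
      arc ρ c x ≤ f x := fun ρ c hρ => by
    have hxt : x ∈ Ioo (-r₁) (d + r₂) \ t := ⟨hx.1, fun h => hx.2 (Or.inr h)⟩
    have hpos := hF.pos x hxt
    by_contra! hlt
    obtain ⟨y, hy1, hy2⟩ := exists_between hlt
    have hy0 : 0 < y := hpos.trans hy1
    refine hF.notMem x hxt y (by rwa [abs_of_pos hy0]) (hρ x y ?_)
    have := (Real.lt_sqrt hy0.le).1 hy2
    linarith
  rcases le_or_gt x x₁ with hx1 | hx1
  · rw [glue_left hx1, bridge, glue_left hx1]
    refine mul_le_mul_of_nonneg_right ?_ (sub_nonneg.2 (hf r₁ 0 (by simpa using hF₁)))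
    exact (div_nonpos_of_nonpos_of_nonneg (by norm_num) hr₁.le).trans hk
  · rcases le_or_gt x x₂ with hx2 | hx2
    · rw [glue_mid hx1 hx2]
    · rw [glue_right hx1 hx2, bridge, glue_right hx1 hx2]
      refine mul_le_mul_of_nonneg_right ?_ (sub_nonneg.2 (hf r₂ d hF₂))
      exact (div_nonpos_of_nonpos_of_nonneg (by norm_num) hr₂.le).trans hk

end TwoBallProfile

end

/-! ### The closing in coordinates -/

section

/-- The point `(X, Y)` is the center of a ball of radius `r` that does not meet the balls
with radii `r₁`, `r₂` and centers `(0, 0)`, `(d, 0)`. -/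
def IsOuterCenter (r₁ r₂ d r X Y : ℝ) : Prop :=
  (r + r₁) ^ 2 ≤ X ^ 2 + Y ^ 2 ∧ (r + r₂) ^ 2 ≤ (X - d) ^ 2 + Y ^ 2

/-- The closing of the two balls in coordinates. -/
def coordClosing (r₁ r₂ d r : ℝ) : Set (ℝ × ℝ) :=
  {p | ∀ X Y, IsOuterCenter r₁ r₂ d r X Y → r ^ 2 ≤ (X - p.1) ^ 2 + (Y - p.2) ^ 2}

variable {r₁ r₂ d r t h x y X Y : ℝ}

theorem IsOuterCenter.of_sq_le (hc : IsOuterCenter r₁ r₂ d r X Y) {Y' : ℝ} (hY : Y ^ 2 ≤ Y' ^ 2) :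
    IsOuterCenter r₁ r₂ d r X Y' :=
  ⟨by linarith [hc.1], by linarith [hc.2]⟩

/-- If a ball covers `(x, y')`, moving its center away from the axis by `|y| - |y'|`, to the side of
`y`, keeps it clear of both balls and does not increase the distance to the covered point, now `(x,
y)`. Hence the closing is symmetric and its vertical sections are intervals. -/
theorem mem_coordClosing_of_abs_le (hp : (x, y) ∈ coordClosing r₁ r₂ d r) {y' : ℝ}
    (hy : |y'| ≤ |y|) : (x, y') ∈ coordClosing r₁ r₂ d r := by
  intro X Y hc
  have h1 : ∀ Z : ℝ, |Z| = |Y| + (|y| - |y'|) → |Z - y| = |(|Z| - |y|)| →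
      r ^ 2 ≤ (X - x) ^ 2 + (Y - y') ^ 2 := fun Z hZ hZy => by
    have h2 := hp X Z (hc.of_sq_le (sq_le_sq.2 (by linarith)))
    have h3 : (Z - y) ^ 2 ≤ (Y - y') ^ 2 := by
      rw [sq_le_sq, hZy, hZ]
      refine le_trans (le_of_eq ?_) (abs_abs_sub_abs_le_abs_sub Y y')
      congr 1; ring
    simp only at h2 ⊢
    linarith
  have h0 : 0 ≤ |Y| + (|y| - |y'|) := by linarith [abs_nonneg Y]
  rcases le_total 0 y with hy0 | hy0
  · refine h1 (|Y| + (|y| - |y'|)) (abs_of_nonneg h0) ?_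
    rw [abs_of_nonneg h0, abs_of_nonneg hy0]
  · refine h1 (-(|Y| + (|y| - |y'|))) (by rw [abs_neg, abs_of_nonneg h0]) ?_
    rw [abs_neg, abs_of_nonneg h0, abs_of_nonpos hy0, ← abs_neg]
    congr 1; ring

/-- Raising a center keeps it admissible, so one center excludes everything above the lower arc of
its ball, not only the ball itself. -/
theorem notMem_coordClosing (hc : IsOuterCenter r₁ r₂ d r X Y) (hY : 0 ≤ Y) (hX : |X - x| < r)
    (hy : Y - √(r ^ 2 - (X - x) ^ 2) < |y|) : (x, y) ∉ coordClosing r₁ r₂ d r := by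
  intro hp
  have hp' : (x, |y|) ∈ coordClosing r₁ r₂ d r := mem_coordClosing_of_abs_le hp (by simp)
  have hpos := sub_sq_pos hX
  rcases le_total |y| Y with h1 | h1
  · have h2 := hp' X Y hc
    simp only at h2
    have h3 : (Y - |y|) ^ 2 < r ^ 2 - (X - x) ^ 2 :=
      (Real.lt_sqrt (by linarith)).1 (by linarith)
    linarith
  · have h2 := hp' X |y| (hc.of_sq_le (sq_le_sq.2 (by rwa [abs_abs, abs_of_nonneg hY])))
    simp only [sub_self] at h2
    linarith

/-- If `|z| ≤ ρ` and `|Z| ≥ r + ρ`, then `|Z - z| ≥ r`. -/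
theorem sq_le_of_sq_add_sq_le {ρ : ℝ} (hr : 0 ≤ r) (hρ : 0 ≤ ρ) (hz : x ^ 2 + y ^ 2 ≤ ρ ^ 2)
    (hZ : (r + ρ) ^ 2 ≤ X ^ 2 + Y ^ 2) : r ^ 2 ≤ (X - x) ^ 2 + (Y - y) ^ 2 := by
  have hA := Real.sq_sqrt (add_nonneg (sq_nonneg X) (sq_nonneg Y))
  have ha := Real.sq_sqrt (add_nonneg (sq_nonneg x) (sq_nonneg y))
  set A := √(X ^ 2 + Y ^ 2) with hAdef
  set a := √(x ^ 2 + y ^ 2) with hadef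
  have hA0 : 0 ≤ A := Real.sqrt_nonneg _
  have ha0 : 0 ≤ a := Real.sqrt_nonneg _
  have h1 : r + ρ ≤ A := Real.le_sqrt_of_sq_le hZ
  have h2 : a ≤ ρ := Real.sqrt_le_iff.2 ⟨hρ, hz⟩
  have h3 : X * x + Y * y ≤ A * a := by
    apply le_of_sq_le_sq _ (by positivity)
    rw [mul_pow, hA, ha]
    nlinarith [sq_nonneg (X * y - Y * x)]
  have h4 : r ^ 2 ≤ (A - a) ^ 2 := pow_le_pow_left₀ hr (by linarith) 2
  nlinarith

theorem mem_coordClosing_left (hr : 0 ≤ r) (hr₁ : 0 ≤ r₁) (hp : x ^ 2 + y ^ 2 ≤ r₁ ^ 2) :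
    (x, y) ∈ coordClosing r₁ r₂ d r := fun _ _ hc => sq_le_of_sq_add_sq_le hr hr₁ hp hc.1

theorem mem_coordClosing_right (hr : 0 ≤ r) (hr₂ : 0 ≤ r₂)
    (hp : (x - d) ^ 2 + y ^ 2 ≤ r₂ ^ 2) : (x, y) ∈ coordClosing r₁ r₂ d r := fun X Y hc => by
  have := sq_le_of_sq_add_sq_le hr hr₂ hp hc.2
  simpa using this

theorem mem_Icc_of_mem_coordClosing (hr : 0 < r) (hr₁ : 0 < r₁) (hr₂ : 0 < r₂)
    (hd : r₁ + r₂ ≤ d) (hp : (x, y) ∈ coordClosing r₁ r₂ d r) : x ∈ Icc (-r₁) (d + r₂) := by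
  constructor
  · by_contra! hx
    -- The center has abscissa at most `-r₁ - r`, hence is clear of both balls, and its distance to
    -- `(x, y)` is less than `r` in either case of the minimum.
    have hc : IsOuterCenter r₁ r₂ d r (min x (-r₁ - r / 2) - r / 2) y := by
      have := min_le_right x (-r₁ - r / 2)
      constructor <;> nlinarith [sq_nonneg y]
    have h1 := hp _ _ hc
    simp only [sub_self] at h1
    rcases min_choice x (-r₁ - r / 2) with e | e
    · rw [e] at h1; nlinarith
    · have := min_le_left x (-r₁ - r / 2)
      rw [e] at h1 this
      nlinarith
  · by_contra! hx
    have hc : IsOuterCenter r₁ r₂ d r (max x (d + r₂ + r / 2) + r / 2) y := by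
      have := le_max_right x (d + r₂ + r / 2)
      constructor <;> nlinarith [sq_nonneg y]
    have h1 := hp _ _ hc
    simp only [sub_self] at h1
    rcases max_choice x (d + r₂ + r / 2) with e | e
    · rw [e] at h1; nlinarith
    · have := le_max_left x (d + r₂ + r / 2)
      rw [e] at h1 this
      nlinarith

/-- `(t, h)` is the upper center of the circle of radius `r` that touches both balls. -/
structure IsTangentCenter (r₁ r₂ d r t h : ℝ) : Prop where
  left_pos : 0 < r₁
  right_pos : 0 < r₂
  pos : 0 < r
  dist_le : r₁ + r₂ ≤ d
  height_pos : 0 < h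
  left_eq : t ^ 2 + h ^ 2 = (r + r₁) ^ 2
  right_eq : (t - d) ^ 2 + h ^ 2 = (r + r₂) ^ 2

namespace IsTangentCenter

theorem isOuterCenter (H : IsTangentCenter r₁ r₂ d r t h) : IsOuterCenter r₁ r₂ d r t h :=
  ⟨H.left_eq.ge, H.right_eq.ge⟩

/-- Points of the triangle spanned by the centers that are not in the touching ball belong to the
closing. -/
theorem mem_coordClosing (H : IsTangentCenter r₁ r₂ d r t h) (hy : 0 ≤ y)
    (hl : t * y ≤ x * h) (hr : (t - d) * y ≥ (x - d) * h) (hp : r ^ 2 ≤ (x - t) ^ 2 + (y - h) ^ 2) :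
    (x, y) ∈ coordClosing r₁ r₂ d r := by
  intro X Y hc
  have hh := H.height_pos
  have hd : 0 < d := by linarith [H.left_pos, H.right_pos, H.dist_le]
  -- Barycentric coordinates in the triangle of centers: `a` is the weight of `(0, 0)`, `β` that of
  -- `(d, 0)`, and `1 - (a + β)` that of `(t, h)`.
  set β := (x * h - t * y) / (d * h) with hβ
  set a := ((t - d) * y - (x - d) * h) / (d * h) with ha
  have hβ0 : 0 ≤ β := div_nonneg (by linarith) (by positivity)
  have ha0 : 0 ≤ a := div_nonneg (by linarith) (by positivity)
  have hsum : 1 - (a + β) = y / h := by rw [ha, hβ]; field_simp; ring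
  have hsum0 : 0 ≤ 1 - (a + β) := by rw [hsum]; positivity
  have hx : x - t = -a * t + β * (d - t) := by rw [ha, hβ]; field_simp; ring
  have hyy : y - h = -(a + β) * h := by
    have : y = (1 - (a + β)) * h := by rw [hsum]; field_simp
    rw [this]; ring
  have c1 := hc.1
  have c2 := hc.2
  rw [← H.left_eq] at c1
  rw [← H.right_eq] at c2
  set u := X - t with hu
  set v := Y - h with hv
  have e1 : X = t + u := by rw [hu]; ring
  have e2 : Y = h + v := by rw [hv]; ring
  have n1 : 0 ≤ u ^ 2 + v ^ 2 + 2 * (u * t + v * h) := by rw [e1, e2] at c1; nlinarith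
  have n2 : 0 ≤ u ^ 2 + v ^ 2 + 2 * (u * (t - d) + v * h) := by rw [e1, e2] at c2; nlinarith
  -- The squared distance from the center `(X, Y)` to the point exceeds that from `(t, h)` by a
  -- combination of three nonnegative terms. Those with weights `a` and `β` are the excesses of its
  -- squared distances to the two ball centers over those of the touching center.
  have key : (X - x) ^ 2 + (Y - y) ^ 2 = (x - t) ^ 2 + (y - h) ^ 2 +
      (1 - (a + β)) * (u ^ 2 + v ^ 2) + a * (u ^ 2 + v ^ 2 + 2 * (u * t + v * h)) +
      β * (u ^ 2 + v ^ 2 + 2 * (u * (t - d) + v * h)) := by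
    have i1 : X - x = u - (x - t) := by rw [hu]; ring
    have i2 : Y - y = v - (y - h) := by rw [hv]; ring
    rw [i1, i2, hx, hyy]; ring
  simp only
  rw [key]
  nlinarith [mul_nonneg hsum0 (add_nonneg (sq_nonneg u) (sq_nonneg v)), mul_nonneg ha0 n1,
    mul_nonneg hβ0 n2]

end IsTangentCenter

end

/-! ### The touching circle and the profile of a connected closing -/

section

variable {r₁ r₂ d r t h x y X Y : ℝ}

theorem isClosed_coordClosing : IsClosed (coordClosing r₁ r₂ d r) := by
  have : coordClosing r₁ r₂ d r = ⋂ (X) (Y) (_ : IsOuterCenter r₁ r₂ d r X Y),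
      {p : ℝ × ℝ | r ^ 2 ≤ (X - p.1) ^ 2 + (Y - p.2) ^ 2} := by
    ext p; simp [coordClosing]
  rw [this]
  exact isClosed_iInter fun X => isClosed_iInter fun Y => isClosed_iInter fun _ =>
    isClosed_le continuous_const (by fun_prop)

/-- For acute angles of either sign, comparing sines is comparing tangents: the right triangles have
legs `(w, e)`, `(h, t)` and hypotenuses `r`, `A`. It turns a condition on abscissas into the
position of an arc point relative to a side of the triangle of centers. -/
theorem neg_mul_le_mul_of_sq_add_sq_eq {e w A : ℝ} (hw : 0 ≤ w) (hh : 0 ≤ h) (hr : 0 ≤ r)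
    (hA : 0 ≤ A) (h₁ : w ^ 2 + e ^ 2 = r ^ 2) (h₂ : h ^ 2 + t ^ 2 = A ^ 2)
    (h₃ : -(r * t) ≤ e * A) : -(t * w) ≤ e * h := by
  rcases le_total 0 e with he | he
  · rcases le_total 0 t with ht | ht
    · nlinarith [mul_nonneg ht hw, mul_nonneg he hh]
    · have h4 : (r * -t) ^ 2 ≤ (e * A) ^ 2 :=
        pow_le_pow_left₀ (mul_nonneg hr (by linarith)) (by linarith) 2
      have h5 : (-t * w) ^ 2 ≤ (e * h) ^ 2 := by
        have e1 : (r * -t) ^ 2 = t ^ 2 * (w ^ 2 + e ^ 2) := by rw [h₁]; ring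
        have e2 : (e * A) ^ 2 = e ^ 2 * (h ^ 2 + t ^ 2) := by rw [h₂]; ring
        rw [e1, e2] at h4
        nlinarith
      have := le_of_sq_le_sq h5 (mul_nonneg he hh)
      linarith
  · have ht : 0 ≤ r * t := by nlinarith
    have h4 : (-e * A) ^ 2 ≤ (r * t) ^ 2 :=
      pow_le_pow_left₀ (mul_nonneg (by linarith) hA) (by linarith) 2
    have h5 : (-e * h) ^ 2 ≤ (t * w) ^ 2 := by
      have e1 : (r * t) ^ 2 = t ^ 2 * (w ^ 2 + e ^ 2) := by rw [h₁]; ring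
      have e2 : (-e * A) ^ 2 = e ^ 2 * (h ^ 2 + t ^ 2) := by rw [h₂]; ring
      rw [e1, e2] at h4
      nlinarith
    rcases le_total 0 t with ht0 | ht0
    · have := le_of_sq_le_sq h5 (mul_nonneg ht0 hw)
      linarith
    · rcases eq_or_lt_of_le hr with h0 | h0
      · rw [← h0] at h₁
        have hw0 : w = 0 := by nlinarith [sq_nonneg w, sq_nonneg e]
        have he0 : e = 0 := by nlinarith [sq_nonneg w, sq_nonneg e]
        simp [hw0, he0]
      · have ht1 : t = 0 := by nlinarith
        rw [ht1] at h5
        have : -e * h = 0 := by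
          have : (-e * h) ^ 2 ≤ 0 := by simpa using h5
          nlinarith [sq_nonneg (-e * h)]
        rw [ht1]; linarith

namespace IsTangentCenter

/-- The abscissa of the point where the touching circle meets the left ball. -/
def left (r₁ r t : ℝ) : ℝ := r₁ * t / (r + r₁)

/-- The abscissa of the point where the touching circle meets the right ball. -/
def right (r₂ d r t : ℝ) : ℝ := d + r₂ * (t - d) / (r + r₂)

variable (H : IsTangentCenter r₁ r₂ d r t h)

include H

theorem abs_lt : |t| < r + r₁ := by
  have := H.left_pos; have := H.pos; have := H.height_pos
  apply abs_lt_of_sq_lt_sq _ (by linarith)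
  nlinarith [H.left_eq, sq_pos_of_pos H.height_pos]

theorem abs_sub_lt : |t - d| < r + r₂ := by
  have := H.right_pos; have := H.pos; have := H.height_pos
  apply abs_lt_of_sq_lt_sq _ (by linarith)
  nlinarith [H.right_eq, sq_pos_of_pos H.height_pos]

theorem add_left_pos : 0 < r + r₁ := by linarith [H.left_pos, H.pos]

theorem add_right_pos : 0 < r + r₂ := by linarith [H.right_pos, H.pos]

theorem abs_left_lt : |left r₁ r t| < r₁ := by
  rw [left, abs_div, abs_mul, abs_of_pos H.left_pos, abs_of_pos H.add_left_pos,
    div_lt_iff₀ H.add_left_pos]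
  exact mul_lt_mul_of_pos_left H.abs_lt H.left_pos

theorem abs_right_sub_lt : |right r₂ d r t - d| < r₂ := by
  rw [right, add_sub_cancel_left, abs_div, abs_mul, abs_of_pos H.right_pos,
    abs_of_pos H.add_right_pos, div_lt_iff₀ H.add_right_pos]
  exact mul_lt_mul_of_pos_left H.abs_sub_lt H.right_pos

theorem left_sub : left r₁ r t - t = -(r * t / (r + r₁)) := by
  have := H.add_left_pos
  rw [left]; field_simp; ring

theorem right_sub : right r₂ d r t - t = r * (d - t) / (r + r₂) := by
  have := H.add_right_pos
  rw [right]; field_simp; ring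

theorem left_lt_right : left r₁ r t < right r₂ d r t := by
  have hA := H.add_left_pos
  have hB := H.add_right_pos
  have hr := H.pos
  have hd : 0 < d := by linarith [H.left_pos, H.right_pos, H.dist_le]
  -- Equivalent to `(t - d)/(r + r₂) < t/(r + r₁)`, which is the monotonicity of `u ↦ u/√(u² + h²)`
  -- at `t - d < t`.
  have key : 0 < (d - t) * (r + r₁) + t * (r + r₂) := by
    have hh := sq_pos_of_pos H.height_pos
    rcases le_total 0 t with ht | ht
    · rcases le_total t d with htd | htd
      · rcases eq_or_lt_of_le ht with h0 | h0
        · rw [← h0]; simp only [sub_zero, zero_mul, add_zero]; positivity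
        · nlinarith [mul_nonneg (sub_nonneg.2 htd) hA.le, mul_pos h0 hB]
      · have h1 : ((t - d) * (r + r₁)) ^ 2 < (t * (r + r₂)) ^ 2 := by
          rw [mul_pow, mul_pow, ← H.left_eq, ← H.right_eq]
          nlinarith [mul_pos hh (by nlinarith : 0 < t ^ 2 - (t - d) ^ 2)]
        have := lt_of_pow_lt_pow_left₀ 2 (by positivity) h1
        linarith
    · have h1 : (-t * (r + r₂)) ^ 2 < ((d - t) * (r + r₁)) ^ 2 := by
        rw [mul_pow, mul_pow, ← H.left_eq, ← H.right_eq]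
        nlinarith [mul_pos hh (by nlinarith : 0 < (d - t) ^ 2 - t ^ 2)]
      have := lt_of_pow_lt_pow_left₀ 2 (mul_nonneg (by linarith) hA.le) h1
      linarith
  have e : right r₂ d r t - left r₁ r t =
      r * ((d - t) * (r + r₁) + t * (r + r₂)) / ((r + r₁) * (r + r₂)) := by
    have : right r₂ d r t - left r₁ r t =
      (right r₂ d r t - t) - (left r₁ r t - t) := by ring
    rw [this, H.left_sub, H.right_sub]; field_simp; ring
  have : 0 < right r₂ d r t - left r₁ r t := by rw [e]; positivity
  linarith

theorem abs_sub_lt_of_mem (hx : x ∈ Icc (left r₁ r t) (right r₂ d r t)) : |x - t| < r := by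
  have h1 : -r < left r₁ r t - t := by
    rw [H.left_sub, neg_lt_neg_iff, div_lt_iff₀ H.add_left_pos]
    exact mul_lt_mul_of_pos_left (lt_of_abs_lt H.abs_lt) H.pos
  have h2 : right r₂ d r t - t < r := by
    rw [H.right_sub, div_lt_iff₀ H.add_right_pos]
    have := neg_lt_of_abs_lt H.abs_sub_lt
    exact mul_lt_mul_of_pos_left (by linarith) H.pos
  rw [_root_.abs_lt]
  constructor <;> linarith [hx.1, hx.2]

/-- The contact point divides the segment from `(0, 0)` to `(t, h)` in the ratio `r₁ : r`, so its
height is `r₁ h / (r + r₁)` on either circle. -/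
theorem arc_left : arc r₁ 0 (left r₁ r t) = h - arc r t (left r₁ r t) := by
  have hA := H.add_left_pos
  have hr := H.pos
  have hr₁ := H.left_pos
  have hh := H.height_pos
  have e1 : arc r₁ 0 (left r₁ r t) = r₁ * h / (r + r₁) := by
    rw [arc, ← Real.sqrt_sq (by positivity : 0 ≤ r₁ * h / (r + r₁)), left]
    congr 1
    have := H.left_eq
    field_simp
    linear_combination (-r₁ ^ 2) * this
  have e2 : arc r t (left r₁ r t) = r * h / (r + r₁) := by
    rw [arc, ← Real.sqrt_sq (by positivity : 0 ≤ r * h / (r + r₁)), H.left_sub]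
    congr 1
    have := H.left_eq
    field_simp
    linear_combination (-1) * this
  rw [e1, e2]; field_simp; ring

theorem arc_right : h - arc r t (right r₂ d r t) = arc r₂ d (right r₂ d r t) := by
  have hA := H.add_right_pos
  have hr := H.pos
  have hr₁ := H.right_pos
  have hh := H.height_pos
  have e1 : arc r₂ d (right r₂ d r t) = r₂ * h / (r + r₂) := by
    rw [arc, ← Real.sqrt_sq (by positivity : 0 ≤ r₂ * h / (r + r₂)), right]
    congr 1
    have := H.right_eq
    field_simp
    linear_combination (-r₂ ^ 2) * this
  have e2 : arc r t (right r₂ d r t) = r * h / (r + r₂) := by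
    rw [arc, ← Real.sqrt_sq (by positivity : 0 ≤ r * h / (r + r₂)), H.right_sub]
    congr 1
    have := H.right_eq
    field_simp
    linear_combination (-1) * this
  rw [e1, e2]; field_simp; ring

/-- Outside the gap the axis point lies in one of the closed balls, which the touching ball does not
enter; so the condition on the gap suffices. -/
theorem mid_nonneg (hconn : ∀ x ∈ Icc r₁ (d - r₂), r ^ 2 ≤ (x - t) ^ 2 + h ^ 2)
    (hx : x ∈ Icc (left r₁ r t) (right r₂ d r t)) : r ^ 2 ≤ (x - t) ^ 2 + h ^ 2 := by
  have h1 := _root_.abs_lt.1 H.abs_left_lt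
  have h2 := _root_.abs_lt.1 H.abs_right_sub_lt
  rcases lt_or_ge x r₁ with hx1 | hx1
  · have hm : (x, (0 : ℝ)) ∈ coordClosing r₁ r₂ d r := mem_coordClosing_left H.pos.le
      H.left_pos.le (by nlinarith [hx.1])
    have := hm t h H.isOuterCenter
    simp only at this
    linarith
  · rcases lt_or_ge (d - r₂) x with hx2 | hx2
    · have hm : (x, (0 : ℝ)) ∈ coordClosing r₁ r₂ d r := mem_coordClosing_right H.pos.le
        H.right_pos.le (by nlinarith [hx.2])
      have := hm t h H.isOuterCenter
      simp only at this
      linarith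
    · exact hconn x ⟨hx1, hx2⟩

theorem mid_mem (hconn : ∀ x ∈ Icc r₁ (d - r₂), r ^ 2 ≤ (x - t) ^ 2 + h ^ 2)
    (hx : x ∈ Icc (left r₁ r t) (right r₂ d r t)) :
    0 ≤ h - arc r t x ∧ (x, h - arc r t x) ∈ coordClosing r₁ r₂ d r := by
  have hw := arc_sq (H.abs_sub_lt_of_mem hx).le
  have hw0 : 0 ≤ arc r t x := Real.sqrt_nonneg _
  have hA := H.add_left_pos
  have hB := H.add_right_pos
  have h0 : 0 ≤ h - arc r t x := by
    have := H.mid_nonneg hconn hx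
    have := le_of_sq_le_sq (by linarith : arc r t x ^ 2 ≤ h ^ 2) H.height_pos.le
    linarith
  refine ⟨h0, H.mem_coordClosing h0 ?_ ?_ ?_⟩
  · have h1 : -(r * t) ≤ (x - t) * (r + r₁) := by
      have := hx.1
      have h2 := H.left_sub
      have h3 : -(r * t / (r + r₁)) ≤ x - t := by linarith
      rw [← neg_div, div_le_iff₀ hA] at h3
      exact h3
    have := neg_mul_le_mul_of_sq_add_sq_eq hw0 H.height_pos.le H.pos.le hA.le
      (by linarith) (by linarith [H.left_eq]) h1
    nlinarith
  · have h1 : -(r * (d - t)) ≤ (t - x) * (r + r₂) := by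
      have := hx.2
      have h2 := H.right_sub
      have h3 : x - t ≤ r * (d - t) / (r + r₂) := by linarith
      rw [le_div_iff₀ hB] at h3
      linarith
    have := neg_mul_le_mul_of_sq_add_sq_eq (e := t - x) (t := d - t) hw0 H.height_pos.le
      H.pos.le hB.le (by linarith) (by linarith [H.right_eq]) h1
    nlinarith
  · have : (h - arc r t x - h) ^ 2 = arc r t x ^ 2 := by ring
    rw [this, hw]; linarith

/-- This ball touches the left ball at the arc point over `x`. Its center is on the same circle
about the origin as `(t, h)` but not to the right of it, hence at least as far from `(d, 0)`. -/
theorem isOuterCenter_left (hx : |x| ≤ r₁) (hxl : x ≤ left r₁ r t) :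
    IsOuterCenter r₁ r₂ d r ((1 + r / r₁) * x) ((1 + r / r₁) * arc r₁ 0 x) := by
  have hr₁ := H.left_pos
  have hd : 0 < d := by linarith [H.left_pos, H.right_pos, H.dist_le]
  have ha := arc_sq (ρ := r₁) (c := 0) (by simpa using hx)
  have e : ((1 + r / r₁) * x) ^ 2 + ((1 + r / r₁) * arc r₁ 0 x) ^ 2 = (r + r₁) ^ 2 := by
    rw [mul_pow, mul_pow, ha]; field_simp; ring
  refine ⟨e.ge, ?_⟩
  have h2 : (1 + r / r₁) * x ≤ t := by
    rw [left, le_div_iff₀ H.add_left_pos] at hxl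
    have : (1 + r / r₁) * x = x * (r + r₁) / r₁ := by field_simp; ring
    rw [this, div_le_iff₀ hr₁]; linarith
  nlinarith [H.left_eq, H.right_eq, mul_le_mul_of_nonneg_left h2 hd.le]

theorem isOuterCenter_right (hx : |x - d| ≤ r₂) (hxr : right r₂ d r t ≤ x) :
    IsOuterCenter r₁ r₂ d r (d + (1 + r / r₂) * (x - d)) ((1 + r / r₂) * arc r₂ d x) := by
  have hr₂ := H.right_pos
  have hd : 0 < d := by linarith [H.left_pos, H.right_pos, H.dist_le]
  have ha := arc_sq hx
  have e : ((1 + r / r₂) * (x - d)) ^ 2 + ((1 + r / r₂) * arc r₂ d x) ^ 2 = (r + r₂) ^ 2 := by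
    rw [mul_pow, mul_pow, ha]; field_simp; ring
  have h2 : t - d ≤ (1 + r / r₂) * (x - d) := by
    have hxr' : r₂ * (t - d) / (r + r₂) ≤ x - d := by rw [right] at hxr; linarith
    rw [div_le_iff₀ H.add_right_pos] at hxr'
    have : (1 + r / r₂) * (x - d) = (x - d) * (r + r₂) / r₂ := by field_simp; ring
    rw [this, le_div_iff₀ hr₂]; linarith
  refine ⟨?_, by rw [add_sub_cancel_left]; exact e.ge⟩
  nlinarith [H.left_eq, H.right_eq, mul_le_mul_of_nonneg_left h2 hd.le]

/-- The abscissas where the boundary of the closing is not known to be regular. -/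
def exceptional (r₁ r₂ d r t h : ℝ) : Set ℝ :=
  {left r₁ r t, right r₂ d r t, t + √(r ^ 2 - h ^ 2), t - √(r ^ 2 - h ^ 2)}

theorem sqrt_sub_sq_left (hx : |x| ≤ r₁) :
    √(r ^ 2 - ((1 + r / r₁) * x - x) ^ 2) = r / r₁ * arc r₁ 0 x := by
  have hr₁ := H.left_pos
  have hr := H.pos
  have ha := arc_sq (ρ := r₁) (c := 0) (by simpa using hx)
  rw [← Real.sqrt_sq (mul_nonneg (by positivity) (Real.sqrt_nonneg _) : 0 ≤ r / r₁ * arc r₁ 0 x),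
    mul_pow, ha]
  congr 1
  field_simp; ring

theorem sqrt_sub_sq_right (hx : |x - d| ≤ r₂) :
    √(r ^ 2 - (d + (1 + r / r₂) * (x - d) - x) ^ 2) = r / r₂ * arc r₂ d x := by
  have hr₂ := H.right_pos
  have hr := H.pos
  have ha := arc_sq hx
  rw [← Real.sqrt_sq (mul_nonneg (by positivity) (Real.sqrt_nonneg _) : 0 ≤ r / r₂ * arc r₂ d x),
    mul_pow, ha]
  congr 1
  field_simp; ring

/-- The profile of the closing with radius `r`. -/
theorem isProfile (hconn : ∀ x ∈ Icc r₁ (d - r₂), r ^ 2 ≤ (x - t) ^ 2 + h ^ 2) :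
    IsProfile (-r₁) (d + r₂) (coordClosing r₁ r₂ d r)
      (bridge r₁ r₂ d (left r₁ r t) (right r₂ d r t) fun x => h - arc r t x)
      (bridgeSlope r₁ r₂ d (left r₁ r t) (right r₂ d r t)
        fun x => (x - t) / r / √(1 - ((x - t) / r) ^ 2))
      (exceptional r₁ r₂ d r t h) := by
  have h1 := _root_.abs_lt.1 H.abs_left_lt
  have h2 := _root_.abs_lt.1 H.abs_right_sub_lt
  have hlr := H.left_lt_right
  have hr := H.pos
  have hr₁ := H.left_pos
  have hr₂ := H.right_pos
  have hq1 : ∀ x ∈ Icc (left r₁ r t) (right r₂ d r t), |(x - t) / r| < 1 := fun x hx => by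
    rw [abs_div, abs_of_pos hr, div_lt_one hr]; exact H.abs_sub_lt_of_mem hx
  refine isProfile_bridge h1.1 h1.2.le hlr.le (by linarith) (by linarith)
    (continuous_const.sub continuous_arc).continuousOn H.arc_left H.arc_right
    (fun x hx => ?_) (intervalIntegrable_div_sqrt hlr.le (by fun_prop) hq1)
    (Set.Finite.countable (by simp [exceptional])) (by simp [exceptional])
    (by simp [exceptional]) (fun x hx => ?_) isClosed_coordClosing.measurableSet
    (fun x hx y hy => ?_) (fun x hx y hy => ?_)
    (fun x hx y hxy => hx (mem_Icc_of_mem_coordClosing hr hr₁ hr₂ H.dist_le hxy))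
  · have := (hasDerivAt_arc (H.abs_sub_lt_of_mem (Ioo_subset_Icc_self hx))).const_sub h
    refine this.congr_deriv ?_
    rw [arcSlope_eq hr, neg_div, neg_sq, neg_div, neg_neg]
  -- The bridge can meet the axis only where `(x - t)² = r² - h²`, that is, at the last two
  -- exceptional abscissas. If `r < h` the square root is 0 by default and these are merely
  -- superfluous.
  · have hx' := Ioo_subset_Icc_self hx.1
    refine lt_of_le_of_ne (H.mid_mem hconn hx').1 fun h0 => hx.2 ?_
    have hw := arc_sq (H.abs_sub_lt_of_mem hx').le
    have hw' : arc r t x = h := by linarith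
    rw [hw'] at hw
    have h3 : √(r ^ 2 - h ^ 2) = |x - t| := by
      rw [← Real.sqrt_sq_eq_abs]; congr 1; linarith
    simp only [exceptional, h3, mem_insert_iff, mem_singleton_iff]
    rcases abs_choice (x - t) with e | e <;> rw [e]
    · exact Or.inr (Or.inr (Or.inl (by ring)))
    · exact Or.inr (Or.inr (Or.inr (by ring)))
  · rcases le_or_gt x (left r₁ r t) with hx1 | hx1
    · rw [bridge, glue_left hx1] at hy
      refine mem_coordClosing_left hr.le hr₁.le ?_
      have := (Real.lt_sqrt (abs_nonneg y)).1 hy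
      rw [sq_abs, sub_zero] at this
      linarith
    · rcases le_or_gt x (right r₂ d r t) with hx2 | hx2
      · rw [bridge, glue_mid hx1 hx2] at hy
        obtain ⟨h3, h4⟩ := H.mid_mem hconn ⟨hx1.le, hx2⟩
        exact mem_coordClosing_of_abs_le h4 (by rw [abs_of_nonneg h3]; exact hy.le)
      · rw [bridge, glue_right hx1 hx2] at hy
        refine mem_coordClosing_right hr.le hr₂.le ?_
        have := (Real.lt_sqrt (abs_nonneg y)).1 hy
        rw [sq_abs] at this
        linarith
  · rcases le_or_gt x (left r₁ r t) with hx1 | hx1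
    · rw [bridge, glue_left hx1] at hy
      have hxr : |x| < r₁ := _root_.abs_lt.2 ⟨hx.1, by linarith⟩
      refine notMem_coordClosing (H.isOuterCenter_left hxr.le hx1)
        (mul_nonneg (by positivity) (Real.sqrt_nonneg _)) ?_ ?_
      · have : (1 + r / r₁) * x - x = r * (x / r₁) := by ring
        rw [this, abs_mul, abs_of_pos hr, abs_div, abs_of_pos hr₁]
        have := (div_lt_one hr₁).2 hxr
        nlinarith
      · rw [H.sqrt_sub_sq_left hxr.le]; linarith
    · rcases le_or_gt x (right r₂ d r t) with hx2 | hx2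
      · rw [bridge, glue_mid hx1 hx2] at hy
        have hxt := H.abs_sub_lt_of_mem ⟨hx1.le, hx2⟩
        refine notMem_coordClosing H.isOuterCenter H.height_pos.le (by rwa [abs_sub_comm]) ?_
        rw [arc] at hy
        rwa [← neg_sub x t, neg_sq]
      · rw [bridge, glue_right hx1 hx2] at hy
        have hxr : |x - d| < r₂ := _root_.abs_lt.2 ⟨by linarith, by linarith [hx.2]⟩
        refine notMem_coordClosing (H.isOuterCenter_right hxr.le hx2.le)
          (mul_nonneg (by positivity) (Real.sqrt_nonneg _)) ?_ ?_
        · have : d + (1 + r / r₂) * (x - d) - x = r * ((x - d) / r₂) := by ring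
          rw [this, abs_mul, abs_of_pos hr, abs_div, abs_of_pos hr₂]
          have := (div_lt_one hr₂).2 hxr
          nlinarith
        · rw [H.sqrt_sub_sq_right hxr.le]; linarith

/-- The closing with radius `r` minimizes perimeter plus area over `r` among the profiles that
contain the two balls. -/
theorem perimeter_le {E F : Set Plane} {o : Plane} {b : OrthonormalBasis (Fin 2) ℝ Plane}
    (hconn : ∀ x ∈ Icc r₁ (d - r₂), r ^ 2 ≤ (x - t) ^ 2 + h ^ 2)
    (hE : chart o b ⁻¹' E = coordClosing r₁ r₂ d r) {f f' : ℝ → ℝ} {s : Set ℝ}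
    (hF : IsProfile (-r₁) (d + r₂) (chart o b ⁻¹' F) f f' s)
    (hF₁ : ∀ x y, x ^ 2 + y ^ 2 < r₁ ^ 2 → (x, y) ∈ chart o b ⁻¹' F)
    (hF₂ : ∀ x y, (x - d) ^ 2 + y ^ 2 < r₂ ^ 2 → (x, y) ∈ chart o b ⁻¹' F) :
    perimeter E + ENNReal.ofReal (1 / r) * volume E ≤
      perimeter F + ENNReal.ofReal (1 / r) * volume F := by
  have h1 := _root_.abs_lt.1 H.abs_left_lt
  have h2 := _root_.abs_lt.1 H.abs_right_sub_lt
  have hr := H.pos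
  have hr₁ := H.left_pos
  have hr₂ := H.right_pos
  have hA := H.add_left_pos
  have hB := H.add_right_pos
  -- The sine of the slope angle of the lower arc, with derivative `1/r`; at the contact points it
  -- agrees with those of the two circles.
  refine bridge_perimeter_le (q := fun x => (x - t) / r)
    (s := exceptional r₁ r₂ d r t h) h1.1 h1.2
    H.left_lt_right.le (by linarith) (by linarith)
    (by simp [exceptional]) (by simp [exceptional]) (by positivity)
    (fun x => ((hasDerivAt_id x).sub_const t).div_const r) ?_ ?_ (fun x hx => ?_)
    (by rw [hE]; exact H.isProfile hconn) hF hF₁ hF₂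
  · rw [H.left_sub, left]; field_simp
  · rw [H.right_sub, right]; field_simp; ring
  · rw [abs_div, abs_of_pos hr, div_lt_one hr]; exact H.abs_sub_lt_of_mem hx

end IsTangentCenter

end

/-! ### Touching balls and the convex hull -/

section

variable {r₁ r₂ d x y : ℝ}

/-- The union of the two balls in coordinates. -/
def coordBalls (r₁ r₂ d : ℝ) : Set (ℝ × ℝ) :=
  {p | p.1 ^ 2 + p.2 ^ 2 < r₁ ^ 2 ∨ (p.1 - d) ^ 2 + p.2 ^ 2 < r₂ ^ 2}

theorem isOpen_coordBalls : IsOpen (coordBalls r₁ r₂ d) :=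
  (isOpen_lt (f := fun p : ℝ × ℝ => p.1 ^ 2 + p.2 ^ 2) (by fun_prop) continuous_const).union
    (isOpen_lt (f := fun p : ℝ × ℝ => (p.1 - d) ^ 2 + p.2 ^ 2) (by fun_prop) continuous_const)

/-- The profile of two touching balls. -/
theorem isProfile_coordBalls (hr₁ : 0 < r₁) (hr₂ : 0 < r₂) (hd : d = r₁ + r₂) :
    IsProfile (-r₁) (d + r₂) (coordBalls r₁ r₂ d) (bridge r₁ r₂ d r₁ r₁ fun _ => 0)
      (bridgeSlope r₁ r₂ d r₁ r₁ fun _ => 0) {r₁} := by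
  refine isProfile_bridge (by linarith) le_rfl le_rfl (by linarith) (by linarith)
    continuousOn_const (by simp [arc]) (by simp [arc, hd])
    (fun x hx => absurd (hx.1.trans hx.2) (lt_irrefl _)) (by simp) (countable_singleton _) rfl rfl
    (fun x hx => absurd (hx.1.1.trans hx.1.2) (lt_irrefl _)) isOpen_coordBalls.measurableSet
    (fun x hx y hy => ?_) (fun x hx y hy => ?_) (fun x hx y hxy => hx ?_)
  · rcases le_or_gt x r₁ with hx1 | hx1
    · rw [bridge, glue_left hx1] at hy
      have := (Real.lt_sqrt (abs_nonneg y)).1 hy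
      rw [sq_abs, sub_zero] at this
      exact Or.inl (by simp only; linarith)
    · rw [bridge, glue_right hx1 hx1] at hy
      have := (Real.lt_sqrt (abs_nonneg y)).1 hy
      rw [sq_abs] at this
      exact Or.inr (by simp only; linarith)
  · rcases le_or_gt x r₁ with hx1 | hx1
    · rw [bridge, glue_left hx1] at hy
      have h1 : r₁ ^ 2 - (x - 0) ^ 2 < y ^ 2 := by
        rw [← sq_abs y]; exact Real.lt_sq_of_sqrt_lt hy
      rw [sub_zero] at h1
      rintro (h | h) <;> simp only at h
      · linarith
      · nlinarith [sq_nonneg y]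
    · rw [bridge, glue_right hx1 hx1] at hy
      have h1 : r₂ ^ 2 - (x - d) ^ 2 < y ^ 2 := by
        rw [← sq_abs y]; exact Real.lt_sq_of_sqrt_lt hy
      rintro (h | h) <;> simp only at h
      · nlinarith [sq_nonneg y]
      · linarith
  · rcases hxy with h | h <;> simp only at h
    · have := abs_lt.1 (abs_lt_of_sq_lt_sq (by nlinarith [sq_nonneg y] : x ^ 2 < r₁ ^ 2) hr₁.le)
      constructor <;> linarith [this.1, this.2]
    · have := abs_lt.1 (abs_lt_of_sq_lt_sq (by nlinarith [sq_nonneg y] : (x - d) ^ 2 < r₂ ^ 2)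
        hr₂.le)
      constructor <;> linarith [this.1, this.2]

section Chart

variable (o : Plane) (b : OrthonormalBasis (Fin 2) ℝ Plane)

/-- The chart as an affine map. -/
def chartAffine : (ℝ × ℝ) →ᵃ[ℝ] Plane where
  toFun := chart o b
  linear := (LinearMap.fst ℝ ℝ ℝ).smulRight (b 0) + (LinearMap.snd ℝ ℝ ℝ).smulRight (b 1)
  map_vadd' p v := by
    simp only [chart, vadd_eq_add, Prod.fst_add, Prod.snd_add, add_smul, LinearMap.add_apply,
      LinearMap.smulRight_apply, LinearMap.fst_apply, LinearMap.snd_apply]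
    abel

theorem preimage_closure_convexHull {S : Set Plane} :
    chart o b ⁻¹' closure (convexHull ℝ S) = closure (convexHull ℝ (chart o b ⁻¹' S)) := by
  have h1 : chart o b '' convexHull ℝ (chart o b ⁻¹' S) = convexHull ℝ S := by
    have := (chartAffine o b).image_convexHull (chart o b ⁻¹' S)
    change chart o b '' _ = convexHull ℝ (chart o b '' _) at this
    rwa [image_preimage_eq _ (chart_surjective o b)] at this
  have h2 := (chartHomeo o b).preimage_closure (convexHull ℝ S)
  change chart o b ⁻¹' _ = closure (chart o b ⁻¹' _) at h2
  rw [h2, ← h1, preimage_image_eq _ (show Function.Injective (chart o b) from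
    (chartHomeo o b).injective)]

/-- The frontier of a convex set is null, so the closed hull, which contains its tangent segments,
may replace the hull. -/
theorem closure_convexHull_ae_eq (S : Set Plane) :
    closure (convexHull ℝ S) =ᵐ[volume] convexHull ℝ S :=
  closure_ae_eq_of_null_frontier ((convex_convexHull ℝ S).addHaar_frontier volume)

end Chart

theorem mem_closure_ball_coord {c ρ : ℝ} (hρ : 0 < ρ) (h : (x - c) ^ 2 + y ^ 2 ≤ ρ ^ 2) :
    (x, y) ∈ closure {p : ℝ × ℝ | (p.1 - c) ^ 2 + p.2 ^ 2 < ρ ^ 2} := by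
  have hlim : Tendsto (fun τ : ℝ => (c + τ * (x - c), τ * y)) (𝓝[<] 1) (𝓝 (x, y)) := by
    have : Continuous fun τ : ℝ => (c + τ * (x - c), τ * y) := by fun_prop
    have h1 := this.tendsto 1
    simp only [one_mul, add_sub_cancel] at h1
    exact h1.mono_left nhdsWithin_le_nhds
  refine mem_closure_of_tendsto hlim ?_
  filter_upwards [Ioo_mem_nhdsLT (zero_lt_one (α := ℝ))] with τ hτ
  have h2 : (c + τ * (x - c) - c) ^ 2 + (τ * y) ^ 2 = τ ^ 2 * ((x - c) ^ 2 + y ^ 2) := by ring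
  have h3 : τ ^ 2 < 1 := by nlinarith [hτ.1, hτ.2]
  have h4 : τ ^ 2 * ((x - c) ^ 2 + y ^ 2) ≤ τ ^ 2 * ρ ^ 2 :=
    mul_le_mul_of_nonneg_left h (sq_nonneg τ)
  have h5 : 0 < ρ ^ 2 := by positivity
  change (c + τ * (x - c) - c) ^ 2 + (τ * y) ^ 2 < ρ ^ 2
  rw [h2]; nlinarith

theorem mem_closure_hull_left (hr₁ : 0 < r₁) (h : x ^ 2 + y ^ 2 ≤ r₁ ^ 2) :
    (x, y) ∈ closure (convexHull ℝ (coordBalls r₁ r₂ d)) := by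
  refine closure_mono ?_ (mem_closure_ball_coord (c := 0) hr₁ (by simpa using h))
  refine subset_trans (fun p hp => Or.inl ?_) (subset_convexHull ℝ _)
  simpa using hp

theorem mem_closure_hull_right (hr₂ : 0 < r₂) (h : (x - d) ^ 2 + y ^ 2 ≤ r₂ ^ 2) :
    (x, y) ∈ closure (convexHull ℝ (coordBalls r₁ r₂ d)) :=
  closure_mono (subset_trans (fun _ hp => Or.inr hp) (subset_convexHull ℝ _))
    (mem_closure_ball_coord hr₂ h)

/-- The hull lies in every closed half-plane that contains both balls; `h₁` and `h₂` bound their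
support functions. The reflected normal accounts for `|y|`. -/
theorem le_of_mem_closure_hull (hr₁ : 0 < r₁) (hr₂ : 0 < r₂) {n₁ n₂ m : ℝ}
    (hn : n₁ ^ 2 + n₂ ^ 2 = 1) (h₁ : r₁ ≤ m) (h₂ : d * n₁ + r₂ ≤ m)
    (h : (x, y) ∈ closure (convexHull ℝ (coordBalls r₁ r₂ d))) : n₁ * x + n₂ * |y| ≤ m := by
  have key : ∀ k₂ : ℝ, n₁ ^ 2 + k₂ ^ 2 = 1 → n₁ * x + k₂ * y ≤ m := by
    intro k₂ hk
    have hsub : closure (convexHull ℝ (coordBalls r₁ r₂ d)) ⊆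
        {p : ℝ × ℝ | n₁ * p.1 + k₂ * p.2 ≤ m} := by
      refine closure_minimal (convexHull_min ?_ ?_) (isClosed_le (by fun_prop) continuous_const)
      · have hcs : ∀ u v ρ : ℝ, 0 < ρ → u ^ 2 + v ^ 2 < ρ ^ 2 → n₁ * u + k₂ * v ≤ ρ :=
          fun u v ρ hρ huv => by
            apply le_of_sq_le_sq _ hρ.le
            nlinarith [sq_nonneg (n₁ * v - k₂ * u)]
        rintro p (hp | hp)
        · exact (hcs _ _ _ hr₁ hp).trans h₁
        · have := hcs _ _ _ hr₂ hp
          simp only [mem_ofPred_eq]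
          linarith
      · exact convex_halfSpace_le (f := fun p : ℝ × ℝ => n₁ * p.1 + k₂ * p.2)
          ⟨fun p q => by simp only [Prod.fst_add, Prod.snd_add]; ring,
            fun c p => by simp only [Prod.smul_fst, Prod.smul_snd, smul_eq_mul]; ring⟩ m
    exact hsub h
  rcases abs_choice y with e | e <;> rw [e]
  · exact key n₂ hn
  · have := key (-n₂) (by rwa [neg_sq])
    linarith

section Hull

/-- The cosine of the angle between the axis and the normal of the upper common tangent. -/
def tangentCos (r₁ r₂ d : ℝ) : ℝ := (r₁ - r₂) / d

variable (hr₁ : 0 < r₁) (hr₂ : 0 < r₂) (hd : r₁ + r₂ ≤ d)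

include hr₁ hr₂ hd

theorem abs_tangentCos_lt : |tangentCos r₁ r₂ d| < 1 := by
  have h : 0 < d := by linarith
  rw [tangentCos, abs_div, abs_of_pos h, div_lt_one h, abs_lt]
  constructor <;> linarith

theorem mul_tangentCos : d * tangentCos r₁ r₂ d = r₁ - r₂ := by
  have h : 0 < d := by linarith
  rw [tangentCos]; field_simp

theorem one_sub_tangentCos_sq_pos : 0 < 1 - tangentCos r₁ r₂ d ^ 2 := by
  have := (sq_lt_one_iff_abs_lt_one _).2 (abs_tangentCos_lt hr₁ hr₂ hd)
  linarith

theorem mul_tangentCos_lt : r₁ * tangentCos r₁ r₂ d < d + r₂ * tangentCos r₁ r₂ d := by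
  have h1 := mul_tangentCos hr₁ hr₂ hd
  have h2 := one_sub_tangentCos_sq_pos hr₁ hr₂ hd
  nlinarith

/-- These points fill the segment between the two contact points of a common tangent, the upper one
for `σ = 1` and the lower one for `σ = -1`. -/
theorem tangent_mem {σ : ℝ} (hσ : σ ^ 2 = 1)
    (hx : x ∈ Icc (r₁ * tangentCos r₁ r₂ d) (d + r₂ * tangentCos r₁ r₂ d)) :
    (x, σ * ((r₁ - tangentCos r₁ r₂ d * x) / √(1 - tangentCos r₁ r₂ d ^ 2))) ∈
      closure (convexHull ℝ (coordBalls r₁ r₂ d)) := by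
  have hc := mul_tangentCos hr₁ hr₂ hd
  have h1 := one_sub_tangentCos_sq_pos hr₁ hr₂ hd
  have h2 := mul_tangentCos_lt hr₁ hr₂ hd
  have hw := Real.sq_sqrt h1.le
  have hw0 := Real.sqrt_pos.2 h1
  set c := tangentCos r₁ r₂ d with hcdef
  set w := √(1 - c ^ 2) with hwdef
  have hA : (r₁ * c, σ * (r₁ * w)) ∈ closure (convexHull ℝ (coordBalls r₁ r₂ d)) := by
    refine mem_closure_hull_left hr₁ (le_of_eq ?_)
    rw [mul_pow, mul_pow, mul_pow, hσ, hw]; ring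
  have hB : (d + r₂ * c, σ * (r₂ * w)) ∈ closure (convexHull ℝ (coordBalls r₁ r₂ d)) := by
    refine mem_closure_hull_right hr₂ (le_of_eq ?_)
    rw [add_sub_cancel_left, mul_pow, mul_pow, mul_pow, hσ, hw]; ring
  have hL : 0 < d + r₂ * c - r₁ * c := by linarith
  have hcomb := (convex_convexHull ℝ (coordBalls r₁ r₂ d)).closure hA hB
    (a := (d + r₂ * c - x) / (d + r₂ * c - r₁ * c)) (b := (x - r₁ * c) / (d + r₂ * c - r₁ * c))
    (div_nonneg (by linarith [hx.2]) hL.le) (div_nonneg (by linarith [hx.1]) hL.le)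
    (by rw [← add_div, div_eq_one_iff_eq hL.ne']; ring)
  convert hcomb using 1
  ext
  · simp only [Prod.smul_mk, Prod.mk_add_mk, smul_eq_mul]
    rw [div_mul_eq_mul_div, div_mul_eq_mul_div, ← add_div, eq_div_iff hL.ne']; ring
  · simp only [Prod.smul_mk, Prod.mk_add_mk, smul_eq_mul]
    have key : (r₁ - c * x) * (d + r₂ * c - r₁ * c) =
        ((d + r₂ * c - x) * r₁ + (x - r₁ * c) * r₂) * w ^ 2 := by
      rw [hw]; linear_combination ((r₁ - c * x) * c - x * (1 - c ^ 2)) * hc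
    rw [div_mul_eq_mul_div, div_mul_eq_mul_div, ← add_div, eq_div_iff hL.ne', ← mul_div_assoc,
      div_mul_eq_mul_div, div_eq_iff hw0.ne']
    linear_combination σ * key

/-- The profile of the closed convex hull. -/
theorem isProfile_hull :
    IsProfile (-r₁) (d + r₂) (closure (convexHull ℝ (coordBalls r₁ r₂ d)))
      (bridge r₁ r₂ d (r₁ * tangentCos r₁ r₂ d) (d + r₂ * tangentCos r₁ r₂ d)
        fun x => (r₁ - tangentCos r₁ r₂ d * x) / √(1 - tangentCos r₁ r₂ d ^ 2))
      (bridgeSlope r₁ r₂ d (r₁ * tangentCos r₁ r₂ d) (d + r₂ * tangentCos r₁ r₂ d)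
        fun _ => -tangentCos r₁ r₂ d / √(1 - (-tangentCos r₁ r₂ d) ^ 2))
      {r₁ * tangentCos r₁ r₂ d, d + r₂ * tangentCos r₁ r₂ d} := by
  have hc := mul_tangentCos hr₁ hr₂ hd
  have h1 := one_sub_tangentCos_sq_pos hr₁ hr₂ hd
  have h2 := mul_tangentCos_lt hr₁ hr₂ hd
  have hc1 := abs_lt.1 (abs_tangentCos_lt hr₁ hr₂ hd)
  have hmem := fun (σ : ℝ) hσ x => tangent_mem (x := x) hr₁ hr₂ hd (σ := σ) hσ
  have hw := Real.sq_sqrt h1.le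
  have hw0 := Real.sqrt_pos.2 h1
  have hd0 : 0 < d := by linarith
  set c := tangentCos r₁ r₂ d with hcdef
  set w := √(1 - c ^ 2) with hwdef
  have hpos : ∀ x, x ∈ Icc (r₁ * c) (d + r₂ * c) → 0 < (r₁ - c * x) / w := fun x hx => by
    apply div_pos _ hw0
    rcases le_total 0 c with h0 | h0
    · nlinarith [mul_le_mul_of_nonneg_left hx.2 h0]
    · nlinarith [mul_le_mul_of_nonpos_left hx.1 h0]
  refine isProfile_bridge (by nlinarith) (by nlinarith) h2.le (by nlinarith) (by nlinarith)
    (by fun_prop) ?_ ?_ (fun x hx => ?_) intervalIntegrable_const (by simp) (by simp) (by simp)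
    (fun x hx => hpos x (Ioo_subset_Icc_self hx.1)) isClosed_closure.measurableSet
    (fun x hx y hy => ?_) (fun x hx y hy hxy => ?_) (fun x hx y hxy => hx ⟨?_, ?_⟩)
  · have e : r₁ ^ 2 - (r₁ * c - 0) ^ 2 = (r₁ * w) ^ 2 := by rw [mul_pow, hw]; ring
    rw [arc, e, Real.sqrt_sq (by positivity), eq_div_iff hw0.ne', mul_assoc, ← sq, hw]; ring
  · have e : r₂ ^ 2 - (d + r₂ * c - d) ^ 2 = (r₂ * w) ^ 2 := by rw [mul_pow, hw]; ring
    rw [arc, e, Real.sqrt_sq (by positivity), div_eq_iff hw0.ne', mul_assoc, ← sq, hw]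
    linear_combination (-1) * hc
  · rw [neg_sq, ← hwdef]
    simpa using (((hasDerivAt_id x).const_mul c).const_sub r₁).div_const w
  · rcases le_or_gt x (r₁ * c) with hx1 | hx1
    · rw [bridge, glue_left hx1] at hy
      have := (Real.lt_sqrt (abs_nonneg y)).1 hy
      rw [sq_abs, sub_zero] at this
      exact mem_closure_hull_left hr₁ (by linarith)
    · rcases le_or_gt x (d + r₂ * c) with hx2 | hx2
      · rw [bridge, glue_mid hx1 hx2] at hy
        have hA := hmem 1 (by norm_num) x ⟨hx1.le, hx2⟩
        have hB := hmem (-1) (by norm_num) x ⟨hx1.le, hx2⟩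
        have hv := hpos x ⟨hx1.le, hx2⟩
        set v := (r₁ - c * x) / w with hvdef
        have hy' := abs_lt.1 hy
        have hcomb := (convex_convexHull ℝ (coordBalls r₁ r₂ d)).closure hA hB
          (a := (v + y) / (2 * v)) (b := (v - y) / (2 * v))
          (div_nonneg (by linarith) (by positivity)) (div_nonneg (by linarith) (by positivity))
          (by field_simp; ring)
        convert hcomb using 1
        ext <;> simp only [Prod.smul_mk, Prod.mk_add_mk, smul_eq_mul] <;> field_simp <;> ring
      · rw [bridge, glue_right hx1 hx2] at hy
        have := (Real.lt_sqrt (abs_nonneg y)).1 hy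
        rw [sq_abs] at this
        exact mem_closure_hull_right hr₂ (by linarith)
  · rcases le_or_gt x (r₁ * c) with hx1 | hx1
    · rw [bridge, glue_left hx1] at hy
      have hxr : |x - 0| < r₁ := by rw [sub_zero]; exact abs_lt.2 ⟨hx.1, by nlinarith⟩
      have ha := arc_sq hxr.le
      have ha0 := arc_pos hxr
      -- The supporting half-plane of the left ball at its arc point over `x`. It contains the right
      -- ball because `x ≤ r₁ c` gives `d x / r₁ ≤ d c = r₁ - r₂`.
      have := le_of_mem_closure_hull hr₁ hr₂ (n₁ := x / r₁) (n₂ := arc r₁ 0 x / r₁) (m := r₁)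
        (by rw [div_pow, div_pow, ha]; field_simp; ring) le_rfl
        (by
          have : d * (x / r₁) ≤ d * c :=
            mul_le_mul_of_nonneg_left ((div_le_iff₀ hr₁).2 (by linarith)) hd0.le
          linarith) hxy
      have e : x / r₁ * x + arc r₁ 0 x / r₁ * |y| = (x ^ 2 + arc r₁ 0 x * |y|) / r₁ := by ring
      rw [e, div_le_iff₀ hr₁] at this
      nlinarith
    · rcases le_or_gt x (d + r₂ * c) with hx2 | hx2
      · rw [bridge, glue_mid hx1 hx2, div_lt_iff₀ hw0] at hy
        have := le_of_mem_closure_hull hr₁ hr₂ (n₁ := c) (n₂ := w) (m := r₁)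
          (by rw [hw]; ring) le_rfl (by linarith) hxy
        linarith
      · rw [bridge, glue_right hx1 hx2] at hy
        have hxr : |x - d| < r₂ := abs_lt.2 ⟨by nlinarith, by linarith [hx.2]⟩
        have ha := arc_sq hxr.le
        have ha0 := arc_pos hxr
        have := le_of_mem_closure_hull hr₁ hr₂ (n₁ := (x - d) / r₂) (n₂ := arc r₂ d x / r₂)
          (m := d * ((x - d) / r₂) + r₂) (by rw [div_pow, div_pow, ha]; field_simp; ring)
          (by
            have : d * c ≤ d * ((x - d) / r₂) :=
              mul_le_mul_of_nonneg_left ((le_div_iff₀ hr₂).2 (by linarith)) hd0.le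
            linarith) le_rfl hxy
        have e : (x - d) / r₂ * x + arc r₂ d x / r₂ * |y| - d * ((x - d) / r₂) =
          ((x - d) ^ 2 + arc r₂ d x * |y|) / r₂ := by ring
        have h3 : ((x - d) ^ 2 + arc r₂ d x * |y|) / r₂ ≤ r₂ := by rw [← e]; linarith
        rw [div_le_iff₀ hr₂] at h3
        nlinarith
  · have := le_of_mem_closure_hull hr₁ hr₂ (n₁ := -1) (n₂ := 0) (m := r₁) (by norm_num) le_rfl
      (by linarith) hxy
    linarith
  · have := le_of_mem_closure_hull hr₁ hr₂ (n₁ := 1) (n₂ := 0) (m := d + r₂) (by norm_num)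
      (by linarith) (by linarith) hxy
    linarith

/-- The convex hull has the least perimeter among the profiles that contain the two balls. -/
theorem perimeter_hull_le {E F : Set Plane} {o : Plane} {b : OrthonormalBasis (Fin 2) ℝ Plane}
    (hE : chart o b ⁻¹' E = closure (convexHull ℝ (coordBalls r₁ r₂ d))) {f f' : ℝ → ℝ}
    {s : Set ℝ} (hF : IsProfile (-r₁) (d + r₂) (chart o b ⁻¹' F) f f' s)
    (hF₁ : ∀ x y, x ^ 2 + y ^ 2 < r₁ ^ 2 → (x, y) ∈ chart o b ⁻¹' F)
    (hF₂ : ∀ x y, (x - d) ^ 2 + y ^ 2 < r₂ ^ 2 → (x, y) ∈ chart o b ⁻¹' F) :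
    perimeter E ≤ perimeter F := by
  have hc1 := abs_lt.1 (abs_tangentCos_lt hr₁ hr₂ hd)
  -- A segment has constant slope angle, so this is the calibration with curvature `0` and the area
  -- term drops out.
  have := bridge_perimeter_le (k := 0) (q := fun _ => -tangentCos r₁ r₂ d)
    (s := {r₁ * tangentCos r₁ r₂ d, d + r₂ * tangentCos r₁ r₂ d})
    (by nlinarith) (by nlinarith) (mul_tangentCos_lt hr₁ hr₂ hd).le (by nlinarith) (by nlinarith)
    (by simp) (by simp) le_rfl (fun x => hasDerivAt_const x _)
    (by field_simp) (by field_simp; ring)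
    (fun x _ => by rw [abs_neg]; exact abs_tangentCos_lt hr₁ hr₂ hd)
    (by rw [hE]; exact isProfile_hull hr₁ hr₂ hd) hF hF₁ hF₂
  simpa using this

end Hull

end

/-! ### The connectedness threshold -/

section

variable {r₁ r₂ d r t h x y : ℝ}

/-- The condition on the radius `r` that makes the closing of two balls connected. -/
def Bridged (r₁ r₂ d r : ℝ) : Prop :=
  ∀ x ∈ Icc r₁ (d - r₂), (d - x) * (x ^ 2 - r₁ ^ 2) + x * ((d - x) ^ 2 - r₂ ^ 2) ≤
    2 * r * ((d - x) * r₁ + x * r₂)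

/-- Stewart's theorem: the weights `d - x` and `x` on the two tangency equations eliminate `t` and
`h`, and `r²` cancels, which leaves a condition linear in `r`. -/
theorem IsTangentCenter.sq_le_iff (H : IsTangentCenter r₁ r₂ d r t h) :
    r ^ 2 ≤ (x - t) ^ 2 + h ^ 2 ↔
      (d - x) * (x ^ 2 - r₁ ^ 2) + x * ((d - x) ^ 2 - r₂ ^ 2) ≤
        2 * r * ((d - x) * r₁ + x * r₂) := by
  have hd : 0 < d := by linarith [H.left_pos, H.right_pos, H.dist_le]
  have key : d * ((x - t) ^ 2 + h ^ 2 - r ^ 2) = 2 * r * ((d - x) * r₁ + x * r₂) -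
      ((d - x) * (x ^ 2 - r₁ ^ 2) + x * ((d - x) ^ 2 - r₂ ^ 2)) := by
    linear_combination (d - x) * H.left_eq + x * H.right_eq
  rw [← sub_nonneg, ← mul_nonneg_iff_of_pos_left hd, key, sub_nonneg]

/-- A triangle with sides `d`, `r + r₁`, `r + r₂` exists by the strict triangle inequalities; the
factorization of the squared height is Heron's formula. -/
theorem exists_isTangentCenter (hr₁ : 0 < r₁) (hr₂ : 0 < r₂) (hd : r₁ + r₂ ≤ d) (hr : 0 < r)
    (h : d < r₁ + r₂ + 2 * r) : ∃ t h, IsTangentCenter r₁ r₂ d r t h := by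
  have hd0 : 0 < d := by linarith
  set t := (d ^ 2 + (r + r₁) ^ 2 - (r + r₂) ^ 2) / (2 * d) with ht
  have ht2 : 2 * d * t = d ^ 2 + (r + r₁) ^ 2 - (r + r₂) ^ 2 := by rw [ht]; field_simp
  have hpos : 0 < (r + r₁) ^ 2 - t ^ 2 := by
    have e : (2 * d) ^ 2 * ((r + r₁) ^ 2 - t ^ 2) =
        (r + r₂ - (d - r - r₁)) * (r + r₂ + (d - r - r₁)) *
          ((d + r + r₁ - (r + r₂)) * (d + r + r₁ + (r + r₂))) := by
      have : (2 * d) ^ 2 * ((r + r₁) ^ 2 - t ^ 2) =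
        (2 * d * (r + r₁) - 2 * d * t) * (2 * d * (r + r₁) + 2 * d * t) := by ring
      rw [this, ht2]; ring
    have : 0 < (2 * d) ^ 2 * ((r + r₁) ^ 2 - t ^ 2) := by
      rw [e]
      have i1 : 0 < r + r₂ - (d - r - r₁) := by linarith
      have i2 : 0 < r + r₂ + (d - r - r₁) := by linarith
      have i3 : 0 < d + r + r₁ - (r + r₂) := by linarith
      have i4 : 0 < d + r + r₁ + (r + r₂) := by linarith
      positivity
    exact (mul_pos_iff_of_pos_left (by positivity)).1 this
  have hs := Real.sq_sqrt hpos.le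
  refine ⟨t, √((r + r₁) ^ 2 - t ^ 2), hr₁, hr₂, hr, hd, Real.sqrt_pos.2 hpos, ?_, ?_⟩
  · rw [hs]; ring
  · rw [hs]; linear_combination (-1) * ht2

theorem Bridged.lt (hb : Bridged r₁ r₂ d r) (hr₁ : 0 < r₁) (hr₂ : 0 < r₂) (hd : r₁ + r₂ ≤ d)
    (hr : 0 < r) : d < r₁ + r₂ + 2 * r := by
  rcases eq_or_lt_of_le hd with h0 | h0
  · linarith
  · by_contra! hlt
    -- Half the gap. At its midpoint the two sides of the condition differ, for `r = m`, by `m² d`,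
    -- so it fails for every `r ≤ m`.
    set m := (d - r₁ - r₂) / 2 with hm
    have hm0 : 0 < m := by rw [hm]; linarith
    have h1 := hb (r₁ + m) ⟨by linarith, by rw [hm]; linarith⟩
    have e : d = r₁ + r₂ + 2 * m := by rw [hm]; ring
    have hrm : r ≤ m := by linarith
    rw [e] at h1
    have h2 : 2 * r * ((r₁ + r₂ + 2 * m - (r₁ + m)) * r₁ + (r₁ + m) * r₂) ≤
      2 * m * ((r₁ + r₂ + 2 * m - (r₁ + m)) * r₁ + (r₁ + m) * r₂) := by
      have : 0 ≤ (r₁ + r₂ + 2 * m - (r₁ + m)) * r₁ + (r₁ + m) * r₂ := by nlinarith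
      nlinarith
    have h3 : 0 < m ^ 2 * (r₁ + r₂ + 2 * m) := by positivity
    nlinarith

theorem Bridged.exists_isTangentCenter (hb : Bridged r₁ r₂ d r) (hr₁ : 0 < r₁) (hr₂ : 0 < r₂)
    (hd : r₁ + r₂ ≤ d) (hr : 0 < r) : ∃ t h, IsTangentCenter r₁ r₂ d r t h ∧
      ∀ x ∈ Icc r₁ (d - r₂), r ^ 2 ≤ (x - t) ^ 2 + h ^ 2 := by
  obtain ⟨t, h, H⟩ := TwoBalls.exists_isTangentCenter hr₁ hr₂ hd hr (hb.lt hr₁ hr₂ hd hr)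
  exact ⟨t, h, H, fun x hx => H.sq_le_iff.2 (hb x hx)⟩

theorem bridged_iff (hr₁ : 0 < r₁) (hr₂ : 0 < r₂) (hd : r₁ + r₂ ≤ d) (hr : 0 < r) :
    Bridged r₁ r₂ d r ↔ ∀ x ∈ Icc r₁ (d - r₂), (x, (0 : ℝ)) ∈ coordClosing r₁ r₂ d r := by
  constructor
  · intro hb x hx
    obtain ⟨t, h, H, hconn⟩ := hb.exists_isTangentCenter hr₁ hr₂ hd hr
    refine H.mem_coordClosing le_rfl ?_ ?_ ?_
    · have := mul_nonneg (hr₁.le.trans hx.1) H.height_pos.le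
      linarith
    · have := mul_nonneg (by linarith [hx.2] : 0 ≤ d - x) H.height_pos.le
      linarith
    · have := hconn x hx
      linarith
  · intro hK
    -- Otherwise a ball of radius `r` centered on the axis fits into the gap, and its center is not
    -- in the closing.
    have hlt : d < r₁ + r₂ + 2 * r := by
      by_contra! hlt
      have hc : IsOuterCenter r₁ r₂ d r (r₁ + r) 0 := ⟨by nlinarith, by nlinarith⟩
      have := hK (r₁ + r) ⟨by linarith, by linarith⟩ _ _ hc
      simp only [sub_self] at this
      nlinarith
    obtain ⟨t, h, H⟩ := TwoBalls.exists_isTangentCenter hr₁ hr₂ hd hr hlt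
    intro x hx
    have := hK x hx _ _ H.isOuterCenter
    simp only at this
    exact H.sq_le_iff.1 (by linarith)

/-- The projection of a connected set to the axis is an interval, and vertical sections descend to
the axis. Conversely, a vertical segment joins each point to the axis. -/
theorem isConnected_coordClosing_iff (hr₁ : 0 < r₁) (hr₂ : 0 < r₂) (hd : r₁ + r₂ ≤ d)
    (hr : 0 < r) : IsConnected (coordClosing r₁ r₂ d r) ↔ Bridged r₁ r₂ d r := by
  have hleft : ∀ x, |x| ≤ r₁ → (x, (0 : ℝ)) ∈ coordClosing r₁ r₂ d r := fun x hx =>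
    mem_coordClosing_left hr.le hr₁.le (by
      have := abs_le.1 hx; nlinarith)
  have hright : ∀ x, |x - d| ≤ r₂ → (x, (0 : ℝ)) ∈ coordClosing r₁ r₂ d r := fun x hx =>
    mem_coordClosing_right hr.le hr₂.le (by
      have := abs_le.1 hx; nlinarith)
  have hcol : ∀ x y, (x, y) ∈ coordClosing r₁ r₂ d r → (x, (0 : ℝ)) ∈ coordClosing r₁ r₂ d r :=
    fun x y h => mem_coordClosing_of_abs_le h (by simp)
  rw [bridged_iff hr₁ hr₂ hd hr]
  constructor
  · intro hK x hx
    have h1 := (hK.image Prod.fst continuous_fst.continuousOn).isPreconnected.ordConnected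
    have h2 : x ∈ Prod.fst '' coordClosing r₁ r₂ d r :=
      h1.out ⟨_, hleft r₁ (abs_of_pos hr₁).le, rfl⟩
        ⟨_, hright (d - r₂) (by simp [abs_of_pos hr₂]), rfl⟩ hx
    obtain ⟨⟨x', y⟩, hp, rfl⟩ := h2
    exact hcol _ _ hp
  · intro hax
    have haxis : ∀ x ∈ Icc (-r₁) (d + r₂), (x, (0 : ℝ)) ∈ coordClosing r₁ r₂ d r := by
      intro x hx
      rcases le_or_gt x r₁ with h1 | h1
      · exact hleft x (abs_le.2 ⟨hx.1, h1⟩)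
      · rcases le_or_gt x (d - r₂) with h2 | h2
        · exact hax x ⟨h1.le, h2⟩
        · exact hright x (abs_le.2 ⟨by linarith, by linarith [hx.2]⟩)
    refine ⟨⟨_, hleft 0 (by simp [hr₁.le])⟩, isPreconnected_of_forall ((0 : ℝ), (0 : ℝ)) ?_⟩
    rintro ⟨x, y⟩ hp
    have hx := mem_Icc_of_mem_coordClosing hr hr₁ hr₂ hd hp
    refine ⟨(fun u : ℝ => (u, (0 : ℝ))) '' Icc (-r₁) (d + r₂) ∪
      (fun v : ℝ => (x, v)) '' Icc (-|y|) |y|, ?_, Or.inl ⟨0, ⟨by linarith, by linarith⟩, rfl⟩,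
      Or.inr ⟨y, ⟨neg_abs_le y, le_abs_self y⟩, rfl⟩, ?_⟩
    · rintro _ (⟨u, hu, rfl⟩ | ⟨v, hv, rfl⟩)
      · exact haxis u hu
      · exact mem_coordClosing_of_abs_le hp (abs_le.2 hv)
    · refine IsPreconnected.union (x, (0 : ℝ)) ⟨x, hx, rfl⟩
        ⟨0, ⟨by simp, abs_nonneg y⟩, rfl⟩ ?_ ?_
      · exact isPreconnected_Icc.image _ (by fun_prop)
      · exact isPreconnected_Icc.image _ (by fun_prop)

theorem bridgeFactor_pos (hr₁ : 0 < r₁) (hr₂ : 0 < r₂) (hx : x ∈ Icc r₁ (d - r₂)) :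
    0 < (d - x) * r₁ + x * r₂ := by
  have h1 : 0 < d - x := by linarith [hx.2]
  have h2 : 0 < x := by linarith [hx.1]
  positivity

theorem Bridged.mono (hb : Bridged r₁ r₂ d r) (hr₁ : 0 < r₁) (hr₂ : 0 < r₂) {r' : ℝ}
    (h : r ≤ r') : Bridged r₁ r₂ d r' := fun x hx =>
  (hb x hx).trans (by
    have := bridgeFactor_pos hr₁ hr₂ hx
    gcongr)

theorem bridged_of_forall_gt (h : ∀ r' > r, Bridged r₁ r₂ d r') : Bridged r₁ r₂ d r := by
  intro x hx
  have hc : Tendsto (fun r' : ℝ => 2 * r' * ((d - x) * r₁ + x * r₂)) (𝓝[>] r)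
      (𝓝 (2 * r * ((d - x) * r₁ + x * r₂))) := by
    have : Continuous fun r' : ℝ => 2 * r' * ((d - x) * r₁ + x * r₂) := by fun_prop
    exact (this.tendsto r).mono_left nhdsWithin_le_nhds
  refine ge_of_tendsto hc ?_
  filter_upwards [self_mem_nhdsWithin] with r' hr' using h r' hr' x hx

theorem exists_bridged (hr₁ : 0 < r₁) (hr₂ : 0 < r₂) (hd : r₁ + r₂ ≤ d) :
    ∃ r, 0 < r ∧ Bridged r₁ r₂ d r := by
  have hd0 : 0 < d := by linarith
  -- A crude radius: each term on the left is at most `d³`, while the factor `(d - x) r₁ + x r₂` is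
  -- at least `r₁ r₂` on the gap.
  refine ⟨d ^ 3 / (r₁ * r₂), by positivity, fun x hx => ?_⟩
  have hx0 : 0 < x := by linarith [hx.1]
  have hx1 : 0 < d - x := by linarith [hx.2]
  have h1 : (d - x) * (x ^ 2 - r₁ ^ 2) ≤ d ^ 3 := by
    have : (d - x) * (x ^ 2 - r₁ ^ 2) ≤ d * d ^ 2 := by
      apply mul_le_mul (by linarith) (by nlinarith) (by nlinarith [hx.1]) hd0.le
    linarith
  have h2 : x * ((d - x) ^ 2 - r₂ ^ 2) ≤ d ^ 3 := by
    have : x * ((d - x) ^ 2 - r₂ ^ 2) ≤ d * d ^ 2 := by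
      apply mul_le_mul (by linarith) (by nlinarith) (by nlinarith [hx.2]) hd0.le
    linarith
  have h3 : 1 ≤ ((d - x) * r₁ + x * r₂) / (r₁ * r₂) := by
    rw [one_le_div (by positivity)]
    nlinarith [hx.2, mul_pos hx0 hr₂]
  have h4 : 2 * (d ^ 3 / (r₁ * r₂)) * ((d - x) * r₁ + x * r₂) =
      2 * d ^ 3 * (((d - x) * r₁ + x * r₂) / (r₁ * r₂)) := by ring
  rw [h4]
  have h5 : 2 * d ^ 3 * 1 ≤ 2 * d ^ 3 * (((d - x) * r₁ + x * r₂) / (r₁ * r₂)) := by gcongr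
  linarith

/-- Just to the right of the left contact point there is room between the ball and the bridge. This
makes the added area positive, hence the second monotonicity strict. -/
theorem Bridged.exists_isOpen (hb : Bridged r₁ r₂ d r) (hr₁ : 0 < r₁) (hr₂ : 0 < r₂)
    (hd : r₁ + r₂ ≤ d) (hr : 0 < r) :
    ∃ U : Set (ℝ × ℝ), IsOpen U ∧ U.Nonempty ∧ U ⊆ coordClosing r₁ r₂ d r \ coordBalls r₁ r₂ d := by
  obtain ⟨t, h, H, hconn⟩ := hb.exists_isTangentCenter hr₁ hr₂ hd hr
  set x₁ := IsTangentCenter.left r₁ r t with hx₁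
  set x₂ := IsTangentCenter.right r₂ d r t with hx₂
  have hlt : x₁ < min x₂ r₁ := lt_min H.left_lt_right (lt_of_abs_lt H.abs_left_lt)
  refine ⟨{p | x₁ < p.1 ∧ p.1 < min x₂ r₁ ∧ arc r₁ 0 p.1 < p.2 ∧ p.2 < h - arc r t p.1},
    ?_, ?_, ?_⟩
  · have c1 : Continuous fun p : ℝ × ℝ => arc r₁ 0 p.1 := continuous_arc.comp continuous_fst
    have c2 : Continuous fun p : ℝ × ℝ => h - arc r t p.1 :=
      continuous_const.sub (continuous_arc.comp continuous_fst)
    exact (isOpen_lt continuous_const continuous_fst).inter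
      ((isOpen_lt continuous_fst continuous_const).inter
        ((isOpen_lt c1 continuous_snd).inter (isOpen_lt continuous_snd c2)))
  · obtain ⟨x, hx, hx'⟩ := exists_between hlt
    have hxm : x ∈ Icc x₁ x₂ := ⟨hx.le, (hx'.trans_le (min_le_left _ _)).le⟩
    have hv := (H.mid_mem hconn hxm).1
    have hw := arc_sq (H.abs_sub_lt_of_mem hxm).le
    have hxr : |x - 0| ≤ r₁ := by
      rw [sub_zero, abs_le]
      exact ⟨by linarith [neg_lt_of_abs_lt H.abs_left_lt],
        (hx'.trans_le (min_le_right _ _)).le⟩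
    have hgap : arc r₁ 0 x < h - arc r t x := by
      by_contra! hle
      have h1 : (h - arc r t x) ^ 2 ≤ r₁ ^ 2 - (x - 0) ^ 2 := by
        rw [← arc_sq hxr]; exact pow_le_pow_left₀ hv hle 2
      set w := arc r t x with hwdef
      have hA := H.add_left_pos
      -- Two externally tangent circles meet only at the contact point: if a point of the bridge
      -- were in the closed left ball, a sum of two squares would be nonpositive, forcing `x = x₁`.
      have h2 : ((r + r₁) * x - r₁ * t) ^ 2 + ((r + r₁) * (h - w) - r₁ * h) ^ 2 =
          (r + r₁) * r * (x ^ 2 + (h - w) ^ 2 - r₁ ^ 2) := by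
        linear_combination (-(r₁ * r)) * H.left_eq + (r + r₁) * r₁ * hw
      have h3 : (r + r₁) * r * (x ^ 2 + (h - w) ^ 2 - r₁ ^ 2) ≤ 0 :=
        mul_nonpos_of_nonneg_of_nonpos (by positivity) (by nlinarith)
      have h4 : (r + r₁) * x - r₁ * t = 0 := by
        nlinarith [sq_nonneg ((r + r₁) * x - r₁ * t), sq_nonneg ((r + r₁) * (h - w) - r₁ * h)]
      have h5 : x = x₁ := by
        rw [hx₁, IsTangentCenter.left, eq_div_iff hA.ne']; linarith
      linarith
    obtain ⟨y, hy, hy'⟩ := exists_between hgap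
    exact ⟨(x, y), hx, hx', hy, hy'⟩
  · rintro ⟨x, y⟩ ⟨h1, h2, h3, h4⟩
    simp only at h1 h2 h3 h4
    have hxr : |x - 0| ≤ r₁ := by
      rw [sub_zero, abs_le]
      exact ⟨by linarith [neg_lt_of_abs_lt H.abs_left_lt],
        (h2.trans_le (min_le_right _ _)).le⟩
    have hy0 : 0 ≤ arc r₁ 0 x := Real.sqrt_nonneg _
    refine ⟨?_, ?_⟩
    · obtain ⟨h5, h6⟩ := H.mid_mem hconn ⟨h1.le, (h2.trans_le (min_le_left _ _)).le⟩
      exact mem_coordClosing_of_abs_le h6 (abs_le_abs h4.le (by linarith))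
    · have h5 := arc_sq hxr
      have h7 := h2.trans_le (min_le_right _ _)
      rintro (h6 | h6) <;> simp only at h6
      · nlinarith
      · nlinarith

end

/-! ### Transfer to the plane and minimality among the closings -/

section

/-- In the coordinates given by `o` and `b`, the set `S` is the union of the disjoint balls with
radii `r₁`, `r₂` and centers `(0, 0)`, `(d, 0)`. -/
structure IsTwoBalls (S : Set Plane) (r₁ r₂ d : ℝ) (o : Plane)
    (b : OrthonormalBasis (Fin 2) ℝ Plane) : Prop where
  left_pos : 0 < r₁
  right_pos : 0 < r₂
  dist_le : r₁ + r₂ ≤ d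
  eq : S = Metric.ball (chart o b (0, 0)) r₁ ∪ Metric.ball (chart o b (d, 0)) r₂

theorem exists_isTwoBalls {c₁ c₂ : Plane} {r₁ r₂ : ℝ} (hr₁ : 0 < r₁) (hr₂ : 0 < r₂)
    (hdisj : Disjoint (Metric.ball c₁ r₁) (Metric.ball c₂ r₂)) :
    ∃ d b, IsTwoBalls (Metric.ball c₁ r₁ ∪ Metric.ball c₂ r₂) r₁ r₂ d c₁ b := by
  have hd := (disjoint_ball_ball_iff hr₁ hr₂).1 hdisj
  have hne : c₁ ≠ c₂ := dist_pos.1 (by linarith)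
  obtain ⟨b, hb⟩ := exists_basis_of_ne hne
  refine ⟨dist c₁ c₂, b, hr₁, hr₂, hd, ?_⟩
  rw [hb]
  simp [chart]

theorem mem_ball_chart_iff {o : Plane} {b : OrthonormalBasis (Fin 2) ℝ Plane} {ρ : ℝ}
    (hρ : 0 < ρ) (p q : ℝ × ℝ) : chart o b p ∈ Metric.ball (chart o b q) ρ ↔
      (p.1 - q.1) ^ 2 + (p.2 - q.2) ^ 2 < ρ ^ 2 := by
  rw [Metric.mem_ball, ← dist_chart_sq o b, sq_lt_sq₀ dist_nonneg hρ.le]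

theorem indicatorVariation_le_perimeter (E : Set Plane) : indicatorVariation E ≤ perimeter E := by
  unfold perimeter
  split_ifs <;> simp

theorem subset_closing (S : Set Plane) (ρ : ℝ≥0∞) : S ⊆ closing ρ S := by
  rcases eq_or_ne ρ 0 with rfl | h0
  · rw [closing, if_pos rfl]
  rcases eq_or_ne ρ ⊤ with rfl | ht
  · rw [closing, if_neg h0, if_pos rfl]; exact subset_convexHull ℝ S
  · rw [closing, if_neg h0, if_neg ht, subset_compl_comm]
    exact iUnion₂_subset fun _ h => h

theorem closing_top (S : Set Plane) : closing ⊤ S = convexHull ℝ S := by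
  rw [closing, if_neg ENNReal.top_ne_zero, if_pos rfl]

theorem closing_zero (S : Set Plane) : closing 0 S = S := by
  rw [closing, if_pos rfl]

namespace IsTwoBalls

variable {S : Set Plane} {r₁ r₂ d : ℝ} {o : Plane} {b : OrthonormalBasis (Fin 2) ℝ Plane}
  (T : IsTwoBalls S r₁ r₂ d o b)

include T

theorem isOpen : IsOpen S := by
  rw [T.eq]; exact Metric.isOpen_ball.union Metric.isOpen_ball

theorem nonempty : S.Nonempty := by
  rw [T.eq]; exact ⟨_, Or.inl (Metric.mem_ball_self T.left_pos)⟩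

theorem preimage : chart o b ⁻¹' S = coordBalls r₁ r₂ d := by
  ext p
  rw [T.eq, mem_preimage, mem_union, mem_ball_chart_iff T.left_pos, mem_ball_chart_iff T.right_pos]
  simp [coordBalls]

theorem ball_subset_compl_iff {r : ℝ} (hr : 0 < r) (X Y : ℝ) :
    Metric.ball (chart o b (X, Y)) r ⊆ Sᶜ ↔ IsOuterCenter r₁ r₂ d r X Y := by
  have h1 := T.left_pos
  have h2 := T.right_pos
  rw [subset_compl_iff_disjoint_right, T.eq, disjoint_union_right,
    disjoint_ball_ball_iff hr h1, disjoint_ball_ball_iff hr h2,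
    ← sq_le_sq₀ (by positivity) dist_nonneg, ← sq_le_sq₀ (by positivity) dist_nonneg,
    dist_chart_sq, dist_chart_sq]
  simp [IsOuterCenter]

theorem preimage_closing {r : ℝ} (hr : 0 < r) :
    chart o b ⁻¹' closing (ENNReal.ofReal r) S = coordClosing r₁ r₂ d r := by
  have h0 : ENNReal.ofReal r ≠ 0 := (ENNReal.ofReal_pos.2 hr).ne'
  rw [closing, if_neg h0, if_neg ENNReal.ofReal_ne_top, ENNReal.toReal_ofReal hr.le]
  ext ⟨x, y⟩
  simp only [mem_preimage, mem_compl_iff, opening, mem_iUnion, mem_ofPred_eq, coordClosing,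
    not_exists]
  constructor
  · intro h X Y hc
    have := h (chart o b (X, Y)) ((T.ball_subset_compl_iff hr X Y).2 hc)
    rw [mem_ball_chart_iff hr] at this
    simp only at this ⊢
    linarith [not_lt.1 this, sub_sq_comm X x, sub_sq_comm Y y]
  · intro h z hz
    obtain ⟨⟨X, Y⟩, rfl⟩ := chart_surjective o b z
    have := h X Y ((T.ball_subset_compl_iff hr X Y).1 hz)
    rw [mem_ball_chart_iff hr]
    simp only at this ⊢
    linarith [sub_sq_comm X x, sub_sq_comm Y y]

theorem isConnected_closing_ofReal_iff {r : ℝ} (hr : 0 < r) :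
    IsConnected (closing (ENNReal.ofReal r) S) ↔ Bridged r₁ r₂ d r := by
  rw [← isConnected_coordClosing_iff T.left_pos T.right_pos T.dist_le hr, ← T.preimage_closing hr]
  exact (chartHomeo o b).isConnected_preimage.symm

theorem isConnected_closing_top : IsConnected (closing ⊤ S) := by
  rw [closing, if_neg ENNReal.top_ne_zero, if_pos rfl]
  exact ⟨T.nonempty.convexHull, (convex_convexHull ℝ S).isPreconnected⟩

/-- The infimum is attained when it is positive: every larger radius is bridged by monotonicity, and
the condition passes to the limit. -/
theorem bridged_of_connectingRadius_le {r : ℝ} (hr : 0 < r)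
    (h : connectingRadius S ≤ ENNReal.ofReal r) : Bridged r₁ r₂ d r := by
  refine bridged_of_forall_gt fun r' hr' => ?_
  have hlt : connectingRadius S < ENNReal.ofReal r' :=
    h.trans_lt ((ENNReal.ofReal_lt_ofReal_iff (hr.trans hr')).2 hr')
  obtain ⟨ρ, ⟨hρ0, hρ⟩, hlt⟩ := sInf_lt_iff.1 hlt
  have hρt : ρ ≠ ⊤ := hlt.ne_top
  have hρr : 0 < ρ.toReal := ENNReal.toReal_pos hρ0.ne' hρt
  rw [← ENNReal.ofReal_toReal hρt, T.isConnected_closing_ofReal_iff hρr] at hρ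
  refine hρ.mono T.left_pos T.right_pos ?_
  exact (ENNReal.toReal_lt_of_lt_ofReal hlt).le

theorem connectingRadius_lt_top : connectingRadius S < ⊤ := by
  obtain ⟨r, hr, hb⟩ := exists_bridged T.left_pos T.right_pos T.dist_le
  exact (sInf_le (s := {r | 0 < r ∧ IsConnected (closing r S)}) (a := ENNReal.ofReal r)
    ⟨ENNReal.ofReal_pos.2 hr, (T.isConnected_closing_ofReal_iff hr).2 hb⟩).trans_lt ENNReal.ofReal_lt_top

theorem isConnected_closing_iff {ρ : ℝ≥0∞} (hρ : 0 < ρ) :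
    IsConnected (closing ρ S) ↔ connectingRadius S ≤ ρ := by
  refine ⟨fun h => sInf_le ⟨hρ, h⟩, fun h => ?_⟩
  rcases eq_or_ne ρ ⊤ with rfl | ht
  · exact T.isConnected_closing_top
  · have hr := ENNReal.toReal_pos hρ.ne' ht
    rw [← ENNReal.ofReal_toReal ht] at h ⊢
    exact (T.isConnected_closing_ofReal_iff hr).2 (T.bridged_of_connectingRadius_le hr h)

theorem dist_eq_of_connectingRadius_eq_zero (h : connectingRadius S = 0) : d = r₁ + r₂ := by
  refine le_antisymm (le_of_forall_pos_lt_add fun ε hε => ?_) T.dist_le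
  have := (T.bridged_of_connectingRadius_le (half_pos hε) (by rw [h]; exact zero_le)).lt
    T.left_pos T.right_pos T.dist_le (half_pos hε)
  linarith

theorem preimage_closure_hull : chart o b ⁻¹' closure (convexHull ℝ S) =
    closure (convexHull ℝ (coordBalls r₁ r₂ d)) := by
  rw [preimage_closure_convexHull, T.preimage]

/-- Puts the three kinds of closing into one class of competitors, which is what allows any two
radii to be compared. -/
theorem exists_isProfile {ρ : ℝ≥0∞} (hρ : connectingRadius S ≤ ρ) :
    ∃ E g g' s, E =ᵐ[volume] closing ρ S ∧ S ⊆ E ∧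
      IsProfile (-r₁) (d + r₂) (chart o b ⁻¹' E) g g' s := by
  rcases eq_or_ne ρ 0 with rfl | h0
  · have hd := T.dist_eq_of_connectingRadius_eq_zero (nonpos_iff_eq_zero.1 hρ)
    have hp := isProfile_coordBalls T.left_pos T.right_pos hd
    rw [← T.preimage] at hp
    exact ⟨S, _, _, _, by rw [closing_zero S]; exact ae_eq_refl S, le_rfl, hp⟩
  rcases eq_or_ne ρ ⊤ with rfl | ht
  · have hp := isProfile_hull T.left_pos T.right_pos T.dist_le
    rw [← T.preimage_closure_hull] at hp
    exact ⟨closure (convexHull ℝ S), _, _, _,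
      by rw [closing_top S]; exact closure_convexHull_ae_eq S,
      (subset_convexHull ℝ S).trans subset_closure, hp⟩
  · have hr := ENNReal.toReal_pos h0 ht
    have hb := T.bridged_of_connectingRadius_le hr (by rwa [ENNReal.ofReal_toReal ht])
    obtain ⟨t, h, H, hconn⟩ := hb.exists_isTangentCenter T.left_pos T.right_pos T.dist_le hr
    have e := T.preimage_closing hr
    rw [ENNReal.ofReal_toReal ht] at e
    have hp := H.isProfile hconn
    rw [← e] at hp
    exact ⟨closing ρ S, _, _, _, ae_eq_refl _, subset_closing S ρ, hp⟩

theorem perimeter_closing_lt_top {ρ : ℝ≥0∞} (hρ : connectingRadius S ≤ ρ) :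
    perimeter (closing ρ S) < ⊤ := by
  obtain ⟨E, g, g', s, hE, -, hp⟩ := T.exists_isProfile hρ
  rw [← perimeter_congr_ae hE]
  exact hp.perimeter_le.trans_lt ENNReal.ofReal_lt_top

theorem volume_closing_lt_top {ρ : ℝ≥0∞} (hρ : connectingRadius S ≤ ρ) :
    volume (closing ρ S) < ⊤ := by
  obtain ⟨E, g, g', s, hE, -, hp⟩ := T.exists_isProfile hρ
  rw [← measure_congr hE, hp.volume_plane_eq]
  exact ENNReal.ofReal_lt_top

/-- Among the connected closings, the one with radius `ρ` minimizes perimeter plus area over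
`ρ`. -/
theorem perimeter_add_volume_div_le {ρ ρ' : ℝ≥0∞} (h0 : 0 < ρ) (hρ : connectingRadius S ≤ ρ)
    (hρ' : connectingRadius S ≤ ρ') :
    perimeter (closing ρ S) + volume (closing ρ S) / ρ ≤
      perimeter (closing ρ' S) + volume (closing ρ' S) / ρ := by
  obtain ⟨F, f, f', s, hF, hSF, hp⟩ := T.exists_isProfile hρ'
  have hsub : coordBalls r₁ r₂ d ⊆ chart o b ⁻¹' F := by
    rw [← T.preimage]; exact preimage_mono hSF
  have hF₁ : ∀ x y, x ^ 2 + y ^ 2 < r₁ ^ 2 → (x, y) ∈ chart o b ⁻¹' F :=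
    fun x y h => hsub (Or.inl h)
  have hF₂ : ∀ x y, (x - d) ^ 2 + y ^ 2 < r₂ ^ 2 → (x, y) ∈ chart o b ⁻¹' F :=
    fun x y h => hsub (Or.inr h)
  rw [← perimeter_congr_ae hF, ← measure_congr hF]
  rcases eq_or_ne ρ ⊤ with rfl | ht
  · rw [closing_top S, ← perimeter_congr_ae (closure_convexHull_ae_eq S)]
    simpa using perimeter_hull_le T.left_pos T.right_pos T.dist_le T.preimage_closure_hull hp
      hF₁ hF₂
  · have hr := ENNReal.toReal_pos h0.ne' ht
    have hb := T.bridged_of_connectingRadius_le hr (by rwa [ENNReal.ofReal_toReal ht])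
    obtain ⟨t, h, H, hconn⟩ := hb.exists_isTangentCenter T.left_pos T.right_pos T.dist_le hr
    have := H.perimeter_le hconn (T.preimage_closing hr) hp hF₁ hF₂
    rw [ENNReal.ofReal_toReal ht, one_div, ENNReal.ofReal_inv_of_pos hr,
      ENNReal.ofReal_toReal ht] at this
    rwa [div_eq_mul_inv, div_eq_mul_inv, mul_comm (volume _), mul_comm (volume F)]

theorem volume_closing_diff_add {ρ : ℝ≥0∞} :
    volume (closing ρ S \ S) + volume S = volume (closing ρ S) := by
  rw [← measure_inter_add_sdiff (closing ρ S) T.isOpen.measurableSet,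
    inter_eq_self_of_subset_right (subset_closing S ρ), add_comm]

theorem volume_lt_top : volume S < ⊤ :=
  (measure_mono (subset_closing S ⊤)).trans_lt (T.volume_closing_lt_top le_top)

theorem volume_pos : 0 < volume S := T.isOpen.measure_pos volume T.nonempty

theorem volume_closing_diff_lt_top {ρ : ℝ≥0∞} (hρ : connectingRadius S ≤ ρ) :
    volume (closing ρ S \ S) < ⊤ :=
  (measure_mono sdiff_subset).trans_lt (T.volume_closing_lt_top hρ)

theorem perimeter_add_volume_diff_div_le {ρ ρ' : ℝ≥0∞} (h0 : 0 < ρ)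
    (hρ : connectingRadius S ≤ ρ) (hρ' : connectingRadius S ≤ ρ') :
    perimeter (closing ρ S) + volume (closing ρ S \ S) / ρ ≤
      perimeter (closing ρ' S) + volume (closing ρ' S \ S) / ρ := by
  have h := T.perimeter_add_volume_div_le h0 hρ hρ'
  rw [← T.volume_closing_diff_add, ← T.volume_closing_diff_add, ENNReal.add_div, ENNReal.add_div,
    ← add_assoc, ← add_assoc] at h
  exact (ENNReal.add_le_add_iff_right (ENNReal.div_lt_top T.volume_lt_top.ne h0.ne').ne).1 h

theorem volume_closing_diff_pos {ρ : ℝ≥0∞} (h0 : 0 < ρ) (ht : ρ ≠ ⊤)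
    (hρ : connectingRadius S ≤ ρ) : 0 < volume (closing ρ S \ S) := by
  have hr := ENNReal.toReal_pos h0.ne' ht
  have hb := T.bridged_of_connectingRadius_le hr (by rwa [ENNReal.ofReal_toReal ht])
  obtain ⟨U, hU, hne, hsub⟩ := hb.exists_isOpen T.left_pos T.right_pos T.dist_le hr
  rw [← T.preimage_closing hr, ← T.preimage, ENNReal.ofReal_toReal ht, ← preimage_sdiff] at hsub
  rw [← (measurePreserving_chart o b).measure_preimage_emb (measurableEmbedding_chart o b)]
  exact (hU.measure_pos volume hne).trans_le (measure_mono hsub)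

end IsTwoBalls

end

/-! ### Continuity and monotonicity in the radius -/

section

section Envelope

/-- The value at the radius `ρ` of the sum of `p` and of `a` over the radius. -/
def envelope (p a : ℝ≥0∞ → ℝ) (ρ : ℝ≥0∞) : ℝ := p ρ + (ρ⁻¹).toReal * a ρ

variable {C : ℝ≥0∞} {p a : ℝ≥0∞ → ℝ}

theorem toReal_inv_lt {ρ ρ' : ℝ≥0∞} (h0 : 0 < ρ) (h : ρ < ρ') :
    (ρ'⁻¹).toReal < (ρ⁻¹).toReal :=
  (ENNReal.toReal_lt_toReal (ENNReal.inv_ne_top.2 (h0.trans h).ne')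
    (ENNReal.inv_ne_top.2 h0.ne')).2 (ENNReal.inv_lt_inv.2 h)

/-- The optimum for `ρ'` is at most the value of the competitor of the smaller radius `ρ`, which
drops strictly when its weight `1/ρ` becomes `1/ρ'`. -/
theorem strictAntiOn_envelope (ha : ∀ ρ, C ≤ ρ → 0 < ρ → ρ ≠ ⊤ → 0 < a ρ)
    (h : ∀ ρ ρ', C ≤ ρ → 0 < ρ → C ≤ ρ' → 0 < ρ' →
      p ρ + (ρ⁻¹).toReal * a ρ ≤ p ρ' + (ρ⁻¹).toReal * a ρ') :
    StrictAntiOn (envelope p a) {ρ | C ≤ ρ ∧ 0 < ρ} := by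
  rintro ρ ⟨hC, h0⟩ ρ' ⟨hC', h0'⟩ hlt
  refine (h ρ' ρ hC' h0' hC h0).trans_lt ?_
  have := mul_lt_mul_of_pos_right (toReal_inv_lt h0 hlt) (ha ρ hC h0 hlt.ne_top)
  rw [envelope]; linarith

theorem continuousOn_envelope (ha : ∀ ρ, C ≤ ρ → 0 < ρ → 0 ≤ a ρ)
    (h : ∀ ρ ρ', C ≤ ρ → 0 < ρ → C ≤ ρ' → 0 < ρ' →
      p ρ + (ρ⁻¹).toReal * a ρ ≤ p ρ' + (ρ⁻¹).toReal * a ρ') :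
    ContinuousOn (envelope p a) {ρ | C ≤ ρ ∧ 0 < ρ} := by
  -- Adding the minimality at `ρ` tested with `∞` and that at `∞` tested with `ρ` cancels `p`. The
  -- bound makes the envelope Lipschitz in `1/ρ` with constant `a ⊤`.
  have hM : ∀ ρ, C ≤ ρ → 0 < ρ → a ρ ≤ a ⊤ := by
    intro ρ hC h0
    rcases eq_or_ne ρ ⊤ with rfl | ht
    · exact le_rfl
    have h1 := h ρ ⊤ hC h0 le_top ENNReal.zero_lt_top
    have h2 := h ⊤ ρ le_top ENNReal.zero_lt_top hC h0
    simp only [ENNReal.inv_top, ENNReal.toReal_zero, zero_mul, add_zero] at h2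
    have h3 : 0 < (ρ⁻¹).toReal :=
      ENNReal.toReal_pos (ENNReal.inv_ne_zero.2 ht) (ENNReal.inv_ne_top.2 h0.ne')
    exact le_of_mul_le_mul_left (by linarith) h3
  have hle : ∀ ρ ρ', C ≤ ρ → 0 < ρ → C ≤ ρ' → 0 < ρ' →
      envelope p a ρ - envelope p a ρ' ≤ |(ρ⁻¹).toReal - (ρ'⁻¹).toReal| * a ⊤ := by
    intro ρ ρ' hC h0 hC' h0'
    have h1 := h ρ ρ' hC h0 hC' h0'
    have h2 : ((ρ⁻¹).toReal - (ρ'⁻¹).toReal) * a ρ' ≤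
        |(ρ⁻¹).toReal - (ρ'⁻¹).toReal| * a ⊤ :=
      mul_le_mul (le_abs_self _) (hM ρ' hC' h0') (ha ρ' hC' h0') (abs_nonneg _)
    simp only [envelope]; linarith
  rintro ρ₀ ⟨hC, h0⟩
  have hinv : Tendsto (fun ρ : ℝ≥0∞ => |(ρ⁻¹).toReal - (ρ₀⁻¹).toReal| * a ⊤)
      (𝓝[{ρ | C ≤ ρ ∧ 0 < ρ}] ρ₀) (𝓝 0) := by
    have h1 : Tendsto (fun ρ : ℝ≥0∞ => (ρ⁻¹).toReal) (𝓝 ρ₀) (𝓝 (ρ₀⁻¹).toReal) :=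
      (ENNReal.tendsto_toReal (ENNReal.inv_ne_top.2 h0.ne')).comp (tendsto_inv_iff.2
        tendsto_id)
    have h2 := ((h1.sub_const (ρ₀⁻¹).toReal).abs).mul_const (a ⊤)
    simp only [sub_self, abs_zero, zero_mul] at h2
    exact h2.mono_left nhdsWithin_le_nhds
  refine tendsto_iff_dist_tendsto_zero.2 (squeeze_zero' (Eventually.of_forall fun _ =>
    dist_nonneg) ?_ hinv)
  filter_upwards [self_mem_nhdsWithin] with ρ hρ
  rw [Real.dist_eq, abs_le]
  have h1 := hle ρ ρ₀ hρ.1 hρ.2 hC h0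
  have h2 := hle ρ₀ ρ hC h0 hρ.1 hρ.2
  rw [abs_sub_comm] at h2
  exact ⟨by linarith, h1⟩

/-- A strictly decreasing function that is continuous on the positive radii and has its supremum
as its value at `0` is continuous. -/
theorem continuousAt_zero_of_antitone {φ : ℝ≥0∞ → ℝ≥0∞} (h : Antitone φ)
    (h0 : ∀ c < φ 0, ∃ ρ, 0 < ρ ∧ c < φ ρ) : ContinuousAt φ 0 := by
  refine tendsto_order.2 ⟨fun c hc => ?_, fun c hc => ?_⟩
  · obtain ⟨ρ, hρ, hlt⟩ := h0 c hc
    filter_upwards [Iio_mem_nhds hρ] with ρ' hρ' using hlt.trans_le (h hρ'.le)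
  · exact Eventually.of_forall fun ρ => (h zero_le).trans_lt hc

end Envelope

section Radius

theorem radius_pos {l s : ℝ} (hl : 0 < l) : 0 < radius l s :=
  ENNReal.div_pos (ENNReal.ofReal_pos.2 hl).ne' ENNReal.ofReal_ne_top

theorem toReal_inv_radius {l s : ℝ} (hl : 0 < l) (hs : 0 ≤ s) :
    ((radius l s)⁻¹).toReal = s / l := by
  rw [radius, ENNReal.inv_div (Or.inl ENNReal.ofReal_ne_top)
    (Or.inr (ENNReal.ofReal_pos.2 hl).ne'), ENNReal.toReal_div, ENNReal.toReal_ofReal hs,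
    ENNReal.toReal_ofReal hl.le]

theorem radius_lt_radius {l l' s s' : ℝ} (hl : 0 < l) (hll : l ≤ l') (hs : 0 ≤ s')
    (hss : s' < s) : radius l s < radius l' s' := by
  rw [← ENNReal.inv_lt_inv, ← ENNReal.toReal_lt_toReal
    (ENNReal.inv_ne_top.2 (radius_pos (hl.trans_le hll)).ne')
    (ENNReal.inv_ne_top.2 (radius_pos hl).ne'), toReal_inv_radius (hl.trans_le hll) hs,
    toReal_inv_radius hl (hs.trans hss.le)]
  exact div_lt_div₀ hss hll (hs.trans hss.le) hl

theorem continuousAt_radius {α : Type*} [TopologicalSpace α] {l s : α → ℝ} {x : α}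
    (hl : ContinuousAt l x) (hs : ContinuousAt s x) (h : 0 < l x) :
    ContinuousAt (fun x => radius (l x) (s x)) x :=
  ENNReal.Tendsto.div ((ENNReal.continuous_ofReal.tendsto _).comp hl)
    (Or.inl (ENNReal.ofReal_pos.2 h).ne') ((ENNReal.continuous_ofReal.tendsto _).comp hs)
    (Or.inl ENNReal.ofReal_ne_top)

end Radius

/-- Only the radius `0` needs an argument, and it belongs to the interval only if `C = 0`; there
monotonicity reduces continuity to approximating `φ 0` from below. -/
theorem continuousOn_Icc_of_continuousOn_pos {C : ℝ≥0∞} {φ : ℝ≥0∞ → ℝ≥0∞}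
    (h : ContinuousOn φ {ρ | C ≤ ρ ∧ 0 < ρ})
    (ha : StrictAntiOn φ (Icc (C) ⊤))
    (h0 : C = 0 → ∀ c < φ 0, ∃ ρ, 0 < ρ ∧ c < φ ρ) :
    ContinuousOn φ (Icc (C) ⊤) := by
  intro ρ hρ
  rcases eq_or_ne (C) 0 with hC | hC
  · rw [hC] at h ha
    rcases eq_or_ne ρ 0 with rfl | hρ0
    · refine (continuousAt_zero_of_antitone ?_ (h0 hC)).continuousWithinAt
      intro x y hxy
      exact ha.antitoneOn ⟨zero_le, le_top⟩ ⟨zero_le, le_top⟩ hxy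
    · refine (h.continuousAt ?_).continuousWithinAt
      filter_upwards [Ioi_mem_nhds (pos_iff_ne_zero.2 hρ0)] with x hx using ⟨zero_le, hx⟩
  · exact h.mono (fun x hx => ⟨hx.1, (pos_iff_ne_zero.2 hC).trans_le hx.1⟩) ρ hρ

namespace IsTwoBalls

variable {S : Set Plane} {r₁ r₂ d : ℝ} {o : Plane} {b : OrthonormalBasis (Fin 2) ℝ Plane}
  (T : IsTwoBalls S r₁ r₂ d o b)

/-- Perimeter plus area over the radius of the closing. -/
def areaEnvelope (S : Set Plane) : ℝ≥0∞ → ℝ :=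
  envelope (fun ρ => (perimeter (closing ρ S)).toReal) fun ρ => (volume (closing ρ S)).toReal

/-- Perimeter plus added area over the radius of the closing. -/
def diffEnvelope (S : Set Plane) : ℝ≥0∞ → ℝ :=
  envelope (fun ρ => (perimeter (closing ρ S)).toReal) fun ρ => (volume (closing ρ S \ S)).toReal

include T

theorem toReal_le_toReal {ρ ρ' : ℝ≥0∞} (h0 : 0 < ρ) (hρ : connectingRadius S ≤ ρ)
    (hρ' : connectingRadius S ≤ ρ') {v v' : ℝ≥0∞} (hv : v ≠ ⊤) (hv' : v' ≠ ⊤)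
    (h : perimeter (closing ρ S) + v / ρ ≤ perimeter (closing ρ' S) + v' / ρ) :
    (perimeter (closing ρ S)).toReal + (ρ⁻¹).toReal * v.toReal ≤
      (perimeter (closing ρ' S)).toReal + (ρ⁻¹).toReal * v'.toReal := by
  have h1 := (T.perimeter_closing_lt_top hρ).ne
  have h2 := (T.perimeter_closing_lt_top hρ').ne
  have h3 := (ENNReal.div_lt_top hv h0.ne').ne
  have h4 := (ENNReal.div_lt_top hv' h0.ne').ne
  have := ENNReal.toReal_mono (ENNReal.add_ne_top.2 ⟨h2, h4⟩) h
  rw [ENNReal.toReal_add h1 h3, ENNReal.toReal_add h2 h4, div_eq_mul_inv, div_eq_mul_inv,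
    ENNReal.toReal_mul, ENNReal.toReal_mul] at this
  linarith

theorem volume_toReal_pos {ρ : ℝ≥0∞} (hρ : connectingRadius S ≤ ρ) :
    0 < (volume (closing ρ S)).toReal :=
  ENNReal.toReal_pos (T.volume_pos.trans_le (measure_mono (subset_closing S ρ))).ne'
    (T.volume_closing_lt_top hρ).ne

theorem strictAntiOn_areaEnvelope :
    StrictAntiOn (areaEnvelope S) {ρ | connectingRadius S ≤ ρ ∧ 0 < ρ} :=
  strictAntiOn_envelope (fun _ hC _ _ => T.volume_toReal_pos hC) fun _ _ hC h0 hC' _ =>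
    T.toReal_le_toReal h0 hC hC' (T.volume_closing_lt_top hC).ne (T.volume_closing_lt_top hC').ne
      (T.perimeter_add_volume_div_le h0 hC hC')

theorem continuousOn_areaEnvelope :
    ContinuousOn (areaEnvelope S) {ρ | connectingRadius S ≤ ρ ∧ 0 < ρ} :=
  continuousOn_envelope (fun _ _ _ => ENNReal.toReal_nonneg) fun _ _ hC h0 hC' _ =>
    T.toReal_le_toReal h0 hC hC' (T.volume_closing_lt_top hC).ne (T.volume_closing_lt_top hC').ne
      (T.perimeter_add_volume_div_le h0 hC hC')

theorem strictAntiOn_diffEnvelope :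
    StrictAntiOn (diffEnvelope S) {ρ | connectingRadius S ≤ ρ ∧ 0 < ρ} :=
  strictAntiOn_envelope (fun _ hC h0 ht => ENNReal.toReal_pos
    (T.volume_closing_diff_pos h0 ht hC).ne' (T.volume_closing_diff_lt_top hC).ne)
    fun _ _ hC h0 hC' _ => T.toReal_le_toReal h0 hC hC' (T.volume_closing_diff_lt_top hC).ne
      (T.volume_closing_diff_lt_top hC').ne (T.perimeter_add_volume_diff_div_le h0 hC hC')

theorem continuousOn_diffEnvelope :
    ContinuousOn (diffEnvelope S) {ρ | connectingRadius S ≤ ρ ∧ 0 < ρ} :=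
  continuousOn_envelope (fun _ _ _ => ENNReal.toReal_nonneg)
    fun _ _ hC h0 hC' _ => T.toReal_le_toReal h0 hC hC' (T.volume_closing_diff_lt_top hC).ne
      (T.volume_closing_diff_lt_top hC').ne (T.perimeter_add_volume_diff_div_le h0 hC hC')

theorem ofReal_envelope {ρ : ℝ≥0∞} (h0 : 0 < ρ) (hρ : connectingRadius S ≤ ρ) {v : ℝ≥0∞}
    (hv : v ≠ ⊤) : perimeter (closing ρ S) + v / ρ = ENNReal.ofReal
      ((perimeter (closing ρ S)).toReal + (ρ⁻¹).toReal * v.toReal) := by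
  rw [ENNReal.ofReal_add ENNReal.toReal_nonneg (by positivity),
    ENNReal.ofReal_mul ENNReal.toReal_nonneg, ENNReal.ofReal_toReal hv,
    ENNReal.ofReal_toReal (T.perimeter_closing_lt_top hρ).ne,
    ENNReal.ofReal_toReal (ENNReal.inv_ne_top.2 h0.ne'), mul_comm, div_eq_mul_inv]

theorem perimeter_add_volume_div_eq {ρ : ℝ≥0∞} (hρ : connectingRadius S ≤ ρ) (h0 : 0 < ρ) :
    perimeter (closing ρ S) + volume (closing ρ S) / ρ = ENNReal.ofReal (areaEnvelope S ρ) :=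
  T.ofReal_envelope h0 hρ (T.volume_closing_lt_top hρ).ne

theorem perimeter_add_volume_diff_div_eq {ρ : ℝ≥0∞} (hρ : connectingRadius S ≤ ρ) (h0 : 0 < ρ) :
    perimeter (closing ρ S) + volume (closing ρ S \ S) / ρ =
      ENNReal.ofReal (diffEnvelope S ρ) :=
  T.ofReal_envelope h0 hρ (T.volume_closing_diff_lt_top hρ).ne

theorem areaEnvelope_pos {ρ : ℝ≥0∞} (hρ : connectingRadius S ≤ ρ) (h0 : 0 < ρ) (ht : ρ ≠ ⊤) :
    0 < areaEnvelope S ρ :=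
  add_pos_of_nonneg_of_pos ENNReal.toReal_nonneg (mul_pos (ENNReal.toReal_pos
    (ENNReal.inv_ne_zero.2 ht) (ENNReal.inv_ne_top.2 h0.ne')) (T.volume_toReal_pos hρ))

theorem diffEnvelope_pos {ρ : ℝ≥0∞} (hρ : connectingRadius S ≤ ρ) (h0 : 0 < ρ) (ht : ρ ≠ ⊤) :
    0 < diffEnvelope S ρ :=
  add_pos_of_nonneg_of_pos ENNReal.toReal_nonneg (mul_pos (ENNReal.toReal_pos
    (ENNReal.inv_ne_zero.2 ht) (ENNReal.inv_ne_top.2 h0.ne')) (ENNReal.toReal_pos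
    (T.volume_closing_diff_pos h0 ht hρ).ne' (T.volume_closing_diff_lt_top hρ).ne))

theorem strictAntiOn_area_pos : StrictAntiOn
    (fun ρ : ℝ≥0∞ => perimeter (closing ρ S) + volume (closing ρ S) / ρ)
    {ρ | connectingRadius S ≤ ρ ∧ 0 < ρ} := by
  intro ρ hρ ρ' hρ' hlt
  simp only
  rw [T.perimeter_add_volume_div_eq hρ.1 hρ.2, T.perimeter_add_volume_div_eq hρ'.1 hρ'.2]
  exact (ENNReal.ofReal_lt_ofReal_iff (T.areaEnvelope_pos hρ.1 hρ.2 hlt.ne_top)).2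
    (T.strictAntiOn_areaEnvelope hρ hρ' hlt)

theorem strictAntiOn_diff_pos : StrictAntiOn
    (fun ρ : ℝ≥0∞ => perimeter (closing ρ S) + volume (closing ρ S \ S) / ρ)
    {ρ | connectingRadius S ≤ ρ ∧ 0 < ρ} := by
  intro ρ hρ ρ' hρ' hlt
  simp only
  rw [T.perimeter_add_volume_diff_div_eq hρ.1 hρ.2,
    T.perimeter_add_volume_diff_div_eq hρ'.1 hρ'.2]
  exact (ENNReal.ofReal_lt_ofReal_iff (T.diffEnvelope_pos hρ.1 hρ.2 hlt.ne_top)).2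
    (T.strictAntiOn_diffEnvelope hρ hρ' hlt)

theorem strictAntiOn_area : StrictAntiOn
    (fun ρ : ℝ≥0∞ => perimeter (closing ρ S) + volume (closing ρ S) / ρ)
    (Icc (connectingRadius S) ⊤) := by
  intro ρ hρ ρ' hρ' hlt
  rcases eq_or_ne ρ 0 with rfl | h0
  · simp only
    rw [ENNReal.div_zero (T.volume_pos.trans_le (measure_mono (subset_closing S 0))).ne', add_top,
      T.perimeter_add_volume_div_eq hρ'.1 hlt]
    exact ENNReal.ofReal_lt_top
  · have h0 := pos_iff_ne_zero.2 h0
    exact T.strictAntiOn_area_pos ⟨hρ.1, h0⟩ ⟨hρ'.1, h0.trans hlt⟩ hlt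

theorem strictAntiOn_diff : StrictAntiOn
    (fun ρ : ℝ≥0∞ => perimeter (closing ρ S) + volume (closing ρ S \ S) / ρ)
    (Icc (connectingRadius S) ⊤) := by
  intro ρ hρ ρ' hρ' hlt
  rcases eq_or_ne ρ 0 with rfl | h0
  -- Strictness comes from the step between the positive radii `ρ₁` and `ρ'`. The step from `0` to
  -- `ρ₁` is weak: it tests `ρ₁` with `S` itself, whose added area is zero.
  · obtain ⟨ρ₁, h1, h2⟩ := exists_between hlt
    have hC : ∀ ρ, connectingRadius S ≤ ρ := fun ρ => hρ.1.trans zero_le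
    refine (T.strictAntiOn_diff_pos ⟨hC ρ₁, h1⟩ ⟨hC ρ', hlt⟩ h2).trans_le ?_
    have := T.perimeter_add_volume_diff_div_le h1 (hC ρ₁) hρ.1
    simp only [closing_zero, sdiff_self] at this ⊢
    simpa using this
  · have h0 := pos_iff_ne_zero.2 h0
    exact T.strictAntiOn_diff_pos ⟨hρ.1, h0⟩ ⟨hρ'.1, h0.trans hlt⟩ hlt

theorem continuousOn_area_pos : ContinuousOn
    (fun ρ : ℝ≥0∞ => perimeter (closing ρ S) + volume (closing ρ S) / ρ)
    {ρ | connectingRadius S ≤ ρ ∧ 0 < ρ} :=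
  (ENNReal.continuous_ofReal.comp_continuousOn T.continuousOn_areaEnvelope).congr
    fun _ hρ => T.perimeter_add_volume_div_eq hρ.1 hρ.2

theorem continuousOn_diff_pos : ContinuousOn
    (fun ρ : ℝ≥0∞ => perimeter (closing ρ S) + volume (closing ρ S \ S) / ρ)
    {ρ | connectingRadius S ≤ ρ ∧ 0 < ρ} :=
  (ENNReal.continuous_ofReal.comp_continuousOn T.continuousOn_diffEnvelope).congr
    fun _ hρ => T.perimeter_add_volume_diff_div_eq hρ.1 hρ.2

theorem continuousOn_area : ContinuousOn
    (fun ρ : ℝ≥0∞ => perimeter (closing ρ S) + volume (closing ρ S) / ρ)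
    (Icc (connectingRadius S) ⊤) := by
  refine continuousOn_Icc_of_continuousOn_pos T.continuousOn_area_pos T.strictAntiOn_area
    fun hC c hc => ?_
  have hct : c ≠ ⊤ := hc.ne_top
  have hv := T.volume_pos
  have hvt := T.volume_lt_top.ne
  have hlim : Tendsto (fun ρ : ℝ≥0∞ => volume S / ρ) (𝓝[>] 0) (𝓝 ⊤) := by
    have := ENNReal.Tendsto.div (f := 𝓝[>] (0 : ℝ≥0∞)) (tendsto_const_nhds (x := volume S))
      (Or.inl hv.ne') (tendsto_id.mono_left nhdsWithin_le_nhds) (Or.inl ENNReal.zero_ne_top)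
    rwa [ENNReal.div_zero hv.ne'] at this
  obtain ⟨ρ, hρ, hρ0⟩ :=
    ((hlim.eventually (Ioi_mem_nhds hct.lt_top)).and self_mem_nhdsWithin).exists
  refine ⟨ρ, hρ0, lt_of_lt_of_le hρ ?_⟩
  exact (ENNReal.div_le_div_right (measure_mono (subset_closing S ρ)) ρ).trans le_add_self

/-- When the balls touch, `S` is itself a competitor, and its added area is zero. -/
theorem volume_closing_diff_le (hC : connectingRadius S = 0) {ρ : ℝ≥0∞} (h0 : 0 < ρ)
    (ht : ρ ≠ ⊤) : volume (closing ρ S \ S) ≤ ρ * perimeter S := by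
  have hle : ∀ ρ, connectingRadius S ≤ ρ := fun ρ => by rw [hC]; exact zero_le
  have := T.perimeter_add_volume_diff_div_le h0 (hle ρ) (hle 0)
  rw [closing_zero, sdiff_self, measure_empty, ENNReal.zero_div, add_zero] at this
  have h1 := le_add_self.trans this
  rw [ENNReal.div_le_iff h0.ne' ht] at h1
  rwa [mul_comm]

/-- Lower semicontinuity of the perimeter along the closings with small radius. -/
theorem exists_lt_perimeter_closing (hC : connectingRadius S = 0) {c : ℝ≥0∞}
    (hc : c < perimeter S) : ∃ ρ, 0 < ρ ∧ c < perimeter (closing ρ S) := by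
  have hle : ∀ ρ, connectingRadius S ≤ ρ := fun ρ => by rw [hC]; exact zero_le
  have hPS := T.perimeter_closing_lt_top (hle 0)
  rw [closing_zero] at hPS
  have hiv : perimeter S = indicatorVariation S := by
    unfold perimeter
    exact if_pos ⟨T.isOpen.measurableSet.nullMeasurableSet, T.volume_lt_top⟩
  rw [hiv] at hc
  simp only [indicatorVariation, lt_iSup_iff] at hc
  obtain ⟨z, hz, hzc, hz1, hlt⟩ := hc
  have hdc : Continuous (divergence z) := by
    unfold divergence
    refine continuous_finsetSum _ fun i _ => ?_
    exact (EuclideanSpace.proj i : Plane →L[ℝ] ℝ).continuous.comp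
      ((hz.continuous_fderiv (by simp)).clm_apply continuous_const)
  have hdcs : HasCompactSupport (divergence z) := by
    refine (hzc.fderiv ℝ).comp_left (g := fun L : Plane →L[ℝ] Plane =>
      ∑ i : Fin 2, (L (EuclideanSpace.single i 1)) i) (by simp)
  obtain ⟨M, hM⟩ := hdc.bounded_above_of_compact_support hdcs
  have hint : Integrable (divergence z) := hdc.integrable_of_hasCompactSupport hdcs
  set I := ∫ x in S, divergence z x with hI
  -- For a fixed test field with divergence bounded by `M`, the integral over the closing differs
  -- from `I` by at most `M` times the added area, which is at most `r P(S)`.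
  have hlim : Tendsto (fun r : ℝ => ENNReal.ofReal (I - M * (r * (perimeter S).toReal))) (𝓝[>] 0)
      (𝓝 (ENNReal.ofReal I)) := by
    have hcont : Continuous fun r : ℝ =>
        ENNReal.ofReal (I - M * (r * (perimeter S).toReal)) :=
      ENNReal.continuous_ofReal.comp (by fun_prop)
    have := hcont.tendsto 0
    simp only [zero_mul, mul_zero, sub_zero] at this
    exact this.mono_left nhdsWithin_le_nhds
  obtain ⟨r, hr, hr0⟩ := ((hlim.eventually (Ioi_mem_nhds hlt)).and self_mem_nhdsWithin).exists
  have hr0 : 0 < r := hr0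
  have hρ0 : 0 < ENNReal.ofReal r := ENNReal.ofReal_pos.2 hr0
  refine ⟨ENNReal.ofReal r, hρ0, lt_of_lt_of_le hr ?_⟩
  refine le_trans ?_ (indicatorVariation_le_perimeter _)
  refine le_trans (ENNReal.ofReal_le_ofReal ?_) (le_iSup_of_le z (le_iSup_of_le hz
    (le_iSup_of_le hzc (le_iSup_of_le hz1 le_rfl))))
  have hD : volume (closing (ENNReal.ofReal r) S \ S) < ⊤ :=
    T.volume_closing_diff_lt_top (hle _)
  have hsplit : ∫ x in closing (ENNReal.ofReal r) S, divergence z x =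
      I + ∫ x in closing (ENNReal.ofReal r) S \ S, divergence z x := by
    rw [← integral_inter_add_sdiff₀ (s := closing (ENNReal.ofReal r) S) (t := S)
      T.isOpen.measurableSet.nullMeasurableSet hint.integrableOn,
      inter_eq_self_of_subset_right (subset_closing S _)]
  have hbound := norm_setIntegral_le_of_norm_le_const (μ := volume) hD
    (f := divergence z) (C := M) (fun x _ => hM x)
  have hvol : (volume (closing (ENNReal.ofReal r) S \ S)).toReal ≤ r * (perimeter S).toReal := by
    have := ENNReal.toReal_mono (ENNReal.mul_ne_top ENNReal.ofReal_ne_top hPS.ne)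
      (T.volume_closing_diff_le hC hρ0 ENNReal.ofReal_ne_top)
    rwa [ENNReal.toReal_mul, ENNReal.toReal_ofReal hr0.le] at this
  have hM0 : 0 ≤ M := (norm_nonneg _).trans (hM 0)
  have h1 := (abs_le.1 (Real.norm_eq_abs _ ▸ hbound)).1
  have h2 := mul_le_mul_of_nonneg_left hvol hM0
  rw [hsplit]
  simp only [Measure.real] at h1
  linarith

theorem continuousOn_diff : ContinuousOn
    (fun ρ : ℝ≥0∞ => perimeter (closing ρ S) + volume (closing ρ S \ S) / ρ)
    (Icc (connectingRadius S) ⊤) := by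
  refine continuousOn_Icc_of_continuousOn_pos T.continuousOn_diff_pos T.strictAntiOn_diff
    fun hC c hc => ?_
  simp only [closing_zero, sdiff_self, measure_empty, ENNReal.zero_div, add_zero] at hc
  obtain ⟨ρ, hρ, hlt⟩ := T.exists_lt_perimeter_closing hC hc
  exact ⟨ρ, hρ, hlt.trans_le le_self_add⟩

/-- The energy of a connected closing in real terms. -/
theorem energy_closing {l s : ℝ} (hl : 0 < l) (hs : 0 ≤ s)
    (hC : connectingRadius S ≤ radius l s) :
    energy S s l (closing (radius l s) S) =
      ((diffEnvelope S (radius l s) - (1 - s) / l * (volume S).toReal : ℝ) : EReal) := by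
  have hcoe : ∀ v : ℝ≥0∞, v ≠ ⊤ → (v : EReal) = ((v.toReal : ℝ) : EReal) := fun v hv => by
    rw [← EReal.toReal_coe_ennreal, EReal.coe_toReal (by simpa using hv) (by simp)]
  rw [energy, inter_eq_self_of_subset_right (subset_closing S _),
    hcoe _ (T.perimeter_closing_lt_top hC).ne, hcoe _ (T.volume_closing_diff_lt_top hC).ne,
    hcoe _ T.volume_lt_top.ne, diffEnvelope, envelope, toReal_inv_radius hl hs]
  push_cast
  rfl

/-- Since `s/l + (1 - s)/l = 1/l`, passing from the added area to the full area leaves a term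
independent of `s`, as needed for varying `s`. -/
theorem diffEnvelope_sub {l s : ℝ} (hl : 0 < l) (hs : 0 ≤ s)
    (hC : connectingRadius S ≤ radius l s) :
    diffEnvelope S (radius l s) - (1 - s) / l * (volume S).toReal =
      areaEnvelope S (radius l s) - 1 / l * (volume S).toReal := by
  have h := T.volume_closing_diff_add (ρ := radius l s)
  have h1 := congrArg ENNReal.toReal h
  rw [ENNReal.toReal_add (T.volume_closing_diff_lt_top hC).ne T.volume_lt_top.ne] at h1
  simp only [diffEnvelope, areaEnvelope, envelope, toReal_inv_radius hl hs, ← h1]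
  ring

/-- The weight of `|S|` is the constant `1/k`, and the radius increases strictly with `l`, so
everything is inherited from the envelope with the added area. -/
theorem energy_varying_length {k : ℝ} (hk : 0 < k) :
    ContinuousOn (fun l : ℝ => energy S (1 - l / k) l (closing (radius l (1 - l / k)) S))
        {l : ℝ | 0 < l ∧ 0 ≤ 1 - l / k ∧ connectingRadius S ≤ radius l (1 - l / k)} ∧
      StrictAntiOn (fun l : ℝ => energy S (1 - l / k) l (closing (radius l (1 - l / k)) S))
        {l : ℝ | 0 < l ∧ 0 ≤ 1 - l / k ∧ connectingRadius S ≤ radius l (1 - l / k)} := by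
  have heq : ∀ l ∈ {l : ℝ | 0 < l ∧ 0 ≤ 1 - l / k ∧
      connectingRadius S ≤ radius l (1 - l / k)},
      energy S (1 - l / k) l (closing (radius l (1 - l / k)) S) =
        ((diffEnvelope S (radius l (1 - l / k)) - 1 / k * (volume S).toReal : ℝ) : EReal) := by
    rintro l ⟨h1, h2, h3⟩
    rw [T.energy_closing h1 h2 h3]
    have : (1 - (1 - l / k)) / l = 1 / k := by field_simp; ring
    rw [this]
  constructor
  · refine (continuous_coe_real_ereal.comp_continuousOn ?_).congr heq
    refine ContinuousOn.sub (T.continuousOn_diffEnvelope.comp (fun l hl => ?_)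
      fun l hl => ⟨hl.2.2, radius_pos hl.1⟩) continuousOn_const
    exact (continuousAt_radius continuousAt_id (by fun_prop) hl.1).continuousWithinAt
  · intro l hl l' hl' hlt
    simp only
    rw [heq l hl, heq l' hl', EReal.coe_lt_coe_iff]
    have := T.strictAntiOn_diffEnvelope ⟨hl.2.2, radius_pos hl.1⟩ ⟨hl'.2.2, radius_pos hl'.1⟩
      (radius_lt_radius hl.1 hlt.le hl'.2.1 (by gcongr))
    linarith

theorem energy_varying_ratio {l : ℝ} (hl : 0 < l) :
    ContinuousOn (fun s : ℝ => energy S s l (closing (radius l s) S))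
        {s : ℝ | 0 ≤ s ∧ connectingRadius S ≤ radius l s} ∧
      StrictMonoOn (fun s : ℝ => energy S s l (closing (radius l s) S))
        {s : ℝ | 0 ≤ s ∧ connectingRadius S ≤ radius l s} := by
  have heq : ∀ s ∈ {s : ℝ | 0 ≤ s ∧ connectingRadius S ≤ radius l s},
      energy S s l (closing (radius l s) S) =
        ((areaEnvelope S (radius l s) - 1 / l * (volume S).toReal : ℝ) : EReal) := by
    rintro s ⟨h1, h2⟩
    rw [T.energy_closing hl h1 h2, T.diffEnvelope_sub hl h1 h2]
  constructor
  · refine (continuous_coe_real_ereal.comp_continuousOn ?_).congr heq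
    refine ContinuousOn.sub (T.continuousOn_areaEnvelope.comp (fun s hs => ?_)
      fun s hs => ⟨hs.2, radius_pos hl⟩) continuousOn_const
    exact (continuousAt_radius continuousAt_const continuousAt_id hl).continuousWithinAt
  · intro s hs s' hs' hlt
    simp only
    rw [heq s hs, heq s' hs', EReal.coe_lt_coe_iff]
    have := T.strictAntiOn_areaEnvelope ⟨hs'.2, radius_pos hl⟩ ⟨hs.2, radius_pos hl⟩
      (radius_lt_radius hl le_rfl hs.1 hlt)
    linarith

end IsTwoBalls

end

end TwoBalls

end

theorem mainTheorem5 (c₁ c₂ : TwoBalls.Plane) (r₁ r₂ : ℝ) (hr₁ : 0 < r₁) (hr₂ : 0 < r₂)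
    (hdisj : Disjoint (Metric.ball c₁ r₁) (Metric.ball c₂ r₂))
    (S : Set TwoBalls.Plane) (hS : S = Metric.ball c₁ r₁ ∪ Metric.ball c₂ r₂) :
    -- the connecting radius is finite and is the connectedness threshold,
    -- and the closings in question have finite perimeter
    (TwoBalls.connectingRadius S < ⊤ ∧
      (∀ r : ℝ≥0∞, 0 < r →
        (IsConnected (TwoBalls.closing r S) ↔ TwoBalls.connectingRadius S ≤ r)) ∧
      (∀ r : ℝ≥0∞, TwoBalls.connectingRadius S ≤ r →
        TwoBalls.perimeter (TwoBalls.closing r S) < ⊤)) ∧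
    -- (i)
    (∀ k : ℝ, 0 < k →
      ContinuousOn
        (fun l : ℝ => TwoBalls.energy S (1 - l / k) l
          (TwoBalls.closing (TwoBalls.radius l (1 - l / k)) S))
        {l : ℝ | 0 < l ∧ 0 ≤ 1 - l / k ∧
          TwoBalls.connectingRadius S ≤ TwoBalls.radius l (1 - l / k)} ∧
      StrictAntiOn
        (fun l : ℝ => TwoBalls.energy S (1 - l / k) l
          (TwoBalls.closing (TwoBalls.radius l (1 - l / k)) S))
        {l : ℝ | 0 < l ∧ 0 ≤ 1 - l / k ∧
          TwoBalls.connectingRadius S ≤ TwoBalls.radius l (1 - l / k)}) ∧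
    -- (ii)
    (∀ l : ℝ, 0 < l →
      ContinuousOn
        (fun s : ℝ => TwoBalls.energy S s l (TwoBalls.closing (TwoBalls.radius l s) S))
        {s : ℝ | 0 ≤ s ∧ TwoBalls.connectingRadius S ≤ TwoBalls.radius l s} ∧
      StrictMonoOn
        (fun s : ℝ => TwoBalls.energy S s l (TwoBalls.closing (TwoBalls.radius l s) S))
        {s : ℝ | 0 ≤ s ∧ TwoBalls.connectingRadius S ≤ TwoBalls.radius l s}) ∧
    -- (iii)
    (ContinuousOn
        (fun r : ℝ≥0∞ => TwoBalls.perimeter (TwoBalls.closing r S)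
          + MeasureTheory.volume (TwoBalls.closing r S) / r)
        (Set.Icc (TwoBalls.connectingRadius S) ⊤) ∧
      StrictAntiOn
        (fun r : ℝ≥0∞ => TwoBalls.perimeter (TwoBalls.closing r S)
          + MeasureTheory.volume (TwoBalls.closing r S) / r)
        (Set.Icc (TwoBalls.connectingRadius S) ⊤)) ∧
    (ContinuousOn
        (fun r : ℝ≥0∞ => TwoBalls.perimeter (TwoBalls.closing r S)
          + MeasureTheory.volume (TwoBalls.closing r S \ S) / r)
        (Set.Icc (TwoBalls.connectingRadius S) ⊤) ∧
      StrictAntiOn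
        (fun r : ℝ≥0∞ => TwoBalls.perimeter (TwoBalls.closing r S)
          + MeasureTheory.volume (TwoBalls.closing r S \ S) / r)
        (Set.Icc (TwoBalls.connectingRadius S) ⊤)) := by
  subst hS
  obtain ⟨d, b, T⟩ := TwoBalls.exists_isTwoBalls hr₁ hr₂ hdisj
  exact ⟨⟨T.connectingRadius_lt_top, fun r hr => T.isConnected_closing_iff hr,
    fun r hr => T.perimeter_closing_lt_top hr⟩,
    fun k hk => T.energy_varying_length hk, fun l hl => T.energy_varying_ratio hl,
    ⟨T.continuousOn_area, T.strictAntiOn_area⟩, ⟨T.continuousOn_diff, T.strictAntiOn_diff⟩⟩
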